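/- Let $n\ge 1$ and let $\nu=(\nu_{ij})$ be a doubly stochastic $n\times n$ matrix with $\nu_{\min}:=\min_{ij}\nu_{ij}>0$. Write $\|x\|=\big(\sum_{ij}x_{ij}^2\big)^{1/2}$, and let $a_{\max}\ge 1$. For every $0<\epsilon<1$ consider an $n\times n$ switch with queue lengths $q^{(\epsilon)}(t)\in\mathbb Z_{\ge 0}^{n\times n}$ that evolve, from arbitrary initial queue lengths, by $$q^{(\epsilon)}_{ij}(t+1)=\big[q^{(\epsilon)}_{ij}(t)+a^{(\epsilon)}_{ij}(t)-s^{(\epsilon)}_{ij}(t)\big]^+ .$$ The arrivals $a^{(\epsilon)}_{ij}(t)\in\mathbb Z_{\ge 0}$ are i.i.d. over time, independent across pairs $(i,j)$, and independent of the past and of the schedule of the same time slot; they satisfy $a^{(\epsilon)}_{ij}(t)\le a_{\max}$ with $a_{\max}$ not depending on $\epsilon$, $P(a^{(\epsilon)}_{ij}(t)=0)>\epsilon_a$ for some $\epsilon_a>0$, and have mean $\lambda^{(\epsilon)}_{ij}=(1-\epsilon)\nu_{ij}$ and variance $(\sigma^{(\epsilon)}_{ij})^2$. The schedule $s^{(\epsilon)}(t)$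 is chosen by MaxWeight: it is an $n\times n$ permutation matrix that maximizes $\sum_{ij}q^{(\epsilon)}_{ij}(t)s_{ij}$ over all $0/1$ matrices $s$ with at most a single one in each row and each column; ties between such permutation matrices are broken uniformly at random, independently of everything else. For $r\in\{2,3,\dots\}$ put $$M_r^{(\epsilon)}=2^{1/r}\max\left(\frac{8\big(\|\lambda^{(\epsilon)}\|^2+\|\sigma^{(\epsilon)}\|^2+n\big)}{\nu_{\min}},\ (\sqrt r\,e)^{1/r}\,16\,\frac re\,\frac{n a_{\max}}{\nu_{\min}}\,(n a_{\max}+1)\right),$$ $$B_1(\epsilon,n)=-\frac{n\epsilon}{2}+n+3n^{2-1/r}\epsilon^{-1/r}M_r^{(\epsilon)},\qquad B_2(\epsilon,n)=\frac{n(1+\epsilon)}{2}+2n^{2-1/r}\epsilon^{-1/r}M_r^{(\epsilon)} .$$ Then, for every $0<\epsilon<1$, the queue length process has a unique stationary distribution, and $q^{(\epsilon)}(t)$ converges in distribution, as $t\to\infty$, to a random array $\bar q^{(\epsilon)}$ with that distribution. For every $0<\epsilon\le\nu_{\min}/(2\|\nu\|)$ the mean $E\big[\sum_{ij}\bar q^{(\epsilon)}_{ij}\big]$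 is finite, and for every $r\in\{2,3,\dots\}$ $$\Big(1-\frac1{2n}\Big)\frac{\|\sigma^{(\epsilon)}\|^2}{\epsilon}-B_1(\epsilon,n)\ \le\ E\Big[\sum_{ij}\bar q^{(\epsilon)}_{ij}\Big]\ \le\ \Big(1-\frac1{2n}\Big)\frac{\|\sigma^{(\epsilon)}\|^2}{\epsilon}+B_2(\epsilon,n).$$ For every such $r$, both error terms are $o(1/\epsilon)$: $\lim_{\epsilon\downarrow0}\epsilon B_1(\epsilon,n)=\lim_{\epsilon\downarrow0}\epsilon B_2(\epsilon,n)=0$. Consequently, if $(\sigma^{(\epsilon)}_{ij})^2\to\sigma_{ij}^2$ for all $i,j$ as $\epsilon\downarrow 0$, then $$\lim_{\epsilon\downarrow0}\epsilon\,E\Big[\sum_{ij}\bar q^{(\epsilon)}_{ij}\Big]=\Big(1-\frac1{2n}\Big)\|\sigma\|^2 .$$ -/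

import Mathlib

open MeasureTheory ProbabilityTheory Filter Topology

noncomputable section

namespace MaxWeightSwitch

/-- `n × n` arrays of natural numbers: vectors of queue lengths, of arrivals, or schedules.
Entry `(i, j)` belongs to input port `i` and output port `j`. -/
abbrev NatArray (n : ℕ) := Fin n → Fin n → ℕ

/-- Feasible schedules: `0/1` arrays (matchings of the complete bipartite graph) in which each
row and each column contains at most a single one. -/
def IsFeasible {n : ℕ} (s : NatArray n) : Prop :=
  (∀ i j, s i j = 0 ∨ s i j = 1) ∧ (∀ i, ∑ j, s i j ≤ 1) ∧ (∀ j, ∑ i, s i j ≤ 1)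

/-- Maximal feasible schedules: each row and each column contains exactly a single one
(perfect matchings). -/
def IsMaximal {n : ℕ} (s : NatArray n) : Prop :=
  (∀ i j, s i j = 0 ∨ s i j = 1) ∧ (∀ i, ∑ j, s i j = 1) ∧ (∀ j, ∑ i, s i j = 1)

/-- The weight `⟨q, s⟩` of the schedule `s` when the queue lengths are `q`. -/
def weight {n : ℕ} (q s : NatArray n) : ℕ := ∑ i, ∑ j, q i j * s i j

/-- The schedules among which MaxWeight chooses when the queue lengths are `q`: the maximal
schedules whose weight is maximum among all feasible schedules. -/
def maxWeightSchedules {n : ℕ} (q : NatArray n) : Set (NatArray n) :=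
  {s | IsMaximal s ∧ ∀ s', IsFeasible s' → weight q s' ≤ weight q s}

/-- What has been observed before the schedule of time slot `t` is drawn: the queue lengths up to
and including time `t`, the arrivals and the schedules before time `t`. -/
abbrev past {n : ℕ} {Ω : Type*} (a s q : ℕ → Ω → NatArray n) (t : ℕ) : MeasurableSpace Ω :=
  (⨆ k ∈ Set.Iic t, MeasurableSpace.comap (q k) inferInstance) ⊔
    ⨆ k ∈ Set.Iio t, (MeasurableSpace.comap (a k) inferInstance ⊔
      MeasurableSpace.comap (s k) inferInstance)

/-- `a t`, `s t`, `q t` are the arrivals, the schedule and the queue lengths of time slot `t` in an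
`n × n` switch operating under MaxWeight, on the probability space `(Ω, P)`; the numbers of arrivals
are bounded by `amax`. The initial queue lengths `q 0` are arbitrary. -/
structure IsMaxWeightSwitch {n : ℕ} {Ω : Type*} [MeasurableSpace Ω] (P : Measure Ω) (amax : ℝ)
    (a s q : ℕ → Ω → NatArray n) : Prop where
  measurable_arrival : ∀ t, Measurable (a t)
  measurable_schedule : ∀ t, Measurable (s t)
  measurable_queue : ∀ t, Measurable (q t)
  /-- The arrivals are independent across time slots and across input-output pairs. -/
  iIndepFun_arrival : iIndepFun
    (fun (k : ℕ × Fin n × Fin n) (ω : Ω) => a k.1 ω k.2.1 k.2.2) P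
  /-- For every input-output pair, the arrivals are identically distributed across time slots. -/
  identDistrib_arrival : ∀ t i j,
    IdentDistrib (fun ω => a t ω i j) (fun ω => a 0 ω i j) P P
  /-- The arrivals of slot `t` are independent of the past and of the schedule of slot `t`. -/
  indep_arrival : ∀ t, Indep (MeasurableSpace.comap (a t) inferInstance)
    (past a s q t ⊔ MeasurableSpace.comap (s t) inferInstance) P
  arrival_le : ∀ t i j, ∀ᵐ ω ∂P, (a t ω i j : ℝ) ≤ amax
  arrival_zero : ∃ εa : ℝ, 0 < εa ∧ ∀ t i j, εa < P.real {ω | a t ω i j = 0}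
  /-- Given the past, the schedule is uniformly distributed on the MaxWeight schedules. -/
  schedule_law : ∀ (t : ℕ) (A : Set Ω) (S : Set (NatArray n)), MeasurableSet[past a s q t] A →
    P (A ∩ s t ⁻¹' S) = ∫⁻ ω in A, uniformOn (maxWeightSchedules (q t ω)) S ∂P
  /-- The queue evolution `q(t+1) = [q(t) + a(t) - s(t)]⁺` (subtraction in `ℕ` truncates). -/
  queue_succ : ∀ t ω i j, q (t + 1) ω i j = q t ω i j + a t ω i j - s t ω i j

/-- The law of the queue lengths after one time slot, started from `x`, when the arrivals have
law `α`: the schedule is uniform on the MaxWeight schedules and independent of the arrivals. -/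
def stepLaw {n : ℕ} (α : Measure (NatArray n)) (x : NatArray n) : Measure (NatArray n) :=
  ((uniformOn (maxWeightSchedules x)).prod α).map (fun p i j => x i j + p.2 i j - p.1 i j)

/-- `π` is a stationary law of the queue length Markov chain under MaxWeight when the arrivals of
a time slot have law `α`. -/
def IsStationaryLaw {n : ℕ} (α π : Measure (NatArray n)) : Prop :=
  π.bind (stepLaw α) = π

/-- The Euclidean norm on `ℝ^(n²)`. -/
def vnorm {n : ℕ} (x : Matrix (Fin n) (Fin n) ℝ) : ℝ := √(∑ i, ∑ j, x i j ^ 2)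

/-- The smallest entry (for `n ≥ 1`). -/
def minEntry {n : ℕ} (x : Matrix (Fin n) (Fin n) ℝ) : ℝ := ⨅ k : Fin n × Fin n, x k.1 k.2

/-- The state space collapse constant `M_r` of a switch with mean arrival rates `lam`, standard
deviations `σ` and arrivals bounded by `amax`, where `νmin` is the smallest entry of `ν`. -/
def collapseConst {n : ℕ} (lam σ : Matrix (Fin n) (Fin n) ℝ) (νmin amax : ℝ) (r : ℕ) : ℝ :=
  2 ^ (1 / (r : ℝ)) *
    max (8 * (vnorm lam ^ 2 + vnorm σ ^ 2 + n) / νmin)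
      ((√(r : ℝ) * Real.exp 1) ^ (1 / (r : ℝ)) * 16 * (r / Real.exp 1) * (n * amax / νmin)
        * (n * amax + 1))

/-- The error term `B₁(ε, n)` of the lower bound; `M` is the constant `M_r` of the system. -/
def lowerError (n r : ℕ) (ε M : ℝ) : ℝ :=
  -(n * ε / 2) + n + 3 * (n : ℝ) ^ (2 - 1 / (r : ℝ)) * ε ^ (-(1 / (r : ℝ))) * M

/-- The error term `B₂(ε, n)` of the upper bound; `M` is the constant `M_r` of the system. -/
def upperError (n r : ℕ) (ε M : ℝ) : ℝ :=
  n * (1 + ε) / 2 + 2 * (n : ℝ) ^ (2 - 1 / (r : ℝ)) * ε ^ (-(1 / (r : ℝ))) * M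

/-- The total queue length. -/
def totalQueue {n : ℕ} (x : NatArray n) : ℝ := ∑ i, ∑ j, (x i j : ℝ)

end MaxWeightSwitch

end

open MaxWeightSwitch

/-! Let P be the orthogonal projection onto the arrays of the form w i + w' j, and test stationarity
of the queue length chain on ‖Pq‖². With arrivals a, schedule s, unused service u and next queue
lengths q⁺ = q + a - s + u, zero expected drift reads 0 = 2E⟨Pq, P(a-s)⟩ + E‖P(a-s)‖² + 2E⟨Pq⁺, Pu⟩
- E‖Pu‖². Permutation matrices and ν have all row and column sums equal to 1, so the first term is
-2ε/n times the mean total queue length, whatever the schedule (`integral_addProj`). Variances of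
independent arrivals add up over rows, columns and the whole array, so the second term is (2/n -
1/n²)‖σ‖² + ε² (`integral_norm_sq_addProj`). Solving for the mean total, that is multiplying by
n/(2ε), produces the factor 1 - 1/(2n). The last term is at most 2ε, because the mean total unused
service is nε.

The third term is small by state space collapse. Since ⟨q⁺, u⟩ = 0, it is controlled by the distance
of q⁺ to the cone of nonnegative additive arrays times ‖u‖ (`abs_inner_addProj_unused_le`). As all
entries of ν are positive, ν can be moved in the direction of the deviation from the cone without
leaving the doubly substochastic matrices, among which MaxWeight is optimal. Hence the distance has
a negative drift that does not vanish with ε (`inner_sub_coneProj_le`), and, its jumps being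
bounded, its stationary moments are at most M_r^r (`integrable_and_integral_coneDist_pow_le`).
Hölder's inequality, in the pointwise form `mul_le_young`, then bounds the third term by a multiple
of M_r (nε)^(1-1/r).

The steady state comes from Harris' theorem: an exponential of ‖q‖ is a Lyapunov function with
geometric drift, and slots without arrivals empty the switch with positive probability.
`Averaging.IsHarris.exists_invariant` gives a limit law that attracts every initial state and has
all moments, so that the zero-drift identity `integrable_avg_and_integral_avg` applies to the test
functions above. -/

namespace MaxWeightSwitch

/-! ### Geometry of arrays -/

/-- Real `n × n` arrays with the Euclidean norm. -/
abbrev ArrayVec (n : ℕ) := EuclideanSpace ℝ (Fin n × Fin n)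

/-- A natural number array as a Euclidean vector. -/
def vec {n : ℕ} (x : NatArray n) : ArrayVec n := WithLp.toLp 2 fun p => (x p.1 p.2 : ℝ)

/-- A real matrix as a Euclidean vector. -/
def matVec {n : ℕ} (x : Matrix (Fin n) (Fin n) ℝ) : ArrayVec n :=
  WithLp.toLp 2 fun p => x p.1 p.2

variable {n : ℕ}

@[simp] lemma vec_apply (x : NatArray n) (p : Fin n × Fin n) : vec x p = x p.1 p.2 := rfl

@[simp] lemma matVec_apply (x : Matrix (Fin n) (Fin n) ℝ) (p : Fin n × Fin n) :
    matVec x p = x p.1 p.2 := rfl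

lemma inner_eq_sum (x y : ArrayVec n) : inner ℝ x y = ∑ i, ∑ j, x (i, j) * y (i, j) := by
  rw [PiLp.inner_apply, Fintype.sum_prod_type]
  simp [mul_comm]

lemma norm_sq_eq_sum (x : ArrayVec n) : ‖x‖ ^ 2 = ∑ i, ∑ j, x (i, j) ^ 2 := by
  rw [← real_inner_self_eq_norm_sq, inner_eq_sum]
  simp [sq]

lemma norm_matVec (x : Matrix (Fin n) (Fin n) ℝ) : ‖matVec x‖ = vnorm x := by
  rw [vnorm, ← Real.sqrt_sq (norm_nonneg (matVec x)), norm_sq_eq_sum]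
  simp

lemma vnorm_sq (x : Matrix (Fin n) (Fin n) ℝ) : vnorm x ^ 2 = ∑ i, ∑ j, x i j ^ 2 := by
  rw [← norm_matVec, norm_sq_eq_sum]; simp

lemma abs_apply_le_norm (x : ArrayVec n) (p : Fin n × Fin n) : |x p| ≤ ‖x‖ := by
  simpa using PiLp.norm_apply_le x p

lemma totalQueue_nonneg (x : NatArray n) : 0 ≤ totalQueue x := by
  unfold totalQueue; positivity

lemma norm_vec_le_totalQueue (x : NatArray n) : ‖vec x‖ ≤ totalQueue x := by
  refine abs_le_of_sq_le_sq' ?_ (totalQueue_nonneg x) |>.2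
  rw [norm_sq_eq_sum, totalQueue, ← Fintype.sum_prod_type', ← Fintype.sum_prod_type']
  exact Finset.sum_sq_le_sq_sum_of_nonneg (fun p _ => Nat.cast_nonneg (x p.1 p.2))

lemma totalQueue_le (x : NatArray n) : totalQueue x ≤ n ^ 2 * ‖vec x‖ := by
  have h : ∀ i j, (x i j : ℝ) ≤ ‖vec x‖ := fun i j =>
    (le_abs_self _).trans (abs_apply_le_norm (vec x) (i, j))
  calc totalQueue x ≤ ∑ _i : Fin n, ∑ _j : Fin n, ‖vec x‖ :=
        Finset.sum_le_sum fun i _ => Finset.sum_le_sum fun j _ => h i j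
    _ = _ := by simp; ring

/-! ### Doubly substochastic matrices and MaxWeight -/

/-- The row deficits r and the column deficits c have the same total D, so adding the rank one
matrix r i * c j / D repairs all sums at once. -/
lemma exists_doublyStochastic_ge {M : Matrix (Fin n) (Fin n) ℝ} (h0 : ∀ i j, 0 ≤ M i j)
    (hr : ∀ i, ∑ j, M i j ≤ 1) (hc : ∀ j, ∑ i, M i j ≤ 1) :
    ∃ N ∈ doublyStochastic ℝ (Fin n), ∀ i j, M i j ≤ N i j := by
  set r : Fin n → ℝ := fun i => 1 - ∑ j, M i j with hrdef
  set c : Fin n → ℝ := fun j => 1 - ∑ i, M i j with hcdef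
  set D := ∑ i, r i with hD
  have hr0 : ∀ i, 0 ≤ r i := fun i => sub_nonneg.2 (hr i)
  have hc0 : ∀ j, 0 ≤ c j := fun j => sub_nonneg.2 (hc j)
  have hD' : D = ∑ j, c j := by
    simp only [hD, hrdef, hcdef, Finset.sum_sub_distrib]
    rw [Finset.sum_comm]
  have hD0 : 0 ≤ D := Finset.sum_nonneg fun i _ => hr0 i
  -- If D = 0, all deficits vanish, so division by zero does no harm.
  have hrD : ∀ i, r i * D / D = r i := by
    intro i
    by_cases h : D = 0
    · have : r i = 0 := (Finset.sum_eq_zero_iff_of_nonneg fun i _ => hr0 i).1 h i (by simp)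
      simp [this]
    · field_simp
  have hcD : ∀ j, c j * D / D = c j := by
    intro j
    by_cases h : D = 0
    · have : c j = 0 :=
        (Finset.sum_eq_zero_iff_of_nonneg fun i _ => hc0 i).1 (hD' ▸ h) j (by simp)
      simp [this]
    · field_simp
  refine ⟨Matrix.of fun i j => M i j + r i * c j / D, ?_, fun i j => ?_⟩
  · rw [mem_doublyStochastic_iff_sum]
    simp only [Matrix.of_apply]
    refine ⟨fun i j => ?_, fun i => ?_, fun j => ?_⟩
    · have := h0 i j; have := hr0 i; have := hc0 j; positivity
    · rw [Finset.sum_add_distrib, ← Finset.sum_div, ← Finset.mul_sum, ← hD', hrD]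
      simp [hrdef]
    · rw [Finset.sum_add_distrib, ← Finset.sum_div, ← Finset.sum_mul, ← hD, mul_comm, hcD]
      simp [hcdef]
  · have := hr0 i; have := hc0 j
    have : 0 ≤ r i * c j / D := by positivity
    simp only [Matrix.of_apply]; linarith

/-- The schedule of a permutation. -/
def permSchedule (e : Equiv.Perm (Fin n)) : NatArray n := fun i j => if e i = j then 1 else 0

lemma isMaximal_permSchedule (e : Equiv.Perm (Fin n)) : IsMaximal (permSchedule e) := by
  refine ⟨fun i j => ?_, fun i => ?_, fun j => ?_⟩
  · unfold permSchedule; split_ifs <;> simp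
  · simp [permSchedule]
  · simp only [permSchedule]
    rw [Finset.sum_eq_single (e.symm j)] <;> simp
    intro i h h'; exact h (by simp [← h'])

/-- Some permutation schedule has maximum weight among all doubly substochastic matrices. -/
lemma exists_perm_weight_max (q : NatArray n) : ∃ e : Equiv.Perm (Fin n),
    ∀ M : Matrix (Fin n) (Fin n) ℝ, (∀ i j, 0 ≤ M i j) → (∀ i, ∑ j, M i j ≤ 1) →
      (∀ j, ∑ i, M i j ≤ 1) → ∑ i, ∑ j, (q i j : ℝ) * M i j ≤ weight q (permSchedule e) := by
  obtain ⟨e, he⟩ := Finite.exists_max fun e : Equiv.Perm (Fin n) => weight q (permSchedule e)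
  refine ⟨e, fun M h0 hr hc => ?_⟩
  obtain ⟨N, hN, hMN⟩ := exists_doublyStochastic_ge h0 hr hc
  have h1 : ∑ i, ∑ j, (q i j : ℝ) * M i j ≤ ∑ i, ∑ j, (q i j : ℝ) * N i j :=
    Finset.sum_le_sum fun i _ => Finset.sum_le_sum fun j _ =>
      mul_le_mul_of_nonneg_left (hMN i j) (by positivity)
  refine h1.trans ?_
  have hconv : Convex ℝ {A : Matrix (Fin n) (Fin n) ℝ |
      ∑ i, ∑ j, (q i j : ℝ) * A i j ≤ weight q (permSchedule e)} := by
    intro A hA B hB a b ha hb hab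
    simp only [Set.mem_ofPred_eq, Matrix.add_apply, Matrix.smul_apply, smul_eq_mul] at *
    have : ∑ i, ∑ j, (q i j : ℝ) * (a * A i j + b * B i j) =
        a * (∑ i, ∑ j, (q i j : ℝ) * A i j) + b * (∑ i, ∑ j, (q i j : ℝ) * B i j) := by
      simp only [Finset.mul_sum, ← Finset.sum_add_distrib]
      exact Finset.sum_congr rfl fun i _ => Finset.sum_congr rfl fun j _ => by ring
    rw [this]
    calc _ ≤ a * (weight q (permSchedule e) : ℝ) + b * weight q (permSchedule e) := by gcongr
      _ = _ := by rw [← add_mul, hab, one_mul]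
  -- Birkhoff's theorem: a half-space containing all permutation matrices contains their convex
  -- hull.
  have hsub : (doublyStochastic ℝ (Fin n) : Set (Matrix (Fin n) (Fin n) ℝ)) ⊆
      {A | ∑ i, ∑ j, (q i j : ℝ) * A i j ≤ weight q (permSchedule e)} := by
    rw [doublyStochastic_eq_convexHull_permMatrix]
    refine convexHull_min ?_ hconv
    rintro _ ⟨e', rfl⟩
    have h2 : (weight q (permSchedule e') : ℝ) ≤ weight q (permSchedule e) := by exact_mod_cast he e'
    refine le_trans (le_of_eq ?_) h2
    simp only [weight, Nat.cast_sum, Nat.cast_mul]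
    refine Finset.sum_congr rfl fun i _ => Finset.sum_congr rfl fun j _ => ?_
    simp [permSchedule, Equiv.Perm.permMatrix, PEquiv.toMatrix_apply, Equiv.toPEquiv_apply,
      eq_comm]
  exact hsub hN

lemma IsFeasible.sum_le {s : NatArray n} (hs : IsFeasible s) (q : NatArray n)
    (e : Equiv.Perm (Fin n))
    (he : ∀ M : Matrix (Fin n) (Fin n) ℝ, (∀ i j, 0 ≤ M i j) → (∀ i, ∑ j, M i j ≤ 1) →
      (∀ j, ∑ i, M i j ≤ 1) → ∑ i, ∑ j, (q i j : ℝ) * M i j ≤ weight q (permSchedule e)) :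
    weight q s ≤ weight q (permSchedule e) := by
  have := he (fun i j => s i j) (fun i j => by positivity) (fun i => by exact_mod_cast hs.2.1 i)
    (fun j => by exact_mod_cast hs.2.2 j)
  have h2 : ∑ i, ∑ j, (q i j : ℝ) * (s i j : ℝ) = weight q s := by simp [weight]
  rw [h2] at this
  exact_mod_cast this

lemma IsMaximal.isFeasible {s : NatArray n} (hs : IsMaximal s) : IsFeasible s :=
  ⟨hs.1, fun i => (hs.2.1 i).le, fun j => (hs.2.2 j).le⟩

lemma maxWeightSchedules_nonempty (q : NatArray n) : (maxWeightSchedules q).Nonempty := by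
  obtain ⟨e, he⟩ := exists_perm_weight_max q
  exact ⟨permSchedule e, isMaximal_permSchedule e, fun s' hs' => hs'.sum_le q e he⟩

lemma finite_setOf_le (N : ℕ) : {x : NatArray n | ∀ i j, x i j ≤ N}.Finite := by
  have : {x : NatArray n | ∀ i j, x i j ≤ N} = Set.Iic (fun _ _ => N) := by
    ext x; simp [Pi.le_def]
  rw [this]
  exact Set.finite_Iic _

lemma maxWeightSchedules_finite (q : NatArray n) : (maxWeightSchedules q).Finite := by
  refine (finite_setOf_le 1).subset fun s hs i j => ?_
  rcases hs.1.1 i j with h | h <;> omega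

/-- MaxWeight competes with 0/1 schedules only, but some permutation is optimal among fractional
ones too. This is what allows comparison with ν and its perturbations. -/
lemma sum_mul_le_inner {q s : NatArray n} (hs : s ∈ maxWeightSchedules q)
    {M : Matrix (Fin n) (Fin n) ℝ} (h0 : ∀ i j, 0 ≤ M i j)
    (hr : ∀ i, ∑ j, M i j ≤ 1) (hc : ∀ j, ∑ i, M i j ≤ 1) :
    inner ℝ (vec q) (matVec M) ≤ inner ℝ (vec q) (vec s) := by
  obtain ⟨e, he⟩ := exists_perm_weight_max q
  have h1 := he M h0 hr hc
  have h2 := hs.2 _ (isMaximal_permSchedule e).isFeasible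
  have h3 : (weight q s : ℝ) = inner ℝ (vec q) (vec s) := by
    simp [inner_eq_sum, weight]
  rw [← h3, inner_eq_sum]
  exact h1.trans (by exact_mod_cast h2)

/-! ### One time slot -/

/-- The queue lengths after a time slot with schedule `s` and arrivals `b`. -/
def next (x s b : NatArray n) : NatArray n := fun i j => x i j + b i j - s i j

/-- The unused service of a time slot with schedule `s` and arrivals `b`. -/
def unused (x s b : NatArray n) : NatArray n := fun i j => s i j - (x i j + b i j)

lemma vec_next (x s b : NatArray n) :
    vec (next x s b) = vec x + vec b - vec s + vec (unused x s b) := by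
  ext p
  simp only [vec_apply, PiLp.add_apply, PiLp.sub_apply, next, unused]
  rcases le_total (x p.1 p.2 + b p.1 p.2) (s p.1 p.2) with h | h
  · rw [Nat.sub_eq_zero_of_le h, Nat.cast_sub h]; push_cast; ring
  · rw [Nat.sub_eq_zero_of_le h, Nat.cast_sub h]; push_cast; ring

/-- Service is unused only at a queue that ends the slot empty. -/
lemma inner_next_unused (x s b : NatArray n) :
    inner ℝ (vec (next x s b)) (vec (unused x s b)) = 0 := by
  rw [inner_eq_sum]
  refine Finset.sum_eq_zero fun i _ => Finset.sum_eq_zero fun j _ => ?_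
  simp only [vec_apply, next, unused]
  rcases le_total (x i j + b i j) (s i j) with h | h <;> simp [Nat.sub_eq_zero_of_le h]

lemma IsMaximal.le_one {s : NatArray n} (hs : IsMaximal s) (i j : Fin n) : s i j ≤ 1 := by
  rcases hs.1 i j with h | h <;> omega

/-- A schedule serves at most one packet per queue, so unused service also forces the queue to start
empty. -/
lemma inner_queue_unused {x s : NatArray n} (hs : IsMaximal s) (b : NatArray n) :
    inner ℝ (vec x) (vec (unused x s b)) = 0 := by
  rw [inner_eq_sum]
  refine Finset.sum_eq_zero fun i _ => Finset.sum_eq_zero fun j _ => ?_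
  simp only [vec_apply, unused]
  have := hs.le_one i j
  rcases Nat.eq_zero_or_pos (x i j) with h | h
  · simp [h]
  · rw [Nat.sub_eq_zero_of_le (by omega)]; simp

lemma unused_le (x s b : NatArray n) (i j : Fin n) : unused x s b i j ≤ s i j := Nat.sub_le _ _

lemma IsMaximal.norm_sq {s : NatArray n} (hs : IsMaximal s) : ‖vec s‖ ^ 2 = n := by
  rw [norm_sq_eq_sum]
  have : ∀ i, ∑ j, vec s (i, j) ^ 2 = 1 := fun i => by
    rw [← Nat.cast_one, ← hs.2.1 i, Nat.cast_sum]
    refine Finset.sum_congr rfl fun j _ => ?_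
    rcases hs.1 i j with h | h <;> simp [h]
  simp only [this, Finset.sum_const, Finset.card_univ, Fintype.card_fin, nsmul_eq_mul, mul_one]

lemma norm_next_sub_sq_le {x s : NatArray n} (hs : IsMaximal s) (b : NatArray n) :
    ‖vec (next x s b) - vec x‖ ^ 2 ≤ ‖vec b‖ ^ 2 + n := by
  rw [← hs.norm_sq, norm_sq_eq_sum, norm_sq_eq_sum, norm_sq_eq_sum, ← Finset.sum_add_distrib]
  refine Finset.sum_le_sum fun i _ => ?_
  rw [← Finset.sum_add_distrib]
  refine Finset.sum_le_sum fun j _ => ?_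
  simp only [PiLp.sub_apply, vec_apply, next]
  rcases hs.1 i j with h | h
  · rw [h]; push_cast [Nat.sub_zero]; nlinarith
  · rw [h]
    rcases Nat.eq_zero_or_pos (x i j + b i j) with h0 | h0
    · have h1 : x i j = 0 := by omega
      have h2 : b i j = 0 := by omega
      simp [h1, h2]
    · rw [Nat.cast_sub h0]; push_cast
      nlinarith [(Nat.cast_nonneg (b i j) : (0 : ℝ) ≤ b i j)]

lemma norm_next_sub_le {x s : NatArray n} (hs : IsMaximal s) {b : NatArray n} {amax : ℝ}
    (ha : 1 ≤ amax) (hb : ∀ i j, (b i j : ℝ) ≤ amax) :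
    ‖vec (next x s b) - vec x‖ ≤ n * amax := by
  refine abs_le_of_sq_le_sq' ?_ (by positivity) |>.2
  rw [norm_sq_eq_sum]
  have : ∀ i j, (vec (next x s b) - vec x) (i, j) ^ 2 ≤ amax ^ 2 := by
    intro i j
    rw [sq_le_sq, abs_of_nonneg (by linarith : 0 ≤ amax), abs_le]
    simp only [PiLp.sub_apply, vec_apply, next]
    have h1 := hb i j
    have h2 : (0 : ℝ) ≤ b i j := by positivity
    rcases hs.1 i j with h | h
    · rw [h]; push_cast [Nat.sub_zero]; constructor <;> linarith
    · rw [h]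
      rcases Nat.eq_zero_or_pos (x i j + b i j) with h0 | h0
      · have h1 : x i j = 0 := by omega
        have h2 : b i j = 0 := by omega
        simp [h1, h2]; linarith
      · rw [Nat.cast_sub h0]; push_cast
        constructor <;> linarith
  calc _ ≤ ∑ _i : Fin n, ∑ _j : Fin n, amax ^ 2 :=
        Finset.sum_le_sum fun i _ => Finset.sum_le_sum fun j _ => this i j
    _ = _ := by simp; ring

/-- Truncation contributes ⟨x - y, u⟩ = -⟨y, u⟩ ≤ 0 and can be dropped. The cases of interest are y
= 0 and y the projection of x onto the cone. -/
lemma norm_next_sub_sq_le_add {x s : NatArray n} (hs : IsMaximal s) (b : NatArray n)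
    {y : ArrayVec n} (hy : ∀ p, 0 ≤ y p) :
    ‖vec (next x s b) - y‖ ^ 2 ≤
      ‖vec x - y‖ ^ 2 + ‖vec b‖ ^ 2 + n + 2 * inner ℝ (vec x - y) (vec b - vec s) := by
  have h1 : vec (next x s b) - y = (vec x - y) + (vec (next x s b) - vec x) := by abel
  have h2 : inner ℝ (vec x - y) (vec (next x s b) - vec x) ≤
      inner ℝ (vec x - y) (vec b - vec s) := by
    have : vec (next x s b) - vec x = (vec b - vec s) + vec (unused x s b) := by
      rw [vec_next]; abel
    rw [this, inner_add_right, inner_sub_left (vec x) y (vec (unused x s b)),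
      inner_queue_unused hs]
    have : 0 ≤ inner ℝ y (vec (unused x s b)) := by
      rw [inner_eq_sum]
      exact Finset.sum_nonneg fun i _ => Finset.sum_nonneg fun j _ =>
        mul_nonneg (hy _) (by simp)
    linarith
  rw [h1, norm_add_sq_real]
  linarith [norm_next_sub_sq_le hs (x := x) b]

/-! ### State space collapse cone -/

/-- The subspace of arrays of the form `x i j = w i + w' j`. -/
def additiveSubspace (n : ℕ) : Submodule ℝ (ArrayVec n) where
  carrier := {x | ∀ i j i' j', x (i, j) + x (i', j') = x (i, j') + x (i', j)}
  add_mem' := by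
    intro x y hx hy i j i' j'
    simp only [PiLp.add_apply]
    linarith [hx i j i' j', hy i j i' j']
  zero_mem' := by intro i j i' j'; simp
  smul_mem' := by
    intro c x hx i j i' j'
    simp only [PiLp.smul_apply, smul_eq_mul, ← mul_add, hx i j i' j']

/-- The cone onto which the queue lengths collapse in heavy traffic. -/
def collapseCone (n : ℕ) : Set (ArrayVec n) := {x | x ∈ additiveSubspace n ∧ ∀ p, 0 ≤ x p}

lemma isClosed_collapseCone : IsClosed (collapseCone n) := by
  refine IsClosed.inter (additiveSubspace n).closed_of_finiteDimensional ?_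
  have : {x : ArrayVec n | ∀ p, 0 ≤ x p} = ⋂ p, {x | 0 ≤ x p} := by ext; simp
  change IsClosed {x : ArrayVec n | ∀ p, 0 ≤ x p}
  rw [this]
  exact isClosed_iInter fun p => isClosed_le continuous_const
    (EuclideanSpace.proj (𝕜 := ℝ) p).continuous

lemma zero_mem_collapseCone : (0 : ArrayVec n) ∈ collapseCone n :=
  ⟨zero_mem _, fun p => by simp⟩

lemma smul_mem_collapseCone {c : ℝ} (hc : 0 ≤ c) {x : ArrayVec n} (hx : x ∈ collapseCone n) :
    c • x ∈ collapseCone n :=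
  ⟨Submodule.smul_mem _ _ hx.1, fun p => by simpa using mul_nonneg hc (hx.2 p)⟩

lemma add_mem_collapseCone {x y : ArrayVec n} (hx : x ∈ collapseCone n)
    (hy : y ∈ collapseCone n) : x + y ∈ collapseCone n :=
  ⟨Submodule.add_mem _ hx.1 hy.1, fun p => by simpa using add_nonneg (hx.2 p) (hy.2 p)⟩

lemma convex_collapseCone : Convex ℝ (collapseCone n) := fun _ hx _ hy _ _ ha hb _ =>
  add_mem_collapseCone (smul_mem_collapseCone ha hx) (smul_mem_collapseCone hb hy)

/-- The distance of the queue lengths to the collapse cone. -/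
noncomputable def coneDist (x : NatArray n) : ℝ := Metric.infDist (vec x) (collapseCone n)

lemma coneDist_nonneg (x : NatArray n) : 0 ≤ coneDist x := Metric.infDist_nonneg

lemma coneDist_le_norm (x : NatArray n) : coneDist x ≤ ‖vec x‖ := by
  simpa [coneDist] using Metric.infDist_le_dist_of_mem (x := vec x) (zero_mem_collapseCone (n := n))

lemma abs_coneDist_sub_le (x y : NatArray n) : |coneDist x - coneDist y| ≤ ‖vec x - vec y‖ := by
  rw [← dist_eq_norm, ← Real.dist_eq]
  simpa [coneDist] using (Metric.lipschitz_infDist_pt (collapseCone n)).dist_le_mul (vec x) (vec y)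

/-- Moreau's decomposition: the variational inequality of the nearest point y, tested at 0 and 2y,
gives orthogonality; tested at y + w, it puts the residual in the polar cone. -/
lemma exists_coneProj (x : NatArray n) : ∃ y ∈ collapseCone n, ‖vec x - y‖ = coneDist x ∧
    inner ℝ (vec x - y) y = 0 ∧ ∀ w ∈ collapseCone n, inner ℝ (vec x - y) w ≤ 0 := by
  obtain ⟨y, hy, hxy⟩ := isClosed_collapseCone.exists_infDist_eq_dist
    ⟨0, zero_mem_collapseCone⟩ (vec x)
  have hmin : ‖vec x - y‖ = ⨅ w : collapseCone n, ‖vec x - w‖ := by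
    rw [← dist_eq_norm, ← hxy, Metric.infDist_eq_iInf]
    simp [dist_eq_norm]
  have h := (norm_eq_iInf_iff_real_inner_le_zero convex_collapseCone hy).1 hmin
  refine ⟨y, hy, by rw [coneDist, hxy, dist_eq_norm], ?_, fun w hw => ?_⟩
  · have h1 := h 0 zero_mem_collapseCone
    have h2 := h ((2 : ℝ) • y) (smul_mem_collapseCone (by norm_num) hy)
    have h3 : (2 : ℝ) • y - y = y := by rw [two_smul]; abel
    rw [h3] at h2
    rw [zero_sub, inner_neg_right] at h1
    linarith
  · simpa using h (y + w) (add_mem_collapseCone hy hw)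

/-- The additive part of an array. -/
noncomputable def addProj (x : ArrayVec n) : ArrayVec n := (additiveSubspace n).starProjection x

/-- Row mean plus column mean minus grand mean is additive, and the residual has vanishing row and
column sums, hence is orthogonal to every additive array. -/
lemma addProj_eq (hn : 0 < n) (x : ArrayVec n) : addProj x = WithLp.toLp 2 fun p =>
    (∑ j, x (p.1, j)) / n + (∑ i, x (i, p.2)) / n - (∑ i, ∑ j, x (i, j)) / n ^ 2 := by
  have hn' : (n : ℝ) ≠ 0 := by positivity
  refine Submodule.eq_starProjection_of_mem_of_inner_eq_zero ?_ ?_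
  · intro i j i' j'; simp only; ring
  · intro w hw
    -- Summing the additivity relation over i' and j' recovers w from its row and column sums.
    have hwf : ∀ i j, (n : ℝ) ^ 2 * w (i, j) = n * (∑ j', w (i, j')) + n * (∑ i', w (i', j))
        - ∑ i', ∑ j', w (i', j') := by
      intro i j
      have : ∑ i', ∑ j', (w (i, j) + w (i', j')) = ∑ i', ∑ j', (w (i, j') + w (i', j)) :=
        Finset.sum_congr rfl fun i' _ => Finset.sum_congr rfl fun j' _ => hw i j i' j'
      simp only [Finset.sum_add_distrib, Finset.sum_const, Finset.card_univ, Fintype.card_fin,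
        nsmul_eq_mul, ← Finset.mul_sum] at this
      linarith
    have hexp : ∀ f : Fin n → Fin n → ℝ, ∑ i, ∑ j, f i j * ((n : ℝ) ^ 2 * w (i, j)) =
        n * (∑ i, (∑ j, f i j) * (∑ j', w (i, j'))) + n * (∑ j, (∑ i, f i j) * (∑ i', w (i', j)))
        - (∑ i, ∑ j, f i j) * ∑ i', ∑ j', w (i', j') := by
      intro f
      rw [Finset.mul_sum, Finset.mul_sum, Finset.sum_mul]
      have : ∑ j, (n : ℝ) * ((∑ i, f i j) * ∑ i', w (i', j)) =
          ∑ i, ∑ j, (n : ℝ) * (f i j * ∑ i', w (i', j)) := by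
        rw [Finset.sum_comm]
        exact Finset.sum_congr rfl fun j _ => by rw [Finset.sum_mul, Finset.mul_sum]
      rw [this, ← Finset.sum_add_distrib, ← Finset.sum_sub_distrib]
      refine Finset.sum_congr rfl fun i _ => ?_
      rw [Finset.sum_mul, Finset.sum_mul, Finset.mul_sum, ← Finset.sum_add_distrib,
        ← Finset.sum_sub_distrib]
      refine Finset.sum_congr rfl fun j _ => ?_
      rw [hwf]; ring
    have hz : (n : ℝ) ^ 2 * inner ℝ (x - WithLp.toLp 2 fun p : Fin n × Fin n =>
      (∑ j, x (p.1, j)) / n + (∑ i, x (i, p.2)) / n - (∑ i, ∑ j, x (i, j)) / n ^ 2) w = 0 := by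
      rw [inner_eq_sum, Finset.mul_sum]
      simp only [Finset.mul_sum, mul_left_comm ((n : ℝ) ^ 2)]
      rw [hexp]
      have hrow : ∀ i, ∑ j, (x - WithLp.toLp 2 fun p : Fin n × Fin n =>
          (∑ j, x (p.1, j)) / n + (∑ i, x (i, p.2)) / n - (∑ i, ∑ j, x (i, j)) / n ^ 2)
          (i, j) = 0 := by
        intro i
        simp only [PiLp.sub_apply, Finset.sum_sub_distrib, Finset.sum_add_distrib,
          Finset.sum_const, Finset.card_univ, Fintype.card_fin, nsmul_eq_mul, ← Finset.sum_div]
        rw [Finset.sum_comm (f := fun j i => x (i, j))]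
        field_simp; ring
      have hcol : ∀ j, ∑ i, (x - WithLp.toLp 2 fun p : Fin n × Fin n =>
          (∑ j, x (p.1, j)) / n + (∑ i, x (i, p.2)) / n - (∑ i, ∑ j, x (i, j)) / n ^ 2)
          (i, j) = 0 := by
        intro j
        simp only [PiLp.sub_apply, Finset.sum_sub_distrib, Finset.sum_add_distrib,
          Finset.sum_const, Finset.card_univ, Fintype.card_fin, nsmul_eq_mul, ← Finset.sum_div]
        field_simp; ring
      simp only [hrow, hcol]; simp
    exact (mul_eq_zero.1 hz).resolve_left (by positivity)

/-- The inner product of the additive parts in terms of row sums, column sums and totals. -/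
lemma inner_addProj (hn : 0 < n) (x y : ArrayVec n) : inner ℝ (addProj x) (addProj y) =
    (∑ i, (∑ j, x (i, j)) * (∑ j, y (i, j))) / n + (∑ j, (∑ i, x (i, j)) * (∑ i, y (i, j))) / n
      - (∑ i, ∑ j, x (i, j)) * (∑ i, ∑ j, y (i, j)) / n ^ 2 := by
  have : inner ℝ (addProj x) (addProj y) = inner ℝ (addProj x) y := by
    unfold addProj
    rw [← Submodule.inner_starProjection_left_eq_right,
      Submodule.starProjection_eq_self_iff.2 (Submodule.starProjection_apply_mem _ _)]
  rw [this, addProj_eq hn, inner_eq_sum]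
  simp only [sub_mul, add_mul, Finset.sum_sub_distrib, Finset.sum_add_distrib]
  congr 1
  · congr 1
    · rw [Finset.sum_div]
      refine Finset.sum_congr rfl fun i _ => ?_
      rw [← Finset.mul_sum]; ring
    · rw [Finset.sum_comm, Finset.sum_div]
      refine Finset.sum_congr rfl fun i _ => ?_
      rw [← Finset.mul_sum]; ring
  · simp only [← Finset.mul_sum]; ring

lemma norm_addProj_le (x : ArrayVec n) : ‖addProj x‖ ≤ ‖x‖ :=
  Submodule.norm_starProjection_apply_le _ _

/-- All permutation matrices have the same additive part, the constant array 1/n, so the choice made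
by MaxWeight drops out. -/
lemma inner_addProj_vec_schedule (hn : 0 < n) (x : ArrayVec n) {s : NatArray n}
    (hs : IsMaximal s) :
    inner ℝ (addProj x) (addProj (vec s)) = (∑ i, ∑ j, x (i, j)) / n := by
  have hr : ∀ i, ∑ j, (s i j : ℝ) = 1 := fun i => by exact_mod_cast hs.2.1 i
  have hc : ∀ j, ∑ i, (s i j : ℝ) = 1 := fun j => by exact_mod_cast hs.2.2 j
  rw [inner_addProj hn]
  simp only [vec_apply, hr, hc, mul_one, Finset.sum_const, Finset.card_univ, Fintype.card_fin,
    nsmul_eq_mul]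
  rw [Finset.sum_comm (f := fun j i => x (i, j))]
  field_simp; ring

/-- With y the cone projection of the next queue lengths q⁺, additivity of y and ⟨q⁺, u⟩ = 0 turn
the left side into -⟨q⁺ - y, u - Pu⟩, to which Cauchy–Schwarz applies. -/
lemma abs_inner_addProj_unused_le (x s b : NatArray n) :
    |inner ℝ (addProj (vec (next x s b))) (addProj (vec (unused x s b)))| ≤
      coneDist (next x s b) * ‖vec (unused x s b)‖ := by
  obtain ⟨y, hy, hd, -, -⟩ := exists_coneProj (next x s b)
  set x' := vec (next x s b)
  set u := vec (unused x s b)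
  have hu : inner ℝ x' u = 0 := inner_next_unused x s b
  have hPy : addProj y = y := Submodule.starProjection_eq_self_iff.2 hy.1
  have h1 : inner ℝ (addProj x') (addProj u) = - inner ℝ (x' - y) (u - addProj u) := by
    have e1 : inner ℝ (addProj x') (addProj u) = inner ℝ x' (addProj u) := by
      unfold addProj
      rw [← Submodule.inner_starProjection_left_eq_right,
        Submodule.starProjection_eq_self_iff.2 (Submodule.starProjection_apply_mem _ _),
        Submodule.inner_starProjection_left_eq_right]
    have e2 : inner ℝ y (addProj u) = inner ℝ y u := by
      conv_rhs => rw [← hPy]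
      unfold addProj
      rw [Submodule.inner_starProjection_left_eq_right]
    rw [e1, inner_sub_left, inner_sub_right, inner_sub_right, e2, hu]; ring
  rw [h1, abs_neg, ← hd]
  refine (abs_real_inner_le_norm _ _).trans ?_
  gcongr
  have : u - addProj u = (additiveSubspace n)ᗮ.starProjection u := by
    rw [Submodule.starProjection_orthogonal]; rfl
  rw [this]
  exact Submodule.norm_starProjection_apply_le _ _

lemma norm_sq_unused {x s : NatArray n} (hs : IsMaximal s) (b : NatArray n) :
    ‖vec (unused x s b)‖ ^ 2 = totalQueue (unused x s b) := by
  rw [norm_sq_eq_sum, totalQueue]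
  refine Finset.sum_congr rfl fun i _ => Finset.sum_congr rfl fun j _ => ?_
  have h1 := unused_le x s b i j
  have h2 := hs.le_one i j
  have : unused x s b i j = 0 ∨ unused x s b i j = 1 := by omega
  rcases this with h | h <;> simp [h]

/-- Row and column sums of the unused service lie in [0, 1], so each is at least its square. -/
lemma norm_sq_addProj_unused_le (hn : 0 < n) {x s : NatArray n} (hs : IsMaximal s)
    (b : NatArray n) :
    ‖addProj (vec (unused x s b))‖ ^ 2 ≤ 2 / n * totalQueue (unused x s b) := by
  set u := unused x s b with hu
  have hr : ∀ i, (∑ j, (u i j : ℝ)) ≤ 1 := fun i => by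
    have : ∑ j, u i j ≤ ∑ j, s i j := Finset.sum_le_sum fun j _ => unused_le x s b i j
    rw [hs.2.1] at this; exact_mod_cast this
  have hc : ∀ j, (∑ i, (u i j : ℝ)) ≤ 1 := fun j => by
    have : ∑ i, u i j ≤ ∑ i, s i j := Finset.sum_le_sum fun i _ => unused_le x s b i j
    rw [hs.2.2] at this; exact_mod_cast this
  rw [← real_inner_self_eq_norm_sq, inner_addProj hn]
  simp only [vec_apply]
  have h1 : ∑ i, (∑ j, (u i j : ℝ)) * (∑ j, (u i j : ℝ)) ≤ totalQueue u :=
    Finset.sum_le_sum fun i _ => mul_le_of_le_one_left (by positivity) (hr i)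
  have h2 : ∑ j, (∑ i, (u i j : ℝ)) * (∑ i, (u i j : ℝ)) ≤ totalQueue u := by
    rw [totalQueue, Finset.sum_comm]
    exact Finset.sum_le_sum fun i _ => mul_le_of_le_one_left (by positivity) (hc i)
  have h3 : 0 ≤ (∑ i, ∑ j, (u i j : ℝ)) * (∑ i, ∑ j, (u i j : ℝ)) / n ^ 2 := by positivity
  have h4 : 2 / n * totalQueue u = totalQueue u / n + totalQueue u / n := by ring
  rw [h4]
  have := div_le_div_of_nonneg_right h1 (Nat.cast_nonneg (α := ℝ) n)
  have := div_le_div_of_nonneg_right h2 (Nat.cast_nonneg (α := ℝ) n)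
  linarith

end MaxWeightSwitch

/-! ### Measures with finite support -/

lemma integrable_of_ae_mem_finite {S : Type*} [MeasurableSpace S] [DiscreteMeasurableSpace S]
    {μ : Measure S} [IsFiniteMeasure μ] {F : Set S} (hF : F.Finite) (h : ∀ᵐ x ∂μ, x ∈ F)
    (f : S → ℝ) : Integrable f μ := by
  obtain ⟨C, hC⟩ := (hF.image fun x => ‖f x‖).bddAbove
  have hm : AEStronglyMeasurable f μ := by
    have : AEStronglyMeasurable (F.indicator f) μ := by
      refine StronglyMeasurable.aestronglyMeasurable ?_
      refine stronglyMeasurable_iff_measurable_separable.2 ⟨Measurable.of_discrete, ?_⟩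
      refine (((hF.image f).union (Set.finite_singleton 0)).isSeparable).mono ?_
      rintro _ ⟨x, rfl⟩
      by_cases hx : x ∈ F
      · exact Or.inl ⟨x, hx, by simp [hx]⟩
      · exact Or.inr (by simp [hx])
    refine this.congr ?_
    filter_upwards [h] with x hx
    simp [hx]
  refine Integrable.of_bound hm C ?_
  filter_upwards [h] with x hx
  exact hC ⟨x, hx, rfl⟩

/-! ### The one-slot law and its averaging operator -/

namespace MaxWeightSwitch

variable {n : ℕ}

/-- The properties of the law of the arrivals of a time slot that the queue lengths depend on. -/
structure IsArrivalLaw (α : Measure (NatArray n)) (amax : ℝ)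
    (lam σ : Matrix (Fin n) (Fin n) ℝ) : Prop where
  isProbabilityMeasure : IsProbabilityMeasure α
  one_le : 1 ≤ amax
  ae_le : ∀ᵐ b ∂α, ∀ i j, (b i j : ℝ) ≤ amax
  zero_pos : 0 < α.real {0}
  integral_eq : ∀ i j, ∫ b, (b i j : ℝ) ∂α = lam i j
  -- The form in which independence across pairs enters the moment computations; it serves for F an
  -- entry, a row, a column and the whole array.
  integral_sq : ∀ (F : Finset (Fin n × Fin n)) (c : ℝ),
    ∫ b, (∑ p ∈ F, (b p.1 p.2 : ℝ) - c) ^ 2 ∂α =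
      ∑ p ∈ F, σ p.1 p.2 ^ 2 + (∑ p ∈ F, lam p.1 p.2 - c) ^ 2

instance isProbabilityMeasure_uniformOn_maxWeight (x : NatArray n) :
    IsProbabilityMeasure (uniformOn (maxWeightSchedules x)) :=
  isProbabilityMeasure_uniformOn (maxWeightSchedules_finite x) (maxWeightSchedules_nonempty x)

lemma ae_mem_maxWeightSchedules (x : NatArray n) :
    ∀ᵐ s ∂uniformOn (maxWeightSchedules x), s ∈ maxWeightSchedules x :=
  ae_cond_mem (maxWeightSchedules_finite x).measurableSet

instance isProbabilityMeasure_stepLaw (α : Measure (NatArray n)) [IsProbabilityMeasure α]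
    (x : NatArray n) : IsProbabilityMeasure (stepLaw α x) :=
  Measure.isProbabilityMeasure_map Measurable.of_discrete.aemeasurable

namespace IsArrivalLaw

variable {α : Measure (NatArray n)} {amax : ℝ} {lam σ : Matrix (Fin n) (Fin n) ℝ}

lemma ae_mem_finite (h : IsArrivalLaw α amax lam σ) :
    ∀ᵐ b ∂α, b ∈ {x : NatArray n | ∀ i j, x i j ≤ ⌊amax⌋₊} := by
  filter_upwards [h.ae_le] with b hb i j
  exact Nat.le_floor (hb i j)

lemma integrable (h : IsArrivalLaw α amax lam σ) (f : NatArray n → ℝ) : Integrable f α :=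
  have := h.isProbabilityMeasure
  integrable_of_ae_mem_finite (finite_setOf_le _) h.ae_mem_finite f

lemma ae_prod (h : IsArrivalLaw α amax lam σ) (x : NatArray n) :
    ∀ᵐ p ∂(uniformOn (maxWeightSchedules x)).prod α,
      p ∈ maxWeightSchedules x ×ˢ {x : NatArray n | ∀ i j, x i j ≤ ⌊amax⌋₊} := by
  have := h.isProbabilityMeasure
  have h1 := Measure.quasiMeasurePreserving_fst (μ := uniformOn (maxWeightSchedules x)) (ν := α)
    |>.ae (ae_mem_maxWeightSchedules x)
  have h2 := Measure.quasiMeasurePreserving_snd (μ := uniformOn (maxWeightSchedules x)) (ν := α)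
    |>.ae h.ae_mem_finite
  filter_upwards [h1, h2] with p hp1 hp2 using ⟨hp1, hp2⟩

lemma integrable_prod (h : IsArrivalLaw α amax lam σ) (x : NatArray n)
    (f : NatArray n × NatArray n → ℝ) :
    Integrable f ((uniformOn (maxWeightSchedules x)).prod α) :=
  have := h.isProbabilityMeasure
  integrable_of_ae_mem_finite ((maxWeightSchedules_finite x).prod (finite_setOf_le _))
    (h.ae_prod x) f

/-- From a given state a slot has almost surely finitely many outcomes. Hence averaging is a linear
operator on all functions, without integrability conditions. -/
lemma integrable_stepLaw (h : IsArrivalLaw α amax lam σ) (x : NatArray n)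
    (f : NatArray n → ℝ) : Integrable f (stepLaw α x) :=
  (integrable_map_measure Measurable.of_discrete.aestronglyMeasurable
    Measurable.of_discrete.aemeasurable).2 (h.integrable_prod x _)

/-- The averaging operator of the queue length chain. -/
noncomputable def avg (h : IsArrivalLaw α amax lam σ) : Module.End ℝ (NatArray n → ℝ) where
  toFun f x := ∫ y, f y ∂stepLaw α x
  map_add' f g := by
    ext x
    exact integral_add (h.integrable_stepLaw x f) (h.integrable_stepLaw x g)
  map_smul' c f := by
    ext x
    exact integral_const_mul c f

lemma avg_apply (h : IsArrivalLaw α amax lam σ) (f : NatArray n → ℝ) (x : NatArray n) :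
    h.avg f x = ∫ y, f y ∂stepLaw α x := rfl

lemma avg_eq (h : IsArrivalLaw α amax lam σ) (f : NatArray n → ℝ) (x : NatArray n) :
    h.avg f x = ∫ s, ∫ b, f (next x s b) ∂α ∂uniformOn (maxWeightSchedules x) := by
  have := h.isProbabilityMeasure
  rw [avg_apply, stepLaw, integral_map Measurable.of_discrete.aemeasurable
    Measurable.of_discrete.aestronglyMeasurable,
    integral_prod _ (h.integrable_prod x _)]
  rfl

lemma integrable_uniformOn (x : NatArray n) (f : NatArray n → ℝ) :
    Integrable f (uniformOn (maxWeightSchedules x)) :=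
  integrable_of_ae_mem_finite (maxWeightSchedules_finite x) (ae_mem_maxWeightSchedules x) f

lemma avg_le (h : IsArrivalLaw α amax lam σ) {f : NatArray n → ℝ} {x : NatArray n} {c : ℝ}
    (hc : ∀ s ∈ maxWeightSchedules x, ∫ b, f (next x s b) ∂α ≤ c) : h.avg f x ≤ c := by
  rw [avg_eq]
  calc _ ≤ ∫ _, c ∂uniformOn (maxWeightSchedules x) := by
        refine integral_mono_ae (integrable_uniformOn x _) (integrable_const c) ?_
        filter_upwards [ae_mem_maxWeightSchedules x] with s hs using hc s hs
    _ = c := by simp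

lemma le_avg (h : IsArrivalLaw α amax lam σ) {f : NatArray n → ℝ} {x : NatArray n} {c : ℝ}
    (hc : ∀ s ∈ maxWeightSchedules x, c ≤ ∫ b, f (next x s b) ∂α) : c ≤ h.avg f x := by
  have := h.avg_le (f := -f) (x := x) (c := -c) fun s hs => by
    have := hc s hs
    simp only [Pi.neg_apply, integral_neg]; linarith
  rw [map_neg, Pi.neg_apply] at this
  linarith

lemma avg_nonneg (h : IsArrivalLaw α amax lam σ) {f : NatArray n → ℝ} (hf : 0 ≤ f) :
    0 ≤ h.avg f := fun _ => integral_nonneg hf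

lemma avg_one (h : IsArrivalLaw α amax lam σ) : h.avg 1 = 1 := by
  have := h.isProbabilityMeasure
  ext x; simp [avg_apply]

/-- Pointwise comparison of averages over a time slot. -/
lemma avg_le_avg (h : IsArrivalLaw α amax lam σ) {f g : NatArray n → ℝ} {x : NatArray n}
    (hfg : ∀ s ∈ maxWeightSchedules x, ∀ b : NatArray n, (∀ i j, (b i j : ℝ) ≤ amax) →
      f (next x s b) ≤ g (next x s b)) : h.avg f x ≤ h.avg g x := by
  have := h.isProbabilityMeasure
  rw [avg_eq, avg_eq]
  refine integral_mono_ae (integrable_uniformOn x _) (integrable_uniformOn x _) ?_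
  filter_upwards [ae_mem_maxWeightSchedules x] with s hs
  refine integral_mono_ae (h.integrable _) (h.integrable _) ?_
  filter_upwards [h.ae_le] with b hb using hfg s hs b hb

lemma avg_const (h : IsArrivalLaw α amax lam σ) (c : ℝ) (x : NatArray n) :
    h.avg (fun _ => c) x = c := by
  have := h.isProbabilityMeasure
  simp [avg_apply]

end IsArrivalLaw

end MaxWeightSwitch

/-! ### Geometric ergodicity of averaging operators -/

namespace Averaging

variable {S : Type*} {T : Module.End ℝ (S → ℝ)}

lemma mono (hpos : ∀ f, 0 ≤ f → 0 ≤ T f) {f g : S → ℝ} (h : f ≤ g) : T f ≤ T g := by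
  have := hpos (g - f) (sub_nonneg.2 h)
  rwa [map_sub, sub_nonneg] at this

lemma map_const (h1 : T 1 = 1) (c : ℝ) : T (fun _ => c) = fun _ => c := by
  have : (fun _ => c : S → ℝ) = c • (1 : S → ℝ) := by ext; simp
  rw [this, map_smul, h1]

lemma pow_nonneg (hpos : ∀ f, 0 ≤ f → 0 ≤ T f) (k : ℕ) : ∀ f, 0 ≤ f → 0 ≤ (T ^ k) f := by
  induction k with
  | zero => intro f hf; simpa using hf
  | succ k ih => intro f hf; rw [pow_succ', Module.End.mul_apply]; exact hpos _ (ih f hf)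

lemma pow_one (h1 : T 1 = 1) (k : ℕ) : (T ^ k) 1 = 1 := by
  induction k with
  | zero => simp
  | succ k ih => rw [pow_succ', Module.End.mul_apply, ih, h1]

lemma abs_map_le (hpos : ∀ f, 0 ≤ f → 0 ≤ T f) {f g : S → ℝ} (h : ∀ x, |f x| ≤ g x) (x : S) :
    |T f x| ≤ T g x := by
  rw [abs_le]
  have h2 := mono hpos (f := f) (g := g) (fun x => (le_abs_self _).trans (h x)) x
  have h3 := mono hpos (f := -g) (g := f) (fun x => (abs_le.1 (h x)).1) x
  rw [map_neg, Pi.neg_apply] at h3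
  exact ⟨h3, h2⟩

lemma pow_drift (hpos : ∀ f, 0 ≤ f → 0 ≤ T f) (h1 : T 1 = 1) {V : S → ℝ} {ρ K : ℝ}
    (hρ0 : 0 ≤ ρ) (hρ : ρ < 1) (hK : 0 ≤ K)
    (hd : ∀ x, T V x ≤ ρ * V x + K) (k : ℕ) (x : S) :
    (T ^ k) V x ≤ ρ ^ k * V x + K / (1 - ρ) := by
  have hρ' : 0 < 1 - ρ := by linarith
  induction k generalizing x with
  | zero => simp; positivity
  | succ k ih =>
    rw [pow_succ, Module.End.mul_apply]
    have h2 := mono (pow_nonneg hpos k) (f := T V) (g := ρ • V + fun _ => K) (fun y => hd y) x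
    rw [map_add, map_smul, map_const (pow_one h1 k)] at h2
    simp only [Pi.add_apply, Pi.smul_apply, smul_eq_mul] at h2
    have h3 : ρ * (T ^ k) V x ≤ ρ * (ρ ^ k * V x + K / (1 - ρ)) := by gcongr; exact ih x
    have h4 : ρ * (K / (1 - ρ)) + K = K / (1 - ρ) := by field_simp; ring
    have h5 : ρ ^ (k + 1) * V x = ρ * (ρ ^ k * V x) := by ring
    linarith

/-- A function whose oscillation is bounded by a weight is bounded by the weight up to a shift. -/
lemma exists_shift {φ W : S → ℝ} (h : ∀ x y, |φ x - φ y| ≤ W x + W y) [Nonempty S] :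
    ∃ c, ∀ x, |φ x - c| ≤ W x := by
  have hle : ∀ x y, φ y - W y ≤ φ x + W x := fun x y => by
    have := (abs_le.1 (h x y)).1; linarith
  have x₀ : S := Classical.arbitrary S
  have hb : BddAbove (Set.range fun y => φ y - W y) := ⟨φ x₀ + W x₀, by
    rintro _ ⟨y, rfl⟩; exact hle x₀ y⟩
  refine ⟨⨆ y, (φ y - W y), fun x => ?_⟩
  have h1 : φ x - W x ≤ ⨆ y, (φ y - W y) := le_ciSup hb x
  have h2 : ⨆ y, (φ y - W y) ≤ φ x + W x := ciSup_le fun y => hle x y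
  rw [abs_le]; constructor <;> linarith

/-- Harris' theorem in the form of Hairer and Mattingly. -/
lemma exists_contraction (hpos : ∀ f, 0 ≤ f → 0 ≤ T f) (h1 : T 1 = 1) {V : S → ℝ}
    (hV : 0 ≤ V) {ρ K R a : ℝ} (hρ0 : 0 ≤ ρ) (hρ : ρ < 1) (hK : 0 ≤ K)
    (hd : ∀ x, T V x ≤ ρ * V x + K) (hR : 0 < R) (hKR : 4 * K ≤ (1 - ρ) * R) {z : S} (ha : 0 < a)
    (hmin : ∀ x, V x ≤ R → ∀ g, 0 ≤ g → a * g z ≤ T g x) :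
    ∃ β γ : ℝ, 0 < β ∧ 0 ≤ γ ∧ γ < 1 ∧ ∀ (φ : S → ℝ) (c : ℝ), 0 ≤ c →
      (∀ x y, |φ x - φ y| ≤ c * (2 + β * V x + β * V y)) →
      ∀ x y, |T φ x - T φ y| ≤ γ * c * (2 + β * V x + β * V y) := by
  have : Nonempty S := ⟨z⟩
  -- Small enough that the drift constant 2βK consumes at most half of the gain 2a from the
  -- minorization.
  set β := a / (2 * K + 1) with hβ
  have hβ0 : 0 < β := by positivity
  have hβK : 2 * β * K ≤ a := by
    rw [hβ]; field_simp; linarith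
  set γ₀ := (1 + ρ) / 2 with hγ₀
  -- Solves 2 + γ₀βR = (1 - δ)(2 + βR): contracting only the V-part by γ₀ contracts the whole weight
  -- by 1 - δ once V x + V y ≥ R.
  set δ := (1 - γ₀) * (β * R) / (2 + β * R) with hδ
  have hγ₀1 : 0 < 1 - γ₀ := by rw [hγ₀]; linarith
  have hδ0 : 0 < δ := by positivity
  have hδeq : δ * (2 + β * R) = (1 - γ₀) * (β * R) := by rw [hδ]; field_simp
  have hδle : δ ≤ 1 - γ₀ := by
    rw [hδ, div_le_iff₀ (by positivity)]; nlinarith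
  refine ⟨β, max (1 - δ) (max (1 - a / 2) ρ), hβ0, ?_, ?_, ?_⟩
  · exact le_max_of_le_right (le_max_of_le_right hρ0)
  · refine max_lt (by linarith) (max_lt (by linarith) hρ)
  intro φ c hc hφ
  set γ := max (1 - δ) (max (1 - a / 2) ρ) with hγ
  have hγ1 : 1 - δ ≤ γ := le_max_left _ _
  have hγ2 : 1 - a / 2 ≤ γ := (le_max_left _ _).trans (le_max_right _ _)
  have hγ3 : ρ ≤ γ := (le_max_right _ _).trans (le_max_right _ _)
  obtain ⟨m, hm⟩ := exists_shift (φ := φ) (W := fun x => c * (1 + β * V x)) (fun x y => by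
    have := hφ x y; linarith)
  set ψ : S → ℝ := fun x => φ x - m with hψ
  set W : S → ℝ := fun x => c * (1 + β * V x) with hW
  have hTψ : ∀ x y, T φ x - T φ y = T ψ x - T ψ y := by
    intro x y
    have : φ = ψ + fun _ => m := by ext; simp [hψ]
    rw [this, map_add, map_const h1]; simp
  have hTW : ∀ x, T W x ≤ c * (1 + β * (ρ * V x + K)) := by
    intro x
    have : W = c • ((1 : S → ℝ) + β • V) := by ext; simp [hW]
    rw [this, map_smul, map_add, h1, map_smul]
    simp only [Pi.smul_apply, Pi.add_apply, Pi.one_apply, smul_eq_mul]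
    gcongr; exact hd x
  intro x y
  rw [hTψ]
  have hx0 := hV x
  have hy0 := hV y
  simp only [Pi.zero_apply] at hx0 hy0
  -- Far out the drift alone contracts; otherwise both points lie in the sublevel set and share mass
  -- at z.
  rcases le_or_gt R (V x + V y) with hxy | hxy
  · have hx := abs_map_le hpos hm x
    have hy := abs_map_le hpos hm y
    have hb : |T ψ x - T ψ y| ≤ c * (2 + β * (ρ * (V x + V y) + 2 * K)) := by
      refine (abs_sub _ _).trans ?_
      have := hTW x; have := hTW y
      linarith
    refine hb.trans ?_
    rw [mul_comm γ c, mul_assoc]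
    refine mul_le_mul_of_nonneg_left ?_ hc
    have e1 : 2 * K ≤ (γ₀ - ρ) * (V x + V y) := by
      have : (γ₀ - ρ) * R ≤ (γ₀ - ρ) * (V x + V y) := by
        refine mul_le_mul_of_nonneg_left hxy ?_; rw [hγ₀]; linarith
      have e2 : (γ₀ - ρ) * R = (1 - ρ) * R / 2 := by rw [hγ₀]; ring
      linarith
    have e3 : β * (2 * K) ≤ β * ((γ₀ - ρ) * (V x + V y)) := by gcongr
    have e4 : (1 - δ) * (2 + β * V x + β * V y) ≤ γ * (2 + β * V x + β * V y) := by
      gcongr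
    have e5 : δ * (β * (V x + V y - R)) ≤ (1 - γ₀) * (β * (V x + V y - R)) := by
      refine mul_le_mul_of_nonneg_right hδle (mul_nonneg hβ0.le (by linarith))
    nlinarith
  · have hgx : a * (W z - ψ z) ≤ T W x - T ψ x := by
      have := hmin x (by linarith) (W - ψ) (fun w => by
        have := (abs_le.1 (hm w)).2; simp only [Pi.zero_apply, Pi.sub_apply]; linarith)
      simpa [map_sub] using this
    have hgx' : a * (W z + ψ z) ≤ T W x + T ψ x := by
      have := hmin x (by linarith) (W + ψ) (fun w => by
        have := (abs_le.1 (hm w)).1; simp only [Pi.zero_apply, Pi.add_apply]; linarith)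
      simpa [map_add] using this
    have hgy : a * (W z - ψ z) ≤ T W y - T ψ y := by
      have := hmin y (by linarith) (W - ψ) (fun w => by
        have := (abs_le.1 (hm w)).2; simp only [Pi.zero_apply, Pi.sub_apply]; linarith)
      simpa [map_sub] using this
    have hgy' : a * (W z + ψ z) ≤ T W y + T ψ y := by
      have := hmin y (by linarith) (W + ψ) (fun w => by
        have := (abs_le.1 (hm w)).1; simp only [Pi.zero_apply, Pi.add_apply]; linarith)
      simpa [map_add] using this
    have hWz : c ≤ W z := by
      have := hV z
      simp only [Pi.zero_apply] at this
      have : 0 ≤ c * (β * V z) := by positivity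
      simp only [hW]; linarith
    -- Minorizing W - ψ at one point and W + ψ at the other makes ψ z cancel and saves 2a * W z ≥
    -- 2ac.
    have hb : |T ψ x - T ψ y| ≤ c * (2 - 2 * a + β * (ρ * (V x + V y) + 2 * K)) := by
      have e1 := hTW x
      have e2 := hTW y
      have e3 : a * c ≤ a * W z := by gcongr
      rw [abs_le]; constructor <;> linarith
    refine hb.trans ?_
    rw [mul_comm γ c, mul_assoc]
    refine mul_le_mul_of_nonneg_left ?_ hc
    have e4 : (1 - a / 2) * 2 ≤ γ * 2 := by gcongr
    have e5 : ρ * (β * (V x + V y)) ≤ γ * (β * (V x + V y)) := by gcongr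
    linarith

/-- Hypotheses of the ergodic theorem: an averaging operator with geometric drift towards finite
sublevel sets, on which the powers of the operator charge a common point. -/
structure IsHarris (T : Module.End ℝ (S → ℝ)) (V : S → ℝ) (z : S) : Prop where
  nonneg : ∀ f, 0 ≤ f → 0 ≤ T f
  one : T 1 = 1
  weight_nonneg : 0 ≤ V
  drift : ∃ ρ K : ℝ, 0 ≤ ρ ∧ ρ < 1 ∧ 0 ≤ K ∧ ∀ x, T V x ≤ ρ * V x + K
  finite : ∀ R, {x | V x ≤ R}.Finite
  minorization : ∀ R : ℝ, ∃ (m : ℕ) (a : ℝ), 0 < m ∧ 0 < a ∧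
    ∀ x, V x ≤ R → ∀ g, 0 ≤ g → a * g z ≤ (T ^ m) g x

namespace IsHarris

variable {V : S → ℝ} {z : S}

lemma exists_rate (h : IsHarris T V z) : ∃ (β : ℝ) (r : ℕ → ℝ), 0 ≤ β ∧ (∀ k, 0 ≤ r k) ∧
    Tendsto r atTop (𝓝 0) ∧ ∀ (φ : S → ℝ) (C : ℝ), 0 ≤ C → (∀ x, |φ x| ≤ C) → ∀ k x y,
      |(T ^ k) φ x - (T ^ k) φ y| ≤ r k * C * (2 + β * V x + β * V y) := by
  obtain ⟨ρ, K, hρ0, hρ, hK, hd⟩ := h.drift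
  have hρ' : 0 < 1 - ρ := by linarith
  set K' := K / (1 - ρ) with hK'
  have hK'0 : 0 ≤ K' := by positivity
  -- The number m of steps depends on the level, so the level must not depend on m: every positive
  -- power of T has drift constants ρ and K' = K / (1 - ρ).
  obtain ⟨m, a, hm, ha, hmin⟩ := h.minorization (4 * K' / (1 - ρ) + 1)
  obtain ⟨β, γ, hβ, hγ0, hγ, hc⟩ := exists_contraction (T := T ^ m) (pow_nonneg h.nonneg m)
    (pow_one h.one m) h.weight_nonneg hρ0 hρ hK'0 (fun x => by
      refine (pow_drift h.nonneg h.one hρ0 hρ hK hd m x).trans ?_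
      have : ρ ^ m ≤ ρ := pow_le_of_le_one hρ0 hρ.le hm.ne'
      have := h.weight_nonneg x
      gcongr) (R := 4 * K' / (1 - ρ) + 1) (by positivity)
    (by rw [mul_add, mul_div_cancel₀ _ hρ'.ne']; linarith) ha hmin
  refine ⟨β, fun k => γ ^ (k / m), hβ.le, fun k => by positivity, ?_, ?_⟩
  · exact (tendsto_pow_atTop_nhds_zero_of_lt_one hγ0 hγ).comp
      (Nat.tendsto_div_const_atTop hm.ne')
  · intro φ C hC hφ k
    have hbdd : ∀ i x, |(T ^ i) φ x| ≤ C := fun i x => by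
      have := abs_map_le (pow_nonneg h.nonneg i) (g := fun _ => C) hφ x
      rwa [map_const (pow_one h.one i)] at this
    have hbase : ∀ i x y, |(T ^ i) φ x - (T ^ i) φ y| ≤ C * (2 + β * V x + β * V y) := by
      intro i x y
      have h1 := hbdd i x
      have h2 := hbdd i y
      have h3 := h.weight_nonneg x
      have h4 := h.weight_nonneg y
      simp only [Pi.zero_apply] at h3 h4
      have h5 : 0 ≤ C * (β * V x + β * V y) := by positivity
      refine (abs_sub _ _).trans ?_
      linarith
    -- Only T ^ m contracts; the remainder of k modulo m is absorbed by the uniform bound `hbase`.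
    have hiter : ∀ j i x y, |(T ^ (m * j + i)) φ x - (T ^ (m * j + i)) φ y| ≤
        γ ^ j * C * (2 + β * V x + β * V y) := by
      intro j i
      induction j with
      | zero => simpa using hbase i
      | succ j ih =>
        have e : T ^ (m * (j + 1) + i) = T ^ m * T ^ (m * j + i) := by
          rw [← pow_add]; congr 1; ring
        intro x y
        rw [e, Module.End.mul_apply]
        have := hc _ _ (by positivity) ih x y
        rwa [pow_succ', mul_assoc γ]
    have := hiter (k / m) (k % m)
    rwa [Nat.div_add_mod] at this

lemma exists_limit (h : IsHarris T V z) (φ : S → ℝ) (hφ : ∃ C, ∀ x, |φ x| ≤ C) :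
    ∃ L, ∀ x, Tendsto (fun k => (T ^ k) φ x) atTop (𝓝 L) := by
  obtain ⟨β, r, hβ, hr0, hr, hc⟩ := h.exists_rate
  obtain ⟨ρ, K, hρ0, hρ, hK, hd⟩ := h.drift
  obtain ⟨C, hC⟩ := hφ
  have hC0 : 0 ≤ C := (abs_nonneg _).trans (hC z)
  have hρ' : 0 < 1 - ρ := by linarith
  -- The difference is T ^ j applied to the oscillation of T ^ k φ around its value at x; the drift
  -- bounds T ^ j V uniformly in j, so the sequence is Cauchy.
  have hosc : ∀ k j x, |(T ^ (k + j)) φ x - (T ^ k) φ x| ≤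
      r k * C * (2 + β * V x + β * (V x + K / (1 - ρ))) := by
    intro k j x
    have e : (T ^ (k + j)) φ x - (T ^ k) φ x =
        (T ^ j) ((T ^ k) φ - fun _ => (T ^ k) φ x) x := by
      rw [map_sub, map_const (pow_one h.one j), add_comm k j, pow_add, Module.End.mul_apply]
      simp
    rw [e]
    refine (abs_map_le (pow_nonneg h.nonneg j) (fun y => hc φ C hC0 hC k y x) x).trans ?_
    have e2 : (fun y => r k * C * (2 + β * V y + β * V x)) =
        (r k * C) • ((fun _ => 2 + β * V x) + β • V) := by
      ext y; simp; left; ring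
    rw [e2, map_smul, map_add, map_const (pow_one h.one j), map_smul]
    simp only [Pi.smul_apply, Pi.add_apply, smul_eq_mul]
    have h3 := pow_drift h.nonneg h.one hρ0 hρ hK hd j x
    have h4 : ρ ^ j * V x ≤ 1 * V x :=
      mul_le_mul_of_nonneg_right (pow_le_one₀ hρ0 hρ.le) (h.weight_nonneg x)
    have := hr0 k
    gcongr
    linarith
  have hlim : ∀ x, ∃ L, Tendsto (fun k => (T ^ k) φ x) atTop (𝓝 L) := by
    intro x
    refine cauchySeq_tendsto_of_complete (cauchySeq_of_le_tendsto_0'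
      (fun k => r k * C * (2 + β * V x + β * (V x + K / (1 - ρ)))) ?_ ?_)
    · intro k l hkl
      obtain ⟨j, rfl⟩ := Nat.exists_eq_add_of_le hkl
      rw [dist_comm, Real.dist_eq]
      exact hosc k j x
    · have := (hr.mul_const C).mul_const (2 + β * V x + β * (V x + K / (1 - ρ)))
      simpa using this
  obtain ⟨L, hL⟩ := hlim z
  refine ⟨L, fun x => ?_⟩
  have hdiff : Tendsto (fun k => (T ^ k) φ x - (T ^ k) φ z) atTop (𝓝 0) := by
    refine squeeze_zero_norm (fun k => hc φ C hC0 hC k x z) ?_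
    have := (hr.mul_const C).mul_const (2 + β * V x + β * V z)
    simpa using this
  simpa using hdiff.add hL

/-- The ergodic theorem: the powers of the operator converge to the expectation under a
probability measure, which integrates the weight. -/
theorem exists_invariant [Countable S] [MeasurableSpace S] [MeasurableSingletonClass S]
    (h : IsHarris T V z) : ∃ π : Measure S, IsProbabilityMeasure π ∧ Integrable V π ∧
      ∀ φ : S → ℝ, (∃ C, ∀ x, |φ x| ≤ C) →
        ∀ x, Tendsto (fun k => (T ^ k) φ x) atTop (𝓝 (∫ y, φ y ∂π)) := by
  classical
  obtain ⟨ρ, K, hρ0, hρ, hK, hd⟩ := h.drift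
  have hρ' : 0 < 1 - ρ := by linarith
  set B := V z + K / (1 - ρ) with hB
  have hVz := h.weight_nonneg z
  simp only [Pi.zero_apply] at hVz
  have hB0 : 0 ≤ B := by positivity
  have hTV : ∀ k, (T ^ k) V z ≤ B := fun k => by
    have h3 := pow_drift h.nonneg h.one hρ0 hρ hK hd k z
    have h4 : ρ ^ k * V z ≤ 1 * V z :=
      mul_le_mul_of_nonneg_right (pow_le_one₀ hρ0 hρ.le) hVz
    linarith
  choose! L hL using h.exists_limit
  have hind : ∀ A : Set S, ∃ C, ∀ x, |A.indicator (1 : S → ℝ) x| ≤ C := fun A => ⟨1, fun x => by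
    by_cases hx : x ∈ A <;> simp [hx]⟩
  -- The candidate mass at w is the limit of the transition probabilities from z.
  set p : S → ℝ := fun w => L (Set.indicator {w} 1) with hp
  have hp0 : ∀ w, 0 ≤ p w := fun w => ge_of_tendsto' (hL _ (hind {w}) z) fun k =>
    pow_nonneg h.nonneg k _ (fun x => Set.indicator_nonneg (fun _ _ => zero_le_one) x) z
  have hsum : ∀ φ : S → ℝ, (∃ C, ∀ x, |φ x| ≤ C) → HasSum (fun w => p w * φ w) (L φ) := by
    rintro φ ⟨C, hC⟩
    have hC0 : 0 ≤ C := (abs_nonneg _).trans (hC z)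
    -- Tightness: outside F one has |φ| ≤ C ≤ (C / R) V, and T ^ k V z stays below B, so no mass
    -- escapes to infinity.
    have key : ∀ R : ℝ, 0 < R → ∀ F : Finset S, (∀ w, V w ≤ R → w ∈ F) →
        |∑ w ∈ F, p w * φ w - L φ| ≤ C * B / R := by
      intro R hR F hF
      have ht : Tendsto (fun k => ∑ w ∈ F, (T ^ k) (Set.indicator {w} 1) z * φ w
          - (T ^ k) φ z) atTop (𝓝 (∑ w ∈ F, p w * φ w - L φ)) :=
        (tendsto_finsetSum _ fun w _ => (hL _ (hind {w}) z).mul_const _).sub (hL φ ⟨C, hC⟩ z)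
      refine le_of_tendsto' ht.abs fun k => ?_
      have e : ∑ w ∈ F, (T ^ k) (Set.indicator {w} 1) z * φ w - (T ^ k) φ z =
          (T ^ k) (∑ w ∈ F, φ w • Set.indicator {w} (1 : S → ℝ) - φ) z := by
        rw [map_sub, map_sum, Pi.sub_apply, Finset.sum_apply]
        congr 1
        refine Finset.sum_congr rfl fun w _ => ?_
        rw [map_smul, Pi.smul_apply, smul_eq_mul, mul_comm]
      rw [e]
      have hle : (T ^ k) ((C / R) • V) z ≤ C * B / R := by
        rw [map_smul, Pi.smul_apply, smul_eq_mul]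
        have := hTV k
        calc C / R * (T ^ k) V z ≤ C / R * B := by gcongr
          _ = _ := by ring
      refine (abs_map_le (pow_nonneg h.nonneg k) (fun x => ?_) z).trans hle
      have hx0 := h.weight_nonneg x
      simp only [Pi.zero_apply] at hx0
      have e2 : (∑ w ∈ F, φ w • Set.indicator {w} (1 : S → ℝ)) x = if x ∈ F then φ x else 0 := by
        rw [Finset.sum_apply]
        simp [Pi.single_apply]
      rw [Pi.sub_apply, e2]
      split_ifs with hx
      · simp; positivity
      · have : R < V x := not_le.1 fun hh => hx (hF x hh)
        rw [zero_sub, abs_neg]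
        refine (hC x).trans ?_
        simp only [Pi.smul_apply, smul_eq_mul]
        rw [div_mul_eq_mul_div, le_div_iff₀ hR]
        gcongr
    rw [HasSum, SummationFilter.unconditional_filter, Metric.tendsto_atTop]
    intro ε hε
    set R := C * B / (ε / 2) + 1 with hRdef
    have hR : 0 < R := by positivity
    refine ⟨(h.finite R).toFinset, fun F hF => ?_⟩
    rw [Real.dist_eq]
    refine (key R hR F fun w hw => hF (by simpa using hw)).trans_lt ?_
    rw [div_lt_iff₀ hR, hRdef]
    have : ε * (C * B / (ε / 2) + 1) = 2 * (C * B) + ε := by field_simp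
    rw [this]
    have : 0 ≤ C * B := by positivity
    linarith
  have hL1 : L 1 = 1 := by
    refine tendsto_nhds_unique (hL 1 ⟨1, fun x => by simp⟩ z) ?_
    simp [pow_one h.one]
  have hpsum : HasSum (fun w => ENNReal.ofReal (p w)) 1 := by
    have := hsum 1 ⟨1, fun x => by simp⟩
    simp only [Pi.one_apply, mul_one, hL1] at this
    have h2 := ENNReal.ofReal_tsum_of_nonneg hp0 this.summable
    rw [this.tsum_eq, ENNReal.ofReal_one] at h2
    rw [h2]
    exact ENNReal.summable.hasSum
  set μ : PMF S := ⟨fun w => ENNReal.ofReal (p w), hpsum⟩ with hμ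
  have hint : ∀ φ : S → ℝ, (∃ C, ∀ x, |φ x| ≤ C) → ∫ y, φ y ∂μ.toMeasure = L φ := by
    rintro φ ⟨C, hC⟩
    rw [PMF.integral_eq_tsum _ _ (Integrable.of_bound
      Measurable.of_discrete.aestronglyMeasurable C (ae_of_all _ hC)),
      ← (hsum φ ⟨C, hC⟩).tsum_eq]
    refine tsum_congr fun w => ?_
    change (ENNReal.ofReal (p w)).toReal • φ w = _
    rw [ENNReal.toReal_ofReal (hp0 w), smul_eq_mul]
  refine ⟨μ.toMeasure, inferInstance, ?_, fun φ hφ x => by rw [hint φ hφ]; exact hL φ hφ x⟩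
  -- The limit is identified for bounded functions only; the unbounded weight is reached through
  -- truncations and Fatou's lemma.
  have htr : ∀ N : ℕ, ∃ C, ∀ x, |min (V x) N| ≤ C := fun N => ⟨N, fun x => by
    rw [abs_of_nonneg (le_min (h.weight_nonneg x) (by positivity))]; exact min_le_right _ _⟩
  refine ⟨Measurable.of_discrete.aestronglyMeasurable, ?_⟩
  have hlim : ∀ x, ‖V x‖ₑ = liminf (fun N : ℕ => ‖min (V x) (N : ℝ)‖ₑ) atTop := fun x => by
    refine (Tendsto.liminf_eq (tendsto_const_nhds.congr' ?_)).symm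
    filter_upwards [eventually_ge_atTop ⌈V x⌉₊] with N hN
    rw [min_eq_left (Nat.ceil_le.1 hN)]
  rw [HasFiniteIntegral, lintegral_congr hlim]
  refine (lintegral_liminf_le fun N => Measurable.of_discrete).trans_lt ?_
  refine lt_of_le_of_lt ?_ (ENNReal.ofReal_lt_top (r := B))
  refine liminf_le_of_le (by isBoundedDefault) fun b hb => ?_
  obtain ⟨N, hN⟩ := hb.exists
  refine hN.trans ?_
  have hnn : ∀ x, 0 ≤ min (V x) (N : ℝ) := fun x =>
    le_min (h.weight_nonneg x) (by positivity)
  have : ∫⁻ x, ‖min (V x) (N : ℝ)‖ₑ ∂μ.toMeasure =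
      ENNReal.ofReal (∫ x, min (V x) (N : ℝ) ∂μ.toMeasure) := by
    rw [ofReal_integral_eq_lintegral_ofReal _ (ae_of_all _ hnn)]
    · exact lintegral_congr fun x => by rw [Real.enorm_eq_ofReal (hnn x)]
    · obtain ⟨C, hC⟩ := htr N
      exact Integrable.of_bound Measurable.of_discrete.aestronglyMeasurable C (ae_of_all _ hC)
  rw [this, hint _ (htr N)]
  refine ENNReal.ofReal_le_ofReal (le_of_tendsto' (hL _ (htr N) z) fun k => ?_)
  exact (mono (pow_nonneg h.nonneg k) (fun x => min_le_left _ _) z).trans (hTV k)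

end IsHarris

end Averaging

namespace MaxWeightSwitch

variable {n : ℕ}

/-! ### MaxWeight and doubly stochastic rates -/

lemma minEntry_le (ν : Matrix (Fin n) (Fin n) ℝ) (i j : Fin n) : minEntry ν ≤ ν i j :=
  ciInf_le (Set.finite_range fun k : Fin n × Fin n => ν k.1 k.2).bddBelow (i, j)

lemma inner_doublyStochastic_sub_schedule_le {ν : Matrix (Fin n) (Fin n) ℝ}
    (hν : ν ∈ doublyStochastic ℝ (Fin n)) {x s : NatArray n} (hs : s ∈ maxWeightSchedules x) :
    inner ℝ (vec x) (matVec ν - vec s) ≤ 0 := by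
  rw [mem_doublyStochastic_iff_sum] at hν
  rw [inner_sub_right, sub_nonpos]
  exact sum_mul_le_inner hs hν.1 (fun i => (hν.2.1 i).le) fun j => (hν.2.2 j).le

lemma inner_additive_eq_zero (hn : 0 < n) {y w : ArrayVec n} (hy : y ∈ additiveSubspace n)
    (hr : ∀ i, ∑ j, w (i, j) = 0) (hc : ∀ j, ∑ i, w (i, j) = 0) : inner ℝ y w = 0 := by
  have h1 : addProj y = y := Submodule.starProjection_eq_self_iff.2 hy
  have h2 : addProj w = 0 := by rw [addProj_eq hn]; ext p; simp [hr, hc]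
  have h3 : inner ℝ y w = inner ℝ y (addProj w) := by
    conv_lhs => rw [← h1]
    unfold addProj
    rw [Submodule.inner_starProjection_left_eq_right]
  rw [h3, h2, inner_zero_right]

/-- Under MaxWeight the queue lengths are pushed towards the cone. -/
lemma inner_sub_coneProj_le (hn : 0 < n) {ν : Matrix (Fin n) (Fin n) ℝ}
    (hν : ν ∈ doublyStochastic ℝ (Fin n)) (hmin : 0 < minEntry ν) {x s : NatArray n}
    (hs : s ∈ maxWeightSchedules x) {y : ArrayVec n} (hy : y ∈ collapseCone n)
    (hxy : inner ℝ (vec x - y) y = 0)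
    (hw : ∀ w ∈ collapseCone n, inner ℝ (vec x - y) w ≤ 0) :
    inner ℝ (vec x - y) (matVec ν - vec s) ≤ - minEntry ν * ‖vec x - y‖ := by
  have hν' := mem_doublyStochastic_iff_sum.1 hν
  set z := vec x - y with hz
  -- ν and s have equal row and column sums, which additive arrays cannot tell apart.
  have hyν : inner ℝ y (matVec ν - vec s) = 0 := by
    refine inner_additive_eq_zero hn hy.1 (fun i => ?_) fun j => ?_
    · have : ∑ j, (s i j : ℝ) = 1 := by exact_mod_cast hs.1.2.1 i
      simp [Finset.sum_sub_distrib, hν'.2.1 i, this]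
    · have : ∑ i, (s i j : ℝ) = 1 := by exact_mod_cast hs.1.2.2 j
      simp [Finset.sum_sub_distrib, hν'.2.2 j, this]
  have hxz : inner ℝ z (matVec ν - vec s) = inner ℝ (vec x) (matVec ν - vec s) := by
    rw [hz, inner_sub_left, hyν, sub_zero]
  rcases eq_or_ne z 0 with h0 | h0
  · simp [h0]
  have hzpos : 0 < ‖z‖ := norm_pos_iff.2 h0
  -- Since |z (i, j)| ≤ ‖z‖, the matrix ν + c z stays nonnegative.
  set c := minEntry ν / ‖z‖ with hc
  have hc0 : 0 < c := by positivity
  have hcz : c * ‖z‖ = minEntry ν := by rw [hc]; field_simp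
  have key := sum_mul_le_inner hs (M := Matrix.of fun i j => ν i j + c * z (i, j))
    (fun i j => by
      have h1 := minEntry_le ν i j
      have h2 := (abs_le.1 (abs_apply_le_norm z (i, j))).1
      have h3 : c * (-‖z‖) ≤ c * z (i, j) := by gcongr
      simp only [Matrix.of_apply]
      linarith)
    (fun i => by
      -- The indicator of a row lies in the cone, so polarity makes the row sums of z nonpositive
      -- and ν + c z substochastic; columns are treated alike.
      have h1 := hw (WithLp.toLp 2 fun p => if p.1 = i then 1 else 0)
        ⟨fun _ _ _ _ => by simp, fun p => by simp only; split_ifs <;> simp⟩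
      have h2 : inner ℝ z (WithLp.toLp 2 fun p : Fin n × Fin n => if p.1 = i then (1 : ℝ) else 0) =
          ∑ j, z (i, j) := by
        rw [inner_eq_sum, Finset.sum_eq_single i]
        · simp
        · intro b _ hb; simp [hb]
        · simp
      rw [h2] at h1
      simp only [Matrix.of_apply, Finset.sum_add_distrib, hν'.2.1 i, ← Finset.mul_sum]
      nlinarith)
    (fun j => by
      have h1 := hw (WithLp.toLp 2 fun p => if p.2 = j then 1 else 0)
        ⟨fun _ _ _ _ => by simp only; ring, fun p => by simp only; split_ifs <;> simp⟩
      have h2 : inner ℝ z (WithLp.toLp 2 fun p : Fin n × Fin n => if p.2 = j then (1 : ℝ) else 0) =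
          ∑ i, z (i, j) := by
        rw [inner_eq_sum]
        refine Finset.sum_congr rfl fun i _ => ?_
        rw [Finset.sum_eq_single j]
        · simp
        · intro b _ hb; simp [hb]
        · simp
      rw [h2] at h1
      simp only [Matrix.of_apply, Finset.sum_add_distrib, hν'.2.2 j, ← Finset.mul_sum]
      nlinarith)
  have hM : matVec (Matrix.of fun i j => ν i j + c * z (i, j)) = matVec ν + c • z := by
    ext p; simp
  -- Hence beating ν + c z, and not just ν, gains c‖z‖² = minEntry ν * ‖z‖.
  have hxzz : inner ℝ (vec x) z = ‖z‖ ^ 2 := by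
    have : vec x = z + y := by rw [hz]; abel
    rw [this, inner_add_left, real_inner_self_eq_norm_sq, real_inner_comm, hxy, add_zero]
  rw [hM, inner_add_right, inner_smul_right, hxzz] at key
  rw [hxz, inner_sub_right]
  have : c * ‖z‖ ^ 2 = minEntry ν * ‖z‖ := by rw [sq, ← mul_assoc, hcz]
  linarith

namespace IsArrivalLaw

variable {α : Measure (NatArray n)} {amax : ℝ} {lam σ : Matrix (Fin n) (Fin n) ℝ}

/-! ### Drifts -/

lemma integral_inner (h : IsArrivalLaw α amax lam σ) (z : ArrayVec n) :
    ∫ b, inner ℝ z (vec b) ∂α = inner ℝ z (matVec lam) := by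
  simp only [inner_eq_sum, vec_apply, matVec_apply]
  rw [integral_finsetSum _ fun i _ => h.integrable _]
  refine Finset.sum_congr rfl fun i _ => ?_
  rw [integral_finsetSum _ fun i _ => h.integrable _]
  refine Finset.sum_congr rfl fun j _ => ?_
  rw [integral_const_mul, h.integral_eq]

lemma integral_norm_sq (h : IsArrivalLaw α amax lam σ) :
    ∫ b, ‖vec b‖ ^ 2 ∂α = vnorm lam ^ 2 + vnorm σ ^ 2 := by
  simp only [norm_sq_eq_sum, vec_apply, vnorm_sq]
  rw [integral_finsetSum _ fun i _ => h.integrable _, ← Finset.sum_add_distrib]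
  refine Finset.sum_congr rfl fun i _ => ?_
  rw [integral_finsetSum _ fun i _ => h.integrable _, ← Finset.sum_add_distrib]
  refine Finset.sum_congr rfl fun j _ => ?_
  have := h.integral_sq {(i, j)} 0
  simp only [Finset.sum_singleton, sub_zero] at this
  rw [this]; ring

lemma integral_norm_next_sub_sq_le (h : IsArrivalLaw α amax lam σ) {x s : NatArray n}
    (hs : IsMaximal s) {y : ArrayVec n} (hy : ∀ p, 0 ≤ y p) :
    ∫ b, ‖vec (next x s b) - y‖ ^ 2 ∂α ≤ ‖vec x - y‖ ^ 2 + (vnorm lam ^ 2 + vnorm σ ^ 2 + n) +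
      2 * inner ℝ (vec x - y) (matVec lam - vec s) := by
  have := h.isProbabilityMeasure
  refine (integral_mono (h.integrable _) (h.integrable _)
    fun b => norm_next_sub_sq_le_add hs b hy).trans (le_of_eq ?_)
  simp only [inner_sub_right]
  rw [integral_add (h.integrable _) (h.integrable _), integral_add (h.integrable _)
    (h.integrable _), integral_add (h.integrable _) (h.integrable _), integral_const_mul,
    integral_sub (h.integrable _) (h.integrable _), h.integral_inner, h.integral_norm_sq]
  simp; ring

/-- The slack ε⟨x, ν⟩ dominates ε times the smallest entry times the ℓ¹ norm of x. This drift fades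
as ε → 0 and is needed only for ergodicity. -/
lemma avg_norm_sq_le {ν : Matrix (Fin n) (Fin n) ℝ} {ε : ℝ}
    (h : IsArrivalLaw α amax ((1 - ε) • ν) σ) (hν : ν ∈ doublyStochastic ℝ (Fin n))
    (hmin : 0 < minEntry ν) (hε : 0 < ε) (x : NatArray n) :
    h.avg (fun x => ‖vec x‖ ^ 2) x ≤ ‖vec x‖ ^ 2 +
      (vnorm ((1 - ε) • ν) ^ 2 + vnorm σ ^ 2 + n) - 2 * (ε * minEntry ν) * ‖vec x‖ := by
  refine h.avg_le fun s hs => ?_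
  have h1 := h.integral_norm_next_sub_sq_le hs.1 (x := x) (y := 0) (by simp)
  simp only [sub_zero] at h1
  refine h1.trans ?_
  have h2 := inner_doublyStochastic_sub_schedule_le hν hs
  have e : matVec ((1 - ε) • ν) - vec s = (matVec ν - vec s) - ε • matVec ν := by
    ext p; simp; ring
  have h3 : minEntry ν * ‖vec x‖ ≤ inner ℝ (vec x) (matVec ν) := by
    calc minEntry ν * ‖vec x‖ ≤ minEntry ν * totalQueue x := by
          gcongr; exact norm_vec_le_totalQueue x
      _ = ∑ i, ∑ j, minEntry ν * (x i j : ℝ) := by simp only [totalQueue, Finset.mul_sum]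
      _ ≤ _ := by
          rw [inner_eq_sum]
          refine Finset.sum_le_sum fun i _ => Finset.sum_le_sum fun j _ => ?_
          rw [mul_comm]
          exact mul_le_mul_of_nonneg_left (minEntry_le ν i j) (by positivity)
  have h4 : ε * (minEntry ν * ‖vec x‖) ≤ ε * inner ℝ (vec x) (matVec ν) := by gcongr
  rw [e, inner_sub_right (vec x) (matVec ν - vec s), inner_smul_right]
  linarith

/-- MaxWeight supplies the drift `minEntry ν`, and the load reduction ε ν spoils at most half of it,
so the rate does not depend on ε. -/
lemma avg_coneDist_sq_le (hn : 0 < n) {ν : Matrix (Fin n) (Fin n) ℝ} {ε : ℝ}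
    (h : IsArrivalLaw α amax ((1 - ε) • ν) σ) (hν : ν ∈ doublyStochastic ℝ (Fin n))
    (hmin : 0 < minEntry ν) (hε : 0 < ε) (hε' : ε * vnorm ν ≤ minEntry ν / 2)
    (x : NatArray n) :
    h.avg (fun x => coneDist x ^ 2) x ≤ coneDist x ^ 2 +
      (vnorm ((1 - ε) • ν) ^ 2 + vnorm σ ^ 2 + n) - 2 * (minEntry ν / 2) * coneDist x := by
  obtain ⟨y, hy, hd, hxy, hw⟩ := exists_coneProj x
  refine h.avg_le fun s hs => ?_
  have h1 := h.integral_norm_next_sub_sq_le hs.1 (x := x) hy.2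
  have h2 := inner_sub_coneProj_le hn hν hmin hs hy hxy hw
  have e : matVec ((1 - ε) • ν) - vec s = (matVec ν - vec s) - ε • matVec ν := by
    ext p; simp; ring
  -- The old projection y is still a competitor for the new distance.
  have h3 : ∫ b, coneDist (next x s b) ^ 2 ∂α ≤ ∫ b, ‖vec (next x s b) - y‖ ^ 2 ∂α := by
    refine integral_mono (h.integrable _) (h.integrable _) fun b => ?_
    have : coneDist (next x s b) ≤ ‖vec (next x s b) - y‖ := by
      rw [← dist_eq_norm]; exact Metric.infDist_le_dist_of_mem hy
    exact pow_le_pow_left₀ (coneDist_nonneg _) this 2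
  have h4 := (abs_le.1 (abs_real_inner_le_norm (vec x - y) (matVec ν))).1
  rw [norm_matVec] at h4
  have h5 : ε * (-(‖vec x - y‖ * vnorm ν)) ≤ ε * inner ℝ (vec x - y) (matVec ν) := by gcongr
  have h6 : ε * vnorm ν * ‖vec x - y‖ ≤ minEntry ν / 2 * ‖vec x - y‖ := by gcongr
  rw [e, inner_sub_right (vec x - y) (matVec ν - vec s), inner_smul_right, hd] at h1
  rw [hd] at h2 h5 h6
  linarith

/-- A drift of the square of a function gives a drift of the function. -/
lemma avg_le_sub_of_avg_sq_le (h : IsArrivalLaw α amax lam σ) {W : NatArray n → ℝ}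
    {A η : ℝ} (hA : 0 < A) (hη : 0 < η) {x : NatArray n}
    (hd : h.avg (fun x => W x ^ 2) x ≤ W x ^ 2 + A - 2 * η * W x) (hx : A / η ≤ W x) :
    h.avg W x ≤ W x - η / 2 := by
  have hW : 0 < W x := lt_of_lt_of_le (by positivity) hx
  -- Concavity of the square root: w ≤ (w² + W²) / (2W).
  have h1 : h.avg W x ≤ h.avg ((1 / (2 * W x)) • ((fun x => W x ^ 2) + fun _ => W x ^ 2)) x := by
    refine h.avg_le_avg fun s _ b _ => ?_
    simp only [Pi.smul_apply, Pi.add_apply, smul_eq_mul]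
    rw [one_div, inv_mul_eq_div, le_div_iff₀ (by positivity)]
    nlinarith [sq_nonneg (W (next x s b) - W x)]
  rw [map_smul, map_add, Pi.smul_apply, Pi.add_apply, h.avg_const, smul_eq_mul] at h1
  refine h1.trans ?_
  rw [one_div, inv_mul_eq_div, div_le_iff₀ (by positivity)]
  rw [div_le_iff₀ hη] at hx
  nlinarith

/-- A negative drift with bounded jumps gives a geometric drift of an exponential. -/
lemma exists_exp_drift (h : IsArrivalLaw α amax lam σ) {W : NatArray n → ℝ} {κ η D : ℝ}
    (hη : 0 < η) (hD : 0 < D) (hd : ∀ x, κ ≤ W x → h.avg W x ≤ W x - η)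
    (hb : ∀ x, ∀ s ∈ maxWeightSchedules x, ∀ b : NatArray n, (∀ i j, (b i j : ℝ) ≤ amax) →
      |W (next x s b) - W x| ≤ D) :
    ∃ θ ρ K : ℝ, 0 < θ ∧ 0 ≤ ρ ∧ ρ < 1 ∧ 0 ≤ K ∧
      ∀ x, h.avg (fun x => Real.exp (θ * W x)) x ≤ ρ * Real.exp (θ * W x) + K := by
  set η₁ := min η D with hη₁
  have hη₁0 : 0 < η₁ := lt_min hη hD
  -- The quadratic term θ²D² of the expansion then costs half of the linear gain θη₁, and η₁ ≤ D
  -- keeps the exponents within the range of exp t ≤ 1 + t + t².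
  set θ := η₁ / (2 * D ^ 2) with hθ
  have hθ0 : 0 < θ := by positivity
  have hθD : θ * D ≤ 1 / 2 := by
    have : η₁ ≤ D := min_le_right _ _
    have e : θ * D = η₁ / (2 * D) := by rw [hθ]; field_simp
    rw [e, div_le_iff₀ (by positivity)]; linarith
  have hθD2 : θ ^ 2 * D ^ 2 = θ * η₁ / 2 := by rw [hθ]; field_simp
  have hθη : θ * η₁ ≤ 1 / 2 := by
    have : θ * η₁ ≤ θ * D := by gcongr; exact min_le_right _ _
    linarith
  refine ⟨θ, 1 - θ * η₁ / 2, Real.exp (θ * (κ + D)), hθ0, by linarith, ?_, by positivity,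
    fun x => ?_⟩
  · have : 0 < θ * η₁ := by positivity
    linarith
  rcases le_or_gt κ (W x) with hx | hx
  · have h1 : h.avg (fun x => Real.exp (θ * W x)) x ≤
        h.avg (Real.exp (θ * W x) • (θ • W + fun _ => 1 - θ * W x + θ ^ 2 * D ^ 2)) x := by
      refine h.avg_le_avg fun s hs b hb' => ?_
      have h2 := hb x s hs b hb'
      set w := W (next x s b)
      have h3 : |θ * (w - W x)| ≤ θ * D := by
        rw [abs_mul, abs_of_pos hθ0]; gcongr
      have h4 := (abs_le.1 (Real.abs_exp_sub_one_sub_id_le (h3.trans (by linarith)))).2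
      have h5 : (θ * (w - W x)) ^ 2 ≤ θ ^ 2 * D ^ 2 := by
        rw [← mul_pow, ← sq_abs]; exact pow_le_pow_left₀ (abs_nonneg _) h3 2
      have e : Real.exp (θ * w) = Real.exp (θ * W x) * Real.exp (θ * (w - W x)) := by
        rw [← Real.exp_add]; congr 1; ring
      simp only [Pi.smul_apply, Pi.add_apply, smul_eq_mul]
      rw [e]
      gcongr
      linarith
    rw [map_smul, map_add, map_smul] at h1
    simp only [Pi.smul_apply, Pi.add_apply, smul_eq_mul, h.avg_const] at h1
    refine h1.trans ?_
    have h6 : θ * h.avg W x ≤ θ * (W x - η) := by gcongr; exact hd x hx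
    have h7 : θ * η₁ ≤ θ * η := by gcongr; exact min_le_left _ _
    have h8 : θ * h.avg W x + (1 - θ * W x + θ ^ 2 * D ^ 2) ≤ 1 - θ * η₁ / 2 := by
      rw [hθD2]; linarith
    have h9 := mul_le_mul_of_nonneg_left h8 (Real.exp_nonneg (θ * W x))
    have := Real.exp_nonneg (θ * (κ + D))
    linarith
  · have h1 : h.avg (fun x => Real.exp (θ * W x)) x ≤
        h.avg (fun _ => Real.exp (θ * (κ + D))) x := by
      refine h.avg_le_avg fun s hs b hb' => ?_
      have h2 := (abs_le.1 (hb x s hs b hb')).2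
      gcongr
      linarith
    rw [h.avg_const] at h1
    have : 0 ≤ (1 - θ * η₁ / 2) * Real.exp (θ * W x) :=
      mul_nonneg (by linarith) (Real.exp_nonneg _)
    linarith

/-! ### Draining the queues -/

/-- If some queue is nonempty, the schedule serving it alone has positive weight; so the MaxWeight
schedule has too and removes at least one packet. -/
lemma sub_schedule_sum_le {x s : NatArray n} (hs : s ∈ maxWeightSchedules x) {m : ℕ}
    (hx : ∑ i, ∑ j, x i j ≤ m + 1) : ∑ i, ∑ j, (x i j - s i j) ≤ m := by
  rcases eq_or_ne x 0 with h0 | h0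
  · simp [h0]
  obtain ⟨i, j, hij⟩ : ∃ i j, x i j ≠ 0 := by
    by_contra! hc; exact h0 (by ext i j; exact hc i j)
  have hw : 0 < weight x s := by
    set e : NatArray n := fun i' j' => if i' = i ∧ j' = j then 1 else 0 with he
    have hfe : IsFeasible e := by
      refine ⟨fun i' j' => by simp only [he]; split_ifs <;> simp, fun i' => ?_, fun j' => ?_⟩
      · simp only [he, Finset.sum_ite, Finset.sum_const, smul_eq_mul, mul_one, mul_zero, add_zero]
        refine Finset.card_le_one.2 fun a ha b hb => ?_
        simp at ha hb; exact ha.2.trans hb.2.symm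
      · simp only [he, Finset.sum_ite, Finset.sum_const, smul_eq_mul, mul_one, mul_zero, add_zero]
        refine Finset.card_le_one.2 fun a ha b hb => ?_
        simp at ha hb; exact ha.1.trans hb.1.symm
    refine lt_of_lt_of_le ?_ (hs.2 e hfe)
    refine Finset.sum_pos' (fun _ _ => Nat.zero_le _) ⟨i, by simp, ?_⟩
    refine Finset.sum_pos' (fun _ _ => Nat.zero_le _) ⟨j, by simp, ?_⟩
    simp [he]; omega
  obtain ⟨i', -, hi'⟩ := Finset.exists_ne_zero_of_sum_ne_zero hw.ne'
  obtain ⟨j', -, hij'⟩ := Finset.exists_ne_zero_of_sum_ne_zero hi'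
  have hx1 : x i' j' ≠ 0 := left_ne_zero_of_mul hij'
  have hs1 : s i' j' ≠ 0 := right_ne_zero_of_mul hij'
  have hlt : ∑ i, ∑ j, (x i j - s i j) < ∑ i, ∑ j, x i j := by
    refine Finset.sum_lt_sum (fun i _ => Finset.sum_le_sum fun j _ => Nat.sub_le _ _)
      ⟨i', by simp, ?_⟩
    exact Finset.sum_lt_sum (fun j _ => Nat.sub_le _ _) ⟨j', by simp, by omega⟩
  omega

lemma mul_le_avg (h : IsArrivalLaw α amax lam σ) {g : NatArray n → ℝ} (hg : 0 ≤ g)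
    {x : NatArray n} {c : ℝ}
    (hc : ∀ s ∈ maxWeightSchedules x, c ≤ g (fun i j => x i j - s i j)) :
    α.real {0} * c ≤ h.avg g x := by
  have := h.isProbabilityMeasure
  refine h.le_avg fun s hs => ?_
  have h1 : ∫ b, ({0} : Set (NatArray n)).indicator (fun _ => g (next x s 0)) b ∂α ≤
      ∫ b, g (next x s b) ∂α := by
    refine integral_mono (h.integrable _) (h.integrable _) fun b => ?_
    by_cases hb : b = 0
    · simp [hb]
    · simp only [Set.mem_singleton_iff, hb, not_false_eq_true, Set.indicator_of_notMem]
      exact hg _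
  rw [integral_indicator (measurableSet_singleton 0), setIntegral_const, smul_eq_mul] at h1
  refine le_trans ?_ h1
  gcongr
  exact hc s hs

/-- During m consecutive slots without arrivals a total of at most m drains away, and an empty
switch stays empty. -/
lemma pow_mul_le_pow_avg (h : IsArrivalLaw α amax lam σ) (m : ℕ) (x : NatArray n)
    (hx : ∑ i, ∑ j, x i j ≤ m) (g : NatArray n → ℝ) (hg : 0 ≤ g) :
    α.real {0} ^ m * g 0 ≤ (h.avg ^ m) g x := by
  induction m generalizing x with
  | zero =>
    have : x = 0 := by
      ext i j
      have h1 : ∑ i, ∑ j, x i j = 0 := by omega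
      rw [Finset.sum_eq_zero_iff] at h1
      exact Finset.sum_eq_zero_iff.1 (h1 i (by simp)) j (by simp)
    simp [this]
  | succ m ih =>
    rw [pow_succ' (h.avg), Module.End.mul_apply, pow_succ', mul_assoc]
    refine h.mul_le_avg (Averaging.pow_nonneg (fun f => h.avg_nonneg) m g hg) fun s hs => ?_
    exact ih _ (sub_schedule_sum_le hs hx)

lemma exists_isHarris (hn : 0 < n) {ν : Matrix (Fin n) (Fin n) ℝ} {ε : ℝ}
    (h : IsArrivalLaw α amax ((1 - ε) • ν) σ) (hν : ν ∈ doublyStochastic ℝ (Fin n))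
    (hmin : 0 < minEntry ν) (hε : 0 < ε) :
    ∃ θ : ℝ, 0 < θ ∧ Averaging.IsHarris h.avg (fun x => Real.exp (θ * ‖vec x‖)) 0 := by
  have hD : 0 < n * amax := by have := h.one_le; positivity
  obtain ⟨θ, ρ, K, hθ, hρ0, hρ, hK, hd⟩ := h.exists_exp_drift (W := fun x => ‖vec x‖)
    (κ := (vnorm ((1 - ε) • ν) ^ 2 + vnorm σ ^ 2 + n) / (ε * minEntry ν))
    (η := ε * minEntry ν / 2) (D := n * amax) (by positivity) hD
    (fun x hx => h.avg_le_sub_of_avg_sq_le (by positivity) (by positivity)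
      (h.avg_norm_sq_le hν hmin hε x) hx)
    (fun x s hs b hb => (abs_norm_sub_norm_le _ _).trans (norm_next_sub_le hs.1 h.one_le hb))
  have hbound : ∀ R : ℝ, ∀ x : NatArray n, Real.exp (θ * ‖vec x‖) ≤ R →
      ‖vec x‖ ≤ |R| / θ := by
    intro R x hx
    rw [le_div_iff₀ hθ, mul_comm]
    have := Real.add_one_le_exp (θ * ‖vec x‖)
    linarith [le_abs_self R]
  refine ⟨θ, hθ, fun f => h.avg_nonneg, h.avg_one, fun x => (Real.exp_pos _).le,
    ⟨ρ, K, hρ0, hρ, hK, hd⟩, fun R => ?_, fun R => ?_⟩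
  · refine (finite_setOf_le ⌊|R| / θ⌋₊).subset fun x hx i j => Nat.le_floor ?_
    exact ((le_abs_self _).trans (abs_apply_le_norm (vec x) (i, j))).trans (hbound R x hx)
  -- One drain time serves the whole sublevel set; the added 1 makes the exponent positive.
  · refine ⟨⌈n ^ 2 * (|R| / θ)⌉₊ + 1, _, by omega, pow_pos h.zero_pos _, fun x hx g hg =>
      h.pow_mul_le_pow_avg _ x ?_ g hg⟩
    have h1 : totalQueue x ≤ n ^ 2 * (|R| / θ) := (totalQueue_le x).trans (by
      gcongr; exact hbound R x hx)
    have h2 : totalQueue x = ((∑ i, ∑ j, x i j : ℕ) : ℝ) := by simp [totalQueue]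
    rw [h2] at h1
    have h3 : ∑ i, ∑ j, x i j ≤ ⌈n ^ 2 * (|R| / θ)⌉₊ := by exact_mod_cast h1.trans (Nat.le_ceil _)
    omega

end IsArrivalLaw

end MaxWeightSwitch

/-! ### Moments from geometric tails -/

/-- By the hockey-stick identity the right side is the rising factorial N(N+1)⋯(N+r-1). -/
lemma pow_le_factorial_mul_sum (N r : ℕ) (hr : 1 ≤ r) :
    N ^ r ≤ r.factorial * ∑ m ∈ Finset.range N, (m + (r - 1)).choose (r - 1) := by
  obtain ⟨k, rfl⟩ := Nat.exists_eq_add_of_le' hr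
  rcases N with _ | N
  · simp
  rw [Nat.add_sub_cancel, Nat.sum_range_add_choose]
  have h1 := Nat.pow_succ_le_ascFactorial (N + 1) (k + 1)
  rw [Nat.ascFactorial_eq_factorial_mul_choose'] at h1
  convert h1 using 3
  omega

/-- The Stirling sequence decreases from its first value e/√2. -/
lemma factorial_le_stirling {r : ℕ} (hr : 1 ≤ r) :
    (r.factorial : ℝ) ≤ √r * Real.exp 1 * (r / Real.exp 1) ^ r := by
  obtain ⟨k, rfl⟩ := Nat.exists_eq_add_of_le' hr
  have h := Stirling.stirlingSeq'_antitone (Nat.zero_le k)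
  simp only [Function.comp_apply, Nat.succ_eq_add_one, zero_add, Stirling.stirlingSeq_one] at h
  rw [Stirling.stirlingSeq, div_le_iff₀ (by positivity)] at h
  refine h.trans (le_of_eq ?_)
  rw [Real.sqrt_mul (by norm_num)]
  field_simp

/-- The moments of a natural number valued variable with geometric tails. -/
lemma lintegral_pow_le_of_geometric_tail {S : Type*} [MeasurableSpace S]
    [DiscreteMeasurableSpace S] {π : Measure S} [IsProbabilityMeasure π] {N : S → ℕ} {q : ℝ}
    (hq0 : 0 ≤ q) (hq : q < 1) (h : ∀ m : ℕ, π.real {x | m < N x} ≤ q ^ m) {r : ℕ} (hr : 1 ≤ r) :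
    ∫⁻ x, ENNReal.ofReal ((N x : ℝ) ^ r) ∂π ≤ ENNReal.ofReal (r.factorial * (1 / (1 - q)) ^ r) := by
  -- Majorizing the increments of N^r by binomials turns the tail sum into a negative binomial
  -- series, summed exactly.
  set c : ℕ → ℝ := fun m => r.factorial * (m + (r - 1)).choose (r - 1) with hc
  have hc0 : ∀ m, 0 ≤ c m := fun m => by simp only [hc]; positivity
  have hpt : ∀ x, ENNReal.ofReal ((N x : ℝ) ^ r) ≤
      ∑' m, {x | m < N x}.indicator (fun _ => ENNReal.ofReal (c m)) x := by
    intro x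
    have h1 : ((N x : ℝ) ^ r) ≤ ∑ m ∈ Finset.range (N x), c m := by
      have := pow_le_factorial_mul_sum (N x) r hr
      simp only [hc, ← Finset.mul_sum]
      exact_mod_cast this
    refine (ENNReal.ofReal_le_ofReal h1).trans ?_
    rw [ENNReal.ofReal_sum_of_nonneg fun m _ => hc0 m]
    refine le_trans (le_of_eq ?_) (ENNReal.sum_le_tsum (Finset.range (N x)))
    refine Finset.sum_congr rfl fun m hm => ?_
    rw [Set.indicator_of_mem]
    exact Finset.mem_range.1 hm
  have hq' : ‖q‖ < 1 := by rwa [Real.norm_of_nonneg hq0]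
  have hs := summable_choose_mul_geometric_of_norm_lt_one (r - 1) hq'
  calc ∫⁻ x, ENNReal.ofReal ((N x : ℝ) ^ r) ∂π
      ≤ ∫⁻ x, ∑' m, {x | m < N x}.indicator (fun _ => ENNReal.ofReal (c m)) x ∂π :=
        lintegral_mono hpt
    _ = ∑' m, ENNReal.ofReal (c m) * π {x | m < N x} := by
        rw [lintegral_tsum fun m => Measurable.of_discrete.aemeasurable]
        refine tsum_congr fun m => ?_
        rw [lintegral_indicator (MeasurableSet.of_discrete), setLIntegral_const]
    _ ≤ ∑' m : ℕ, ENNReal.ofReal (c m * q ^ m) := by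
        refine ENNReal.tsum_le_tsum fun m => ?_
        rw [ENNReal.ofReal_mul (hc0 m)]
        gcongr
        rw [← ofReal_measureReal]
        exact ENNReal.ofReal_le_ofReal (h m)
    _ = ENNReal.ofReal (∑' m : ℕ, c m * q ^ m) := by
        rw [ENNReal.ofReal_tsum_of_nonneg fun m => mul_nonneg (hc0 m) (by positivity)]
        simp only [hc, mul_assoc]
        exact hs.mul_left _
    _ = _ := by
        congr 1
        simp only [hc, mul_assoc]
        rw [tsum_mul_left, tsum_choose_mul_geometric_of_norm_lt_one _ hq', Nat.sub_add_cancel hr,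
          one_div_pow]

namespace MaxWeightSwitch

variable {n : ℕ}

namespace IsArrivalLaw

variable {α π : Measure (NatArray n)} {amax : ℝ} {lam σ : Matrix (Fin n) (Fin n) ℝ}

/-! ### Stationarity -/

/-- The zero-drift principle of steady state, for every integrable test function. -/
lemma integrable_avg_and_integral_avg (h : IsArrivalLaw α amax lam σ)
    (hπ : IsStationaryLaw α π) {f : NatArray n → ℝ} (hf : Integrable f π) :
    Integrable (h.avg f) π ∧ ∫ x, h.avg f x ∂π = ∫ x, f x ∂π := by
  set κ : Kernel (NatArray n) (NatArray n) := ⟨stepLaw α, Measurable.of_discrete⟩ with hκ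
  have hb : (κ ∘ₖ Kernel.const Unit π) () = π := by
    rw [Kernel.comp_apply, Kernel.const_apply]; exact hπ
  have hf' : Integrable f ((κ ∘ₖ Kernel.const Unit π) ()) := by rwa [hb]
  constructor
  · exact hf'.integral_comp
  · have := Kernel.integral_comp hf'
    rw [hb] at this
    exact this.symm

lemma isStationaryLaw_of_integral_avg [IsProbabilityMeasure π]
    (h : IsArrivalLaw α amax lam σ)
    (hint : ∀ f : NatArray n → ℝ, (∃ C, ∀ x, |f x| ≤ C) → ∫ x, h.avg f x ∂π = ∫ x, f x ∂π) :
    IsStationaryLaw α π := by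
  have := h.isProbabilityMeasure
  refine Measure.ext fun A hA => ?_
  rw [Measure.bind_apply hA Measurable.of_discrete.aemeasurable]
  have h1 := hint (A.indicator 1) ⟨1, fun x => by by_cases hx : x ∈ A <;> simp [hx]⟩
  rw [integral_indicator_one hA] at h1
  have h2 : ∀ x, h.avg (A.indicator 1) x = (stepLaw α x A).toReal := fun x => by
    rw [avg_apply, integral_indicator_one hA]; rfl
  simp only [h2] at h1
  rw [integral_toReal Measurable.of_discrete.aemeasurable
    (ae_of_all _ fun x => measure_lt_top _ _)] at h1
  refine (ENNReal.toReal_eq_toReal_iff' ?_ (measure_ne_top _ _)).1 h1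
  refine ne_top_of_le_ne_top (b := 1) ENNReal.one_ne_top ?_
  calc _ ≤ ∫⁻ _, 1 ∂π := lintegral_mono fun x => prob_le_one
    _ = 1 := by simp

/-! ### Moments of functions with negative drift -/

/-- Apply zero drift to max(W, c): it decreases by η above c + D, where one jump cannot reach c; it
increases by at most D between c - D and c + D; below, it stays equal to c. -/
lemma measure_tail_le [IsProbabilityMeasure π] (h : IsArrivalLaw α amax lam σ)
    (hπ : IsStationaryLaw α π)
    {W : NatArray n → ℝ} (hW : Integrable W π) {κ η D c : ℝ} (hD : 0 < D)
    (hd : ∀ x, κ ≤ W x → h.avg W x ≤ W x - η)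
    (hb : ∀ x, ∀ s ∈ maxWeightSchedules x, ∀ b : NatArray n, (∀ i j, (b i j : ℝ) ≤ amax) →
      |W (next x s b) - W x| ≤ D) (hc : κ ≤ c + D) :
    (D + η) * π.real {x | c + D < W x} ≤ D * π.real {x | c - D < W x} := by
  set g : NatArray n → ℝ := fun x => max (W x) c with hg
  have hgi : Integrable g π := hW.sup (integrable_const c)
  obtain ⟨h1, h2⟩ := h.integrable_avg_and_integral_avg hπ hgi
  have hi : ∀ (A : Set (NatArray n)) (d : ℝ), Integrable (A.indicator fun _ => d) π :=
    fun A d => (integrable_const d).indicator MeasurableSet.of_discrete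
  have hpt : ∀ x, h.avg g x + {x | c + D < W x}.indicator (fun _ => D + η) x ≤
      g x + {x | c - D < W x}.indicator (fun _ => D) x := by
    intro x
    rcases lt_or_ge (c + D) (W x) with hx | hx
    · have h3 : h.avg g x ≤ h.avg W x := h.avg_le_avg fun s hs b hb' => by
        have := (abs_le.1 (hb x s hs b hb')).1
        exact max_le le_rfl (by linarith)
      have h4 := hd x (by linarith)
      have h5 : W x ≤ g x := le_max_left _ _
      rw [Set.indicator_of_mem (by exact hx), Set.indicator_of_mem
        (by simp only [Set.mem_ofPred_eq]; linarith)]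
      linarith
    · rw [Set.indicator_of_notMem (by simpa using hx)]
      rcases lt_or_ge (c - D) (W x) with hx' | hx'
      · rw [Set.indicator_of_mem (by exact hx')]
        have h3 : h.avg g x ≤ h.avg (fun _ => g x + D) x := h.avg_le_avg fun s hs b hb' => by
          have := (abs_le.1 (hb x s hs b hb')).2
          have h5 : W x ≤ g x := le_max_left _ _
          have h6 : c ≤ g x := le_max_right _ _
          exact max_le (by linarith) (by linarith)
        rw [h.avg_const] at h3
        linarith
      · rw [Set.indicator_of_notMem (by simpa using hx')]
        have h3 : h.avg g x ≤ h.avg (fun _ => g x) x := h.avg_le_avg fun s hs b hb' => by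
          have := (abs_le.1 (hb x s hs b hb')).2
          have h6 : c ≤ g x := le_max_right _ _
          exact max_le (by linarith) (by linarith)
        rw [h.avg_const] at h3
        linarith
  have h3 := integral_mono (h1.add (hi _ _)) (hgi.add (hi _ _)) hpt
  simp only [Pi.add_apply] at h3
  rw [integral_add h1 (hi _ _), integral_add hgi (hi _ _), h2,
    integral_indicator_const _ MeasurableSet.of_discrete,
    integral_indicator_const _ MeasurableSet.of_discrete, smul_eq_mul, smul_eq_mul] at h3
  linarith

lemma measure_tail_le_pow [IsProbabilityMeasure π] (h : IsArrivalLaw α amax lam σ)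
    (hπ : IsStationaryLaw α π)
    {W : NatArray n → ℝ} (hW : Integrable W π) {κ η D : ℝ} (hη : 0 < η) (hD : 0 < D)
    (hd : ∀ x, κ ≤ W x → h.avg W x ≤ W x - η)
    (hb : ∀ x, ∀ s ∈ maxWeightSchedules x, ∀ b : NatArray n, (∀ i j, (b i j : ℝ) ≤ amax) →
      |W (next x s b) - W x| ≤ D) (m : ℕ) :
    π.real {x | κ + 2 * D * m < W x} ≤ (D / (D + η)) ^ m := by
  induction m with
  | zero => simp
  | succ m ih =>
    have h1 := h.measure_tail_le hπ hW hD hd hb (c := κ + 2 * D * m + D)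
      (by have : 0 ≤ 2 * D * m := by positivity
          linarith)
    have e1 : κ + 2 * D * m + D + D = κ + 2 * D * (m + 1 : ℕ) := by push_cast; ring
    have e2 : κ + 2 * D * m + D - D = κ + 2 * D * m := by ring
    rw [e1, e2] at h1
    rw [pow_succ', div_mul_eq_mul_div, le_div_iff₀ (by positivity), mul_comm]
    refine h1.trans ?_
    gcongr

lemma integrable_pow_and_integral_pow_le [IsProbabilityMeasure π]
    (h : IsArrivalLaw α amax lam σ) (hπ : IsStationaryLaw α π)
    {W : NatArray n → ℝ} (hW0 : ∀ x, 0 ≤ W x) (hW : Integrable W π) {κ η D : ℝ} (hκ : 0 ≤ κ)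
    (hη : 0 < η) (hD : 0 < D)
    (hd : ∀ x, κ ≤ W x → h.avg W x ≤ W x - η)
    (hb : ∀ x, ∀ s ∈ maxWeightSchedules x, ∀ b : NatArray n, (∀ i j, (b i j : ℝ) ≤ amax) →
      |W (next x s b) - W x| ≤ D) {r : ℕ} (hr : 1 ≤ r) :
    Integrable (fun x => W x ^ r) π ∧
    ∫ x, W x ^ r ∂π ≤ (2 * κ) ^ r + r.factorial * (4 * D * ((D + η) / η)) ^ r := by
  -- The number of steps of length 2D above κ; its tails decay geometrically with ratio D / (D + η).
  set N : NatArray n → ℕ := fun x => ⌈(W x - κ) / (2 * D)⌉₊ with hN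
  have hWN : ∀ x, W x ≤ κ + 2 * D * N x := fun x => by
    have := Nat.le_ceil ((W x - κ) / (2 * D))
    rw [div_le_iff₀ (by positivity)] at this
    simp only [hN]; linarith
  have htail : ∀ m : ℕ, π.real {x | m < N x} ≤ (D / (D + η)) ^ m := fun m => by
    have e : {x | m < N x} = {x | κ + 2 * D * m < W x} := by
      ext x
      simp only [hN, Set.mem_ofPred_eq, Nat.lt_ceil]
      rw [lt_div_iff₀ (by positivity)]
      constructor <;> intro hh <;> linarith
    rw [e]
    exact h.measure_tail_le_pow hπ hW hη hD hd hb m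
  have hq : D / (D + η) < 1 := by rw [div_lt_one (by positivity)]; linarith
  have hl := lintegral_pow_le_of_geometric_tail (by positivity) hq htail hr
  have hrat : 1 / (1 - D / (D + η)) = (D + η) / η := by
    have : 1 - D / (D + η) = η / (D + η) := by field_simp; ring
    rw [this, one_div_div]
  rw [hrat] at hl
  have hNi : Integrable (fun x => (N x : ℝ) ^ r) π := by
    refine ⟨Measurable.of_discrete.aestronglyMeasurable, ?_⟩
    rw [hasFiniteIntegral_iff_ofReal (ae_of_all _ fun x => by positivity)]
    exact hl.trans_lt ENNReal.ofReal_lt_top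
  have hNint : ∫ x, (N x : ℝ) ^ r ∂π ≤ r.factorial * ((D + η) / η) ^ r := by
    rw [integral_eq_lintegral_of_nonneg_ae (ae_of_all _ fun x => by positivity) hNi.1]
    exact ENNReal.toReal_le_of_le_ofReal (by positivity) hl
  have hdom : ∀ x, W x ^ r ≤ 2 ^ (r - 1) * (κ ^ r + (2 * D) ^ r * (N x : ℝ) ^ r) := fun x => by
    refine (pow_le_pow_left₀ (hW0 x) (hWN x) r).trans ?_
    rw [← mul_pow]
    exact add_pow_le hκ (by positivity) r
  have hdomi : Integrable (fun x => 2 ^ (r - 1) * (κ ^ r + (2 * D) ^ r * (N x : ℝ) ^ r)) π :=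
    ((integrable_const _).add (hNi.const_mul _)).const_mul _
  have hWi : Integrable (fun x => W x ^ r) π :=
    hdomi.mono' Measurable.of_discrete.aestronglyMeasurable (ae_of_all _ fun x => by
      rw [Real.norm_of_nonneg (pow_nonneg (hW0 x) r)]; exact hdom x)
  refine ⟨hWi, (integral_mono hWi hdomi hdom).trans ?_⟩
  rw [integral_const_mul, integral_add (integrable_const _) (hNi.const_mul _),
    integral_const_mul]
  simp only [integral_const, probReal_univ, one_smul]
  have h2 : (2 : ℝ) ^ (r - 1) ≤ 2 ^ r := pow_le_pow_right₀ (by norm_num) (by omega)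
  calc (2 : ℝ) ^ (r - 1) * (κ ^ r + (2 * D) ^ r * ∫ x, (N x : ℝ) ^ r ∂π)
      ≤ 2 ^ r * (κ ^ r + (2 * D) ^ r * (r.factorial * ((D + η) / η) ^ r)) := by gcongr
    _ = _ := by
        have e : (4 * D * ((D + η) / η)) ^ r = 2 ^ r * (2 * D) ^ r * ((D + η) / η) ^ r := by
          rw [← mul_pow, ← mul_pow]; congr 1; ring
        rw [e, mul_pow]; ring

/-! ### State space collapse -/

/-- The factor 2^(1/r) in M_r is there because u^r + v^r ≤ 2 max(u, v)^r. -/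
lemma collapseConst_pow {n r : ℕ} (hr : 1 ≤ r) (lam σ : Matrix (Fin n) (Fin n) ℝ) {νmin amax : ℝ}
    (hν : 0 < νmin) (ha : 0 ≤ amax) :
    (8 * (vnorm lam ^ 2 + vnorm σ ^ 2 + n) / νmin) ^ r + √(r : ℝ) * Real.exp 1 *
      (16 * (r / Real.exp 1) * (n * amax / νmin) * (n * amax + 1)) ^ r ≤
      collapseConst lam σ νmin amax r ^ r := by
  have hr0 : r ≠ 0 := by omega
  have hpow : ∀ t : ℝ, 0 ≤ t → (t ^ (1 / (r : ℝ))) ^ r = t := fun t ht => by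
    rw [one_div]; exact Real.rpow_inv_natCast_pow ht hr0
  set u := 8 * (vnorm lam ^ 2 + vnorm σ ^ 2 + n) / νmin with hu
  set v := (√(r : ℝ) * Real.exp 1) ^ (1 / (r : ℝ)) * 16 * (r / Real.exp 1) * (n * amax / νmin)
        * (n * amax + 1) with hv
  have hu0 : 0 ≤ u := by positivity
  have hv0 : 0 ≤ v := by positivity
  have hvr : v ^ r = √(r : ℝ) * Real.exp 1 *
      (16 * (r / Real.exp 1) * (n * amax / νmin) * (n * amax + 1)) ^ r := by
    have : v = (√(r : ℝ) * Real.exp 1) ^ (1 / (r : ℝ)) *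
      (16 * (r / Real.exp 1) * (n * amax / νmin) * (n * amax + 1)) := by rw [hv]; ring
    rw [this, mul_pow, hpow _ (by positivity)]
  have hc : collapseConst lam σ νmin amax r = 2 ^ (1 / (r : ℝ)) * max u v := rfl
  rw [← hvr, hc, mul_pow _ (max u v), hpow _ (by norm_num)]
  have h1 : u ^ r ≤ max u v ^ r := pow_le_pow_left₀ hu0 (le_max_left _ _) r
  have h2 : v ^ r ≤ max u v ^ r := pow_le_pow_left₀ hv0 (le_max_right _ _) r
  linarith

lemma collapseConst_pos {n r : ℕ} (hn : 0 < n) (hr : 1 ≤ r) (lam σ : Matrix (Fin n) (Fin n) ℝ)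
    {νmin amax : ℝ} (hν : 0 < νmin) : 0 < collapseConst lam σ νmin amax r := by
  have : (0 : ℝ) < r := by exact_mod_cast hr
  exact mul_pos (by positivity) (lt_max_of_lt_left (by positivity))

lemma minEntry_le_one (hn : 0 < n) {ν : Matrix (Fin n) (Fin n) ℝ}
    (hν : ν ∈ doublyStochastic ℝ (Fin n)) : minEntry ν ≤ 1 := by
  have hν' := mem_doublyStochastic_iff_sum.1 hν
  have h1 := minEntry_le ν ⟨0, hn⟩ ⟨0, hn⟩
  have h2 : ν ⟨0, hn⟩ ⟨0, hn⟩ ≤ ∑ j, ν ⟨0, hn⟩ j :=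
    Finset.single_le_sum (fun j _ => hν'.1 ⟨0, hn⟩ j) (Finset.mem_univ _)
  rw [hν'.2.1] at h2
  linarith

/-- State space collapse: the moments of the distance to the cone are bounded in heavy traffic. -/
theorem integrable_and_integral_coneDist_pow_le [IsProbabilityMeasure π] (hn : 0 < n)
    {ν : Matrix (Fin n) (Fin n) ℝ} {ε : ℝ}
    (h : IsArrivalLaw α amax ((1 - ε) • ν) σ) (hν : ν ∈ doublyStochastic ℝ (Fin n))
    (hmin : 0 < minEntry ν) (hε : 0 < ε) (hε' : ε * vnorm ν ≤ minEntry ν / 2)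
    (hπ : IsStationaryLaw α π) (hint : Integrable (fun x => ‖vec x‖) π) {r : ℕ} (hr : 1 ≤ r) :
    Integrable (fun x => coneDist x ^ r) π ∧
    ∫ x, coneDist x ^ r ∂π ≤ collapseConst ((1 - ε) • ν) σ (minEntry ν) amax r ^ r := by
  have ha := h.one_le
  have hD : 0 < n * amax := by positivity
  have hW : Integrable coneDist π :=
    hint.mono' Measurable.of_discrete.aestronglyMeasurable (ae_of_all _ fun x => by
      rw [Real.norm_of_nonneg (coneDist_nonneg x)]; exact coneDist_le_norm x)
  -- One half is lost to the load reduction, the other in passing from the squared distance to the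
  -- distance.
  have hη : 0 < minEntry ν / 2 / 2 := by positivity
  set A := vnorm ((1 - ε) • ν) ^ 2 + vnorm σ ^ 2 + n with hA
  have hA0 : 0 < A := by positivity
  obtain ⟨h1, h2⟩ := h.integrable_pow_and_integral_pow_le hπ coneDist_nonneg hW
    (κ := A / (minEntry ν / 2)) (by positivity) hη hD
    (fun x hx => h.avg_le_sub_of_avg_sq_le hA0 (by positivity)
      (h.avg_coneDist_sq_le hn hν hmin hε hε' x) hx)
    (fun x s hs b hb => (abs_coneDist_sub_le _ _).trans (norm_next_sub_le hs.1 ha hb)) hr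
  refine ⟨h1, h2.trans (le_trans ?_ (collapseConst_pow hr _ _ hmin (by linarith)))⟩
  have hm1 := minEntry_le_one hn hν
  refine add_le_add (pow_le_pow_left₀ (by positivity) ?_ r) ?_
  · have e : 2 * (A / (minEntry ν / 2)) = 4 * A / minEntry ν := by field_simp; ring
    rw [e]
    exact div_le_div_of_nonneg_right (by linarith) hmin.le
  · have e : √(r : ℝ) * Real.exp 1 *
      (16 * (r / Real.exp 1) * (n * amax / minEntry ν) * (n * amax + 1)) ^ r =
      (√(r : ℝ) * Real.exp 1 * (r / Real.exp 1) ^ r) *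
        (16 * (n * amax / minEntry ν) * (n * amax + 1)) ^ r := by
      rw [mul_assoc (√(r : ℝ) * Real.exp 1), ← mul_pow]; congr 2; ring
    rw [e]
    refine mul_le_mul (factorial_le_stirling hr) (pow_le_pow_left₀ (by positivity) ?_ r)
      (by positivity) (by positivity)
    -- The origin of the 16 in M_r; the factor n * amax + 1 follows as the smallest entry of ν is at
    -- most 1.
    have e2 : 4 * (n * amax) * ((n * amax + minEntry ν / 2 / 2) / (minEntry ν / 2 / 2)) =
        16 * (n * amax / minEntry ν) * (n * amax + minEntry ν / 2 / 2) := by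
      field_simp; ring
    rw [e2]
    gcongr
    linarith

end IsArrivalLaw

end MaxWeightSwitch

namespace MaxWeightSwitch

variable {n : ℕ}

/-! ### The additive part of the queue lengths -/

lemma totalQueue_vec (x : NatArray n) : totalQueue x = ∑ i, ∑ j, vec x (i, j) := rfl

lemma inner_addProj_of_sums_eq_one (hn : 0 < n) (x : ArrayVec n) {w : ArrayVec n}
    (hr : ∀ i, ∑ j, w (i, j) = 1) (hc : ∀ j, ∑ i, w (i, j) = 1) :
    inner ℝ (addProj x) (addProj w) = (∑ i, ∑ j, x (i, j)) / n := by
  rw [inner_addProj hn]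
  simp only [hr, hc, mul_one, Finset.sum_const, Finset.card_univ, Fintype.card_fin,
    nsmul_eq_mul]
  rw [Finset.sum_comm (f := fun j i => x (i, j))]
  field_simp; ring

lemma addProj_sub (x y : ArrayVec n) : addProj (x - y) = addProj x - addProj y := map_sub _ _ _

lemma addProj_add (x y : ArrayVec n) : addProj (x + y) = addProj x + addProj y := map_add _ _ _

/-- The unused service is paired with the next state, where it is orthogonal to the queue lengths;
the price is the minus sign of the last term. -/
lemma norm_sq_addProj_next (x s b : NatArray n) :
    ‖addProj (vec (next x s b))‖ ^ 2 = ‖addProj (vec x)‖ ^ 2 +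
      2 * inner ℝ (addProj (vec x)) (addProj (vec b - vec s)) + ‖addProj (vec b - vec s)‖ ^ 2 +
      2 * inner ℝ (addProj (vec (next x s b))) (addProj (vec (unused x s b))) -
      ‖addProj (vec (unused x s b))‖ ^ 2 := by
  have e : addProj (vec (next x s b)) =
      (addProj (vec x) + addProj (vec b - vec s)) + addProj (vec (unused x s b)) := by
    rw [← addProj_add, ← addProj_add, vec_next]; congr 1; abel
  rw [e, inner_add_left (addProj (vec x) + addProj (vec b - vec s)),
    real_inner_self_eq_norm_sq, norm_add_sq_real (addProj (vec x) + addProj (vec b - vec s)),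
    norm_add_sq_real (addProj (vec x))]
  ring

/-- Conservation of packets expresses the unused service through the states and the arrivals, so
that stationarity determines its mean nε. -/
lemma totalQueue_unused {x s : NatArray n} (hs : IsMaximal s) (b : NatArray n) :
    totalQueue (unused x s b) = totalQueue (next x s b) - totalQueue x - totalQueue b + n := by
  have h1 : ∀ i j, (unused x s b i j : ℝ) = next x s b i j - x i j - b i j + s i j := fun i j => by
    have := congrArg (fun v : ArrayVec n => v (i, j)) (vec_next x s b)
    simp only [PiLp.add_apply, PiLp.sub_apply, vec_apply] at this
    linarith
  have h2 : ∀ i, ∑ j, (s i j : ℝ) = 1 := fun i => by exact_mod_cast hs.2.1 i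
  simp only [totalQueue, h1, Finset.sum_add_distrib, Finset.sum_sub_distrib, h2]
  simp

/-- Young's inequality, in the form that integrates to Hölder's inequality. -/
lemma mul_le_young {r : ℕ} (hr : 2 ≤ r) {M a Z U : ℝ} (hM : 0 < M) (ha : 0 < a) (hZ : 0 ≤ Z)
    {N : ℕ} (hU : 0 ≤ U) (hUN : U ^ 2 = N) :
    Z * U ≤ M * a ^ (1 - 1 / (r : ℝ)) * (1 / r) / M ^ r * Z ^ r +
      M * a ^ (1 - 1 / (r : ℝ)) * (1 - 1 / r) / a * N := by
  have hr0 : (0 : ℝ) < r := by positivity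
  have hr2 : (2 : ℝ) ≤ r := by exact_mod_cast hr
  have hr1 : (1 : ℝ) < r := by linarith
  set β := a ^ (1 - 1 / (r : ℝ)) with hβ
  have hβ0 : 0 < β := by positivity
  have hinv : 0 < 1 - 1 / (r : ℝ) := by
    have : 1 / (r : ℝ) < 1 := by rw [div_lt_one hr0]; exact hr1
    linarith
  set q : ℝ := (1 - 1 / (r : ℝ))⁻¹ with hq
  have hconj : (r : ℝ).HolderConjugate q := by
    rw [Real.holderConjugate_iff]
    refine ⟨hr1, ?_⟩
    rw [hq, inv_inv, one_div]; ring
  -- For E Z^r ≤ M^r and E U² = a the two terms integrate to at most M a^(1-1/r) in total.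
  have hY := Real.young_inequality_of_nonneg (a := Z / M) (b := U / β) (by positivity)
    (by positivity) hconj
  have hq2 : q ≤ 2 := by
    rw [hq, inv_le_comm₀ hinv (by norm_num)]
    have : 1 / (r : ℝ) ≤ 1 / 2 := by gcongr
    linarith
  have hq0 : 0 < q := by positivity
  -- The square of U is a natural number, so U is 0 or at least 1, and q ≤ 2.
  have hUq : U ^ q ≤ N := by
    rw [← hUN]
    rcases Nat.eq_zero_or_pos N with h0 | h0
    · have : U = 0 := by
        rw [h0] at hUN; simpa using hUN
      rw [this, Real.zero_rpow hq0.ne']; simp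
    · have hU1 : 1 ≤ U := by
        have : (1 : ℝ) ≤ U ^ 2 := by rw [hUN]; exact_mod_cast h0
        nlinarith
      calc U ^ q ≤ U ^ (2 : ℝ) := Real.rpow_le_rpow_of_exponent_le hU1 hq2
        _ = U ^ 2 := by norm_cast
  have hβq : β ^ q = a := by
    rw [hβ, ← Real.rpow_mul ha.le, hq, mul_inv_cancel₀ hinv.ne', Real.rpow_one]
  rw [Real.rpow_natCast, Real.div_rpow hU hβ0.le, hβq, div_pow] at hY
  have h1 : Z * U = M * β * (Z / M * (U / β)) := by field_simp
  rw [h1]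
  have h2 : M * β * (Z / M * (U / β)) ≤ M * β * (Z ^ r / M ^ r / r + N / a / q) := by
    refine mul_le_mul_of_nonneg_left (hY.trans ?_) (by positivity)
    gcongr
  refine h2.trans (le_of_eq ?_)
  have hq' : (1 - 1 / (r : ℝ)) = 1 / q := by rw [hq, one_div, one_div, inv_inv]
  rw [hq']
  field_simp

/-! ### Zero drift of the squared norm of the additive part -/

namespace IsArrivalLaw

variable {α π : Measure (NatArray n)} {amax : ℝ} {σ ν : Matrix (Fin n) (Fin n) ℝ} {ε : ℝ}

/-- Rows and columns each contribute ‖σ‖²/n + ε², and the total removes ‖σ‖²/n² + ε². -/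
lemma integral_norm_sq_addProj (hn : 0 < n) (h : IsArrivalLaw α amax ((1 - ε) • ν) σ)
    (hν : ν ∈ doublyStochastic ℝ (Fin n)) {s : NatArray n} (hs : IsMaximal s) :
    ∫ b, ‖addProj (vec b - vec s)‖ ^ 2 ∂α = (2 / n - 1 / n ^ 2) * vnorm σ ^ 2 + ε ^ 2 := by
  have hν' := mem_doublyStochastic_iff_sum.1 hν
  have hr : ∀ i, ∑ j, (s i j : ℝ) = 1 := fun i => by exact_mod_cast hs.2.1 i
  have hc : ∀ j, ∑ i, (s i j : ℝ) = 1 := fun j => by exact_mod_cast hs.2.2 j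
  have hform : ∀ b : NatArray n, ‖addProj (vec b - vec s)‖ ^ 2 =
      (∑ i, (∑ j, (b i j : ℝ) - 1) ^ 2) / n + (∑ j, (∑ i, (b i j : ℝ) - 1) ^ 2) / n -
        (∑ i, ∑ j, (b i j : ℝ) - n) ^ 2 / n ^ 2 := by
    intro b
    rw [← real_inner_self_eq_norm_sq, inner_addProj hn]
    simp only [PiLp.sub_apply, vec_apply, Finset.sum_sub_distrib, hr, hc, ← sq]
    simp
  have hrow : ∀ i, ∫ b, (∑ j, (b i j : ℝ) - 1) ^ 2 ∂α = ∑ j, σ i j ^ 2 + ε ^ 2 := by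
    intro i
    have := h.integral_sq ({i} ×ˢ Finset.univ) 1
    simp only [Finset.sum_product, Finset.sum_singleton, Matrix.smul_apply, smul_eq_mul,
      ← Finset.mul_sum, hν'.2.1] at this
    rw [this]; ring
  have hcol : ∀ j, ∫ b, (∑ i, (b i j : ℝ) - 1) ^ 2 ∂α = ∑ i, σ i j ^ 2 + ε ^ 2 := by
    intro j
    have := h.integral_sq (Finset.univ ×ˢ {j}) 1
    simp only [Finset.sum_product, Finset.sum_singleton, Matrix.smul_apply, smul_eq_mul,
      ← Finset.mul_sum, hν'.2.2] at this
    rw [this]; ring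
  have htot : ∫ b, (∑ i, ∑ j, (b i j : ℝ) - n) ^ 2 ∂α = vnorm σ ^ 2 + (n * ε) ^ 2 := by
    have := h.integral_sq (Finset.univ ×ˢ Finset.univ) n
    simp only [Finset.sum_product, Matrix.smul_apply, smul_eq_mul,
      ← Finset.mul_sum, hν'.2.1] at this
    rw [this, vnorm_sq]; simp; ring
  simp only [hform]
  rw [integral_sub (h.integrable _) (h.integrable _), integral_add (h.integrable _)
    (h.integrable _), integral_div, integral_div, integral_div,
    integral_finsetSum _ fun i _ => h.integrable _,
    integral_finsetSum _ fun i _ => h.integrable _, htot]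
  simp only [hrow, hcol, Finset.sum_add_distrib]
  rw [Finset.sum_comm (f := fun j i => σ i j ^ 2), ← vnorm_sq]
  simp only [Finset.sum_const, Finset.card_univ, Fintype.card_fin, nsmul_eq_mul]
  field_simp; ring

lemma integral_addProj (hn : 0 < n) (h : IsArrivalLaw α amax ((1 - ε) • ν) σ)
    (hν : ν ∈ doublyStochastic ℝ (Fin n)) (x : NatArray n) {s : NatArray n} (hs : IsMaximal s) :
    ∫ b, inner ℝ (addProj (vec x)) (addProj (vec b - vec s)) ∂α = - (ε / n) * totalQueue x := by
  have := h.isProbabilityMeasure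
  have hν' := mem_doublyStochastic_iff_sum.1 hν
  have e : ∀ b : NatArray n, inner ℝ (addProj (vec x)) (addProj (vec b - vec s)) =
      inner ℝ (addProj (vec x)) (vec b) - totalQueue x / n := fun b => by
    rw [addProj_sub, inner_sub_right, inner_addProj_vec_schedule hn _ hs, ← totalQueue_vec]
    congr 1
    unfold addProj
    rw [← Submodule.inner_starProjection_left_eq_right,
      Submodule.starProjection_eq_self_iff.2 (Submodule.starProjection_apply_mem _ _)]
  simp only [e]
  rw [integral_sub (h.integrable _) (h.integrable _), h.integral_inner]
  have e2 : inner ℝ (addProj (vec x)) (matVec ((1 - ε) • ν)) = (1 - ε) * (totalQueue x / n) := by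
    have : matVec ((1 - ε) • ν) = (1 - ε) • matVec ν := by ext p; simp
    rw [this, inner_smul_right, totalQueue_vec,
      ← inner_addProj_of_sums_eq_one hn (vec x) (w := matVec ν) hν'.2.1 hν'.2.2]
    congr 1
    unfold addProj
    rw [← Submodule.inner_starProjection_left_eq_right,
      Submodule.starProjection_eq_self_iff.2 (Submodule.starProjection_apply_mem _ _)]
  rw [e2]
  simp; ring

lemma integral_totalQueue (h : IsArrivalLaw α amax ((1 - ε) • ν) σ)
    (hν : ν ∈ doublyStochastic ℝ (Fin n)) : ∫ b, totalQueue b ∂α = (1 - ε) * n := by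
  have hν' := mem_doublyStochastic_iff_sum.1 hν
  simp only [totalQueue]
  rw [integral_finsetSum _ fun i _ => h.integrable _]
  have : ∀ i, ∫ b, ∑ j, (b i j : ℝ) ∂α = 1 - ε := fun i => by
    rw [integral_finsetSum _ fun i _ => h.integrable _]
    simp only [h.integral_eq, Matrix.smul_apply, smul_eq_mul, ← Finset.mul_sum, hν'.2.1, mul_one]
  simp [this]; ring

/-- The expected total queue length when the correlation between the collapse and the unused
service is controlled by constants `p₁` and `p₂`. -/
lemma abs_integral_totalQueue_sub_le [IsProbabilityMeasure π] (hn : 0 < n)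
    (h : IsArrivalLaw α amax ((1 - ε) • ν) σ) (hν : ν ∈ doublyStochastic ℝ (Fin n))
    (hπ : IsStationaryLaw α π) {r : ℕ} (hF : Integrable (fun x => ‖addProj (vec x)‖ ^ 2) π)
    (hT : Integrable totalQueue π) (hZ : Integrable (fun x => coneDist x ^ r) π) {p₁ p₂ : ℝ}
    (hY : ∀ x s b : NatArray n, IsMaximal s →
      coneDist (next x s b) * ‖vec (unused x s b)‖ ≤
      p₁ * coneDist (next x s b) ^ r + p₂ * totalQueue (unused x s b)) :
    2 * ε / n * ∫ x, totalQueue x ∂π ≤ (2 / n - 1 / n ^ 2) * vnorm σ ^ 2 + ε ^ 2 +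
      2 * (p₁ * ∫ x, coneDist x ^ r ∂π + p₂ * (n * ε)) ∧
    (2 / n - 1 / n ^ 2) * vnorm σ ^ 2 + ε ^ 2 -
      2 * (p₁ * ∫ x, coneDist x ^ r ∂π + p₂ * (n * ε)) - 2 * ε ≤
      2 * ε / n * ∫ x, totalQueue x ∂π := by
  have := h.isProbabilityMeasure
  set c₀ := (2 / n - 1 / n ^ 2) * vnorm σ ^ 2 + ε ^ 2 with hc₀
  set F : NatArray n → ℝ := fun x => ‖addProj (vec x)‖ ^ 2 with hFdef
  set Z : NatArray n → ℝ := fun x => coneDist x ^ r with hZdef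
  have hlin : ∀ (x s : NatArray n), IsMaximal s → ∀ d : ℝ,
      ∫ b, (F x + 2 * inner ℝ (addProj (vec x)) (addProj (vec b - vec s)) +
        ‖addProj (vec b - vec s)‖ ^ 2 + d * (n - totalQueue x - totalQueue b)) ∂α =
      F x - 2 * (ε / n) * totalQueue x + c₀ + d * (n * ε - totalQueue x) := by
    intro x s hs d
    rw [integral_add (h.integrable _) (h.integrable _), integral_add (h.integrable _)
      (h.integrable _), integral_add (h.integrable _) (h.integrable _), integral_const_mul,
      integral_const_mul, integral_sub (h.integrable _) (h.integrable _),
      h.integral_addProj hn hν x hs, h.integral_norm_sq_addProj hn hν hs,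
      h.integral_totalQueue hν]
    simp; ring
  have hcomb : ∀ d₁ d₂ d₃ : ℝ, Integrable (fun x => F x + d₁ * Z x + d₂ * totalQueue x + d₃) π ∧
      ∫ x, (F x + d₁ * Z x + d₂ * totalQueue x + d₃) ∂π =
        ∫ x, F x ∂π + d₁ * ∫ x, Z x ∂π + d₂ * ∫ x, totalQueue x ∂π + d₃ := fun d₁ d₂ d₃ => by
    have i1 := hZ.const_mul d₁
    have i2 := hT.const_mul d₂
    have i3 : Integrable (fun x => F x + d₁ * Z x) π := hF.add i1
    have i4 : Integrable (fun x => F x + d₁ * Z x + d₂ * totalQueue x) π := i3.add i2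
    refine ⟨i4.add (integrable_const d₃), ?_⟩
    rw [integral_add i4 (integrable_const d₃), integral_add i3 i2, integral_add hF i1,
      integral_const_mul, integral_const_mul]
    simp
  constructor
  -- The correlation term lives at the next state, so its bound from `hY` is built into the test
  -- function; stationarity then settles it without a joint law of consecutive states.
  · set g : NatArray n → ℝ := fun x => F x + (-(2 * p₁)) * Z x +
      (-(2 * p₂)) * totalQueue x + 0 with hg
    obtain ⟨hgi, hgint⟩ := hcomb (-(2 * p₁)) (-(2 * p₂)) 0
    obtain ⟨h1, h2⟩ := h.integrable_avg_and_integral_avg hπ hgi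
    have hpt : ∀ x, h.avg g x ≤
        F x + 0 * Z x + (-(2 * (ε / n) + 2 * p₂)) * totalQueue x + (c₀ + 2 * p₂ * (n * ε)) := by
      intro x
      refine h.avg_le fun s hs => ?_
      have e : F x + 0 * Z x + (-(2 * (ε / n) + 2 * p₂)) * totalQueue x + (c₀ + 2 * p₂ * (n * ε)) =
        F x - 2 * (ε / n) * totalQueue x + c₀ + 2 * p₂ * (n * ε - totalQueue x) := by ring
      rw [e, ← hlin x s hs.1]
      refine integral_mono (h.integrable _) (h.integrable _) fun b => ?_
      have e1 := norm_sq_addProj_next x s b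
      have e2 := (abs_le.1 (abs_inner_addProj_unused_le x s b)).2
      have e3 := hY x s b hs.1
      have e4 := totalQueue_unused hs.1 (x := x) b
      have e5 := sq_nonneg ‖addProj (vec (unused x s b))‖
      rw [e4] at e3
      simp only [hg, hFdef, hZdef]
      linarith
    obtain ⟨hri, hrint⟩ := hcomb 0 (-(2 * (ε / n) + 2 * p₂)) (c₀ + 2 * p₂ * (n * ε))
    have h3 := integral_mono h1 hri hpt
    rw [h2, hgint, hrint] at h3
    have e : 2 * ε / n = 2 * (ε / n) := by ring
    rw [e]
    linarith
  -- The extra 2/n pays for the negative term -‖Pu‖², at the cost of 2ε.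
  · set g : NatArray n → ℝ := fun x => F x + 2 * p₁ * Z x + (2 * p₂ + 2 / n) * totalQueue x + 0
      with hg
    obtain ⟨hgi, hgint⟩ := hcomb (2 * p₁) (2 * p₂ + 2 / n) 0
    obtain ⟨h1, h2⟩ := h.integrable_avg_and_integral_avg hπ hgi
    have hpt : ∀ x, F x + 0 * Z x + (-(2 * (ε / n)) + (2 * p₂ + 2 / n)) * totalQueue x +
        (c₀ - (2 * p₂ + 2 / n) * (n * ε)) ≤ h.avg g x := by
      intro x
      refine h.le_avg fun s hs => ?_
      have e : F x + 0 * Z x + (-(2 * (ε / n)) + (2 * p₂ + 2 / n)) * totalQueue x +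
          (c₀ - (2 * p₂ + 2 / n) * (n * ε)) = F x - 2 * (ε / n) * totalQueue x + c₀ +
          (-(2 * p₂ + 2 / n)) * (n * ε - totalQueue x) := by ring
      rw [e, ← hlin x s hs.1]
      refine integral_mono (h.integrable _) (h.integrable _) fun b => ?_
      have e1 := norm_sq_addProj_next x s b
      have e2 := (abs_le.1 (abs_inner_addProj_unused_le x s b)).1
      have e3 := hY x s b hs.1
      have e4 := totalQueue_unused hs.1 (x := x) b
      have e5 := norm_sq_addProj_unused_le hn hs.1 (x := x) b
      rw [e4] at e3 e5
      simp only [hg, hFdef, hZdef]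
      linarith
    obtain ⟨hri, hrint⟩ := hcomb 0 (-(2 * (ε / n)) + (2 * p₂ + 2 / n))
      (c₀ - (2 * p₂ + 2 / n) * (n * ε))
    have h3 := integral_mono hri h1 hpt
    rw [h2, hgint, hrint] at h3
    have e : 2 * ε / n = 2 * (ε / n) := by ring
    have e6 : (2 / (n : ℝ)) * (n * ε) = 2 * ε := by field_simp
    rw [e]
    linarith

/-- The bounds on the expected total queue length of the stationary switch. -/
theorem integral_totalQueue_bounds [IsProbabilityMeasure π] (hn : 0 < n)
    (h : IsArrivalLaw α amax ((1 - ε) • ν) σ) (hν : ν ∈ doublyStochastic ℝ (Fin n))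
    (hmin : 0 < minEntry ν) (hε : 0 < ε) (hε' : ε * vnorm ν ≤ minEntry ν / 2)
    (hπ : IsStationaryLaw α π) (hint : Integrable (fun x => ‖vec x‖) π)
    (hint2 : Integrable (fun x => ‖vec x‖ ^ 2) π) {r : ℕ} (hr : 2 ≤ r) :
    (1 - 1 / (2 * (n : ℝ))) * (vnorm σ ^ 2 / ε)
        - lowerError n r ε (collapseConst ((1 - ε) • ν) σ (minEntry ν) amax r)
      ≤ ∫ x, totalQueue x ∂π ∧
    ∫ x, totalQueue x ∂π ≤ (1 - 1 / (2 * (n : ℝ))) * (vnorm σ ^ 2 / ε)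
        + upperError n r ε (collapseConst ((1 - ε) • ν) σ (minEntry ν) amax r) := by
  have ha := h.one_le
  set M := collapseConst ((1 - ε) • ν) σ (minEntry ν) amax r with hM
  have hM0 : 0 < M := collapseConst_pos hn (by omega) _ _ hmin
  obtain ⟨hZi, hZ⟩ := h.integrable_and_integral_coneDist_pow_le hn hν hmin hε hε' hπ hint
    (r := r) (by omega)
  have hT : Integrable totalQueue π :=
    (hint.const_mul ((n : ℝ) ^ 2)).mono' Measurable.of_discrete.aestronglyMeasurable
      (ae_of_all _ fun x => by
        rw [Real.norm_of_nonneg (totalQueue_nonneg x)]; exact totalQueue_le x)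
  have hF : Integrable (fun x => ‖addProj (vec x)‖ ^ 2) π :=
    hint2.mono' Measurable.of_discrete.aestronglyMeasurable (ae_of_all _ fun x => by
      rw [Real.norm_of_nonneg (by positivity)]
      exact pow_le_pow_left₀ (norm_nonneg _) (norm_addProj_le _) 2)
  have hnε : 0 < n * ε := by positivity
  set β := (n * ε) ^ (1 - 1 / (r : ℝ)) with hβ
  have hβ0 : 0 < β := by positivity
  have hr0 : (0 : ℝ) < r := by positivity
  obtain ⟨hu, hl⟩ := h.abs_integral_totalQueue_sub_le hn hν hπ hF hT hZi
    (p₁ := M * β * (1 / r) / M ^ r) (p₂ := M * β * (1 - 1 / r) / (n * ε)) (fun x s b hs => by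
      have h1 : ‖vec (unused x s b)‖ ^ 2 = ((∑ i, ∑ j, unused x s b i j : ℕ) : ℝ) := by
        rw [norm_sq_unused hs]; simp [totalQueue]
      have := mul_le_young hr hM0 hnε (coneDist_nonneg (next x s b)) (norm_nonneg _) h1
      rwa [← h1, norm_sq_unused hs] at this)
  -- The weights 1/r and 1 - 1/r of Young's inequality recombine to Hölder's bound.
  have hp : M * β * (1 / r) / M ^ r * ∫ x, coneDist x ^ r ∂π +
      M * β * (1 - 1 / r) / (n * ε) * (n * ε) ≤ M * β := by
    have e1 : M * β * (1 / r) / M ^ r * ∫ x, coneDist x ^ r ∂π ≤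
        M * β * (1 / r) / M ^ r * M ^ r := by gcongr
    have e2 : M * β * (1 / r) / M ^ r * M ^ r = M * β * (1 / r) := by field_simp
    have e3 : M * β * (1 - 1 / r) / (n * ε) * (n * ε) = M * β * (1 - 1 / r) := by field_simp
    rw [e3]
    rw [e2] at e1
    linarith
  have hpow : (n : ℝ) ^ (2 - 1 / (r : ℝ)) * ε ^ (-(1 / (r : ℝ))) * M = n / ε * (M * β) := by
    have hn' : (0 : ℝ) < n := by exact_mod_cast hn
    have e1 : (n : ℝ) ^ (2 - 1 / (r : ℝ)) = n * (n : ℝ) ^ (1 - 1 / (r : ℝ)) := by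
      rw [show (2 - 1 / (r : ℝ)) = 1 + (1 - 1 / (r : ℝ)) by ring, Real.rpow_add hn',
        Real.rpow_one]
    have e2 : ε ^ (-(1 / (r : ℝ))) = ε ^ (1 - 1 / (r : ℝ)) / ε := by
      rw [show (1 - 1 / (r : ℝ)) = -(1 / (r : ℝ)) + 1 by ring, Real.rpow_add hε, Real.rpow_one]
      field_simp
    rw [e1, e2, hβ, Real.mul_rpow hn'.le hε.le]
    ring
  have hX0 : 0 ≤ n / ε * (M * β) := by positivity
  set E := ∫ x, totalQueue x ∂π with hE
  -- After this rescaling the collapse error n/ε * (M * β) appears once; the coefficients 2 and 3 in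
  -- the error terms leave room.
  have hscale : n / (2 * ε) * (2 * ε / n * E) = E := by field_simp
  have hmain : n / (2 * ε) * ((2 / n - 1 / n ^ 2) * vnorm σ ^ 2 + ε ^ 2) =
      (1 - 1 / (2 * (n : ℝ))) * (vnorm σ ^ 2 / ε) + n * ε / 2 := by
    field_simp
  have hcoef : 0 ≤ n / (2 * ε) := by positivity
  have hX : n / (2 * ε) * (2 * (M * β)) = n / ε * (M * β) := by field_simp
  have hone : n / (2 * ε) * (2 * ε) = n := by field_simp
  constructor
  · have h1 := mul_le_mul_of_nonneg_left hl hcoef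
    rw [hscale] at h1
    have h3 : lowerError n r ε M = -(n * ε / 2) + n + 3 * (n / ε * (M * β)) := by
      rw [lowerError, ← hpow]; ring
    rw [h3]
    have h4 := mul_le_mul_of_nonneg_left hp hcoef
    linarith
  · have h1 := mul_le_mul_of_nonneg_left hu hcoef
    rw [hscale] at h1
    have h3 : upperError n r ε M = n * (1 + ε) / 2 + 2 * (n / ε * (M * β)) := by
      rw [upperError, ← hpow]; ring
    rw [h3]
    have h4 := mul_le_mul_of_nonneg_left hp hcoef
    have h5 : (0 : ℝ) ≤ n := by positivity
    linarith

end IsArrivalLaw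

end MaxWeightSwitch

namespace MaxWeightSwitch

variable {n : ℕ}

namespace IsArrivalLaw

variable {α π : Measure (NatArray n)} {amax : ℝ} {lam σ ν : Matrix (Fin n) (Fin n) ℝ} {ε : ℝ}

/-! ### Convergence to the stationary law -/

lemma abs_pow_avg_le (h : IsArrivalLaw α amax lam σ) {f : NatArray n → ℝ} {C : ℝ}
    (hC : ∀ x, |f x| ≤ C) (k : ℕ) (x : NatArray n) : |(h.avg ^ k) f x| ≤ C := by
  have hp := Averaging.pow_nonneg (fun f => h.avg_nonneg (f := f)) k
  have := Averaging.abs_map_le hp (g := fun _ => C) hC x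
  rwa [Averaging.map_const (Averaging.pow_one h.avg_one k)] at this

/-- The stationary law of the switch, which attracts all bounded functions. -/
lemma exists_stationary (hn : 0 < n) (h : IsArrivalLaw α amax ((1 - ε) • ν) σ)
    (hν : ν ∈ doublyStochastic ℝ (Fin n)) (hmin : 0 < minEntry ν) (hε : 0 < ε) :
    ∃ π : ProbabilityMeasure (NatArray n), IsStationaryLaw α (π : Measure (NatArray n)) ∧
      (∀ f : NatArray n → ℝ, (∃ C, ∀ x, |f x| ≤ C) → ∀ x,
        Tendsto (fun k => (h.avg ^ k) f x) atTop (𝓝 (∫ y, f y ∂(π : Measure (NatArray n))))) ∧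
      ∀ k : ℕ, Integrable (fun x => ‖vec x‖ ^ k) (π : Measure (NatArray n)) := by
  obtain ⟨θ, hθ, hH⟩ := h.exists_isHarris hn hν hmin hε
  obtain ⟨π, hπ, hV, hlim⟩ := hH.exists_invariant
  refine ⟨⟨π, hπ⟩, ?_, hlim, fun k => ?_⟩
  · refine h.isStationaryLaw_of_integral_avg (π := π) fun f hf => ?_
    obtain ⟨C, hC⟩ := hf
    have h1 := hlim (h.avg f) ⟨C, fun x => by simpa using h.abs_pow_avg_le hC 1 x⟩ 0
    have h2 := (tendsto_add_atTop_iff_nat 1).2 (hlim f ⟨C, hC⟩ 0)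
    refine tendsto_nhds_unique h1 (h2.congr fun k => ?_)
    rw [pow_succ, Module.End.mul_apply]
  -- Powers are dominated by the exponential Lyapunov function.
  · refine (hV.const_mul (k.factorial / θ ^ k)).mono'
      Measurable.of_discrete.aestronglyMeasurable (ae_of_all _ fun x => ?_)
    rw [Real.norm_of_nonneg (by positivity)]
    have := Real.pow_div_factorial_le_exp (x := θ * ‖vec x‖) (by positivity) k
    rw [div_le_iff₀ (by positivity), mul_pow] at this
    rw [div_mul_eq_mul_div, le_div_iff₀ (by positivity)]
    linarith

lemma tendsto_integral_pow_avg {S : Type*} [MeasurableSpace S] {P : Measure S}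
    [IsProbabilityMeasure P] (h : IsArrivalLaw α amax lam σ) {X : S → NatArray n}
    (hX : Measurable X) {f : NatArray n → ℝ} {C L : ℝ} (hC : ∀ x, |f x| ≤ C)
    (hf : ∀ x, Tendsto (fun k => (h.avg ^ k) f x) atTop (𝓝 L)) :
    Tendsto (fun k => ∫ ω, (h.avg ^ k) f (X ω) ∂P) atTop (𝓝 L) := by
  have : L = ∫ _, L ∂P := by simp
  rw [this]
  refine tendsto_integral_of_dominated_convergence (fun _ => C)
    (fun k => (Measurable.of_discrete.comp hX).aestronglyMeasurable) (integrable_const C)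
    (fun k => ae_of_all _ fun ω => h.abs_pow_avg_le hC k _) (ae_of_all _ fun ω => hf _)

lemma integral_pow_avg [IsProbabilityMeasure π] (h : IsArrivalLaw α amax lam σ)
    (hπ : IsStationaryLaw α π) {f : NatArray n → ℝ} {C : ℝ} (hC : ∀ x, |f x| ≤ C) (k : ℕ) :
    ∫ x, (h.avg ^ k) f x ∂π = ∫ x, f x ∂π := by
  induction k with
  | zero => simp
  | succ k ih =>
    rw [pow_succ', ← ih]
    exact (h.integrable_avg_and_integral_avg hπ (Integrable.of_bound
      Measurable.of_discrete.aestronglyMeasurable C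
      (ae_of_all _ fun x => h.abs_pow_avg_le hC k x))).2

/-- Started from π', the expectations are constant in time and yet converge to those under π. -/
lemma eq_of_isStationaryLaw (h : IsArrivalLaw α amax lam σ) {π π' : ProbabilityMeasure (NatArray n)}
    (hlim : ∀ f : NatArray n → ℝ, (∃ C, ∀ x, |f x| ≤ C) → ∀ x,
      Tendsto (fun k => (h.avg ^ k) f x) atTop (𝓝 (∫ y, f y ∂(π : Measure (NatArray n)))))
    (hπ' : IsStationaryLaw α (π' : Measure (NatArray n))) : π' = π := by
  refine ProbabilityMeasure.toMeasure_injective (Measure.ext fun A hA => ?_)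
  have hb : ∀ x, |A.indicator (1 : NatArray n → ℝ) x| ≤ 1 := fun x => by
    by_cases hx : x ∈ A <;> simp [hx]
  have h1 := h.tendsto_integral_pow_avg (P := (π' : Measure (NatArray n))) measurable_id hb
    (hlim _ ⟨1, hb⟩)
  simp only [id_eq, h.integral_pow_avg hπ' hb] at h1
  have h2 := tendsto_nhds_unique tendsto_const_nhds h1
  rw [integral_indicator_one hA, integral_indicator_one hA] at h2
  exact (measureReal_eq_measureReal_iff (measure_ne_top _ _) (measure_ne_top _ _)).1 h2

/-- Both norms together are the second moment of bounded arrivals; being free of ε, the bound keeps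
M_r bounded in heavy traffic. -/
lemma vnorm_sq_add_vnorm_sq_le (h : IsArrivalLaw α amax lam σ) :
    vnorm lam ^ 2 + vnorm σ ^ 2 ≤ n ^ 2 * amax ^ 2 := by
  have := h.isProbabilityMeasure
  rw [← h.integral_norm_sq]
  calc ∫ b, ‖vec b‖ ^ 2 ∂α ≤ ∫ _, (n : ℝ) ^ 2 * amax ^ 2 ∂α := by
        refine integral_mono_ae (h.integrable _) (integrable_const _) ?_
        filter_upwards [h.ae_le] with b hb
        simp only [norm_sq_eq_sum, vec_apply]
        calc ∑ i, ∑ j, (b i j : ℝ) ^ 2 ≤ ∑ _i : Fin n, ∑ _j : Fin n, amax ^ 2 :=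
              Finset.sum_le_sum fun i _ => Finset.sum_le_sum fun j _ =>
                pow_le_pow_left₀ (by positivity) (hb i j) 2
          _ = _ := by simp; ring
    _ = _ := by simp

end IsArrivalLaw

/-! ### The queue length process -/

namespace IsMaxWeightSwitch

variable {Ω : Type*} [MeasurableSpace Ω] {P : Measure Ω} {amax : ℝ}
  {a s q : ℕ → Ω → NatArray n}

lemma iIndepFun_slot (h : IsMaxWeightSwitch P amax a s q) (t : ℕ) :
    iIndepFun (fun (p : Fin n × Fin n) ω => a t ω p.1 p.2) P :=
  h.iIndepFun_arrival.precomp (g := fun p : Fin n × Fin n => (t, p))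
    fun _ _ hp => (Prod.mk.inj hp).2

lemma queue_succ_eq (h : IsMaxWeightSwitch P amax a s q) (t : ℕ) (ω : Ω) :
    q (t + 1) ω = next (q t ω) (s t ω) (a t ω) := by
  ext i j; exact h.queue_succ t ω i j

lemma measure_arrival_eq (h : IsMaxWeightSwitch P amax a s q) (t : ℕ) (b : NatArray n) :
    P {ω | a t ω = b} = ∏ p : Fin n × Fin n, P {ω | a t ω p.1 p.2 = b p.1 p.2} := by
  have := (h.iIndepFun_slot t).measure_inter_preimage_eq_mul Finset.univ
    (sets := fun p => {b p.1 p.2}) fun p _ => measurableSet_singleton _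
  convert! this using 2
  ext ω
  simp [funext_iff]

lemma map_arrival_eq (h : IsMaxWeightSwitch P amax a s q) (t : ℕ) :
    P.map (a t) = P.map (a 0) := by
  refine Measure.ext_of_singleton fun b => ?_
  rw [Measure.map_apply (h.measurable_arrival t) (measurableSet_singleton b),
    Measure.map_apply (h.measurable_arrival 0) (measurableSet_singleton b)]
  change P {ω | a t ω = b} = P {ω | a 0 ω = b}
  rw [h.measure_arrival_eq, h.measure_arrival_eq]
  refine Finset.prod_congr rfl fun p _ => ?_
  exact (h.identDistrib_arrival t p.1 p.2).measure_mem_eq (measurableSet_singleton _)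

lemma isArrivalLaw [IsProbabilityMeasure P] (h : IsMaxWeightSwitch P amax a s q)
    (hamax : 1 ≤ amax) {lam σ : Matrix (Fin n) (Fin n) ℝ}
    (hmean : ∀ i j, ∫ ω, (a 0 ω i j : ℝ) ∂P = lam i j)
    (hvar : ∀ i j, variance (fun ω => (a 0 ω i j : ℝ)) P = σ i j ^ 2) :
    IsArrivalLaw (P.map (a 0)) amax lam σ := by
  have hm := h.measurable_arrival 0
  have hmij : ∀ i j, Measurable fun ω => (a 0 ω i j : ℝ) := fun i j =>
    (Measurable.of_discrete (f := fun b : NatArray n => (b i j : ℝ))).comp hm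
  have hL : ∀ i j, MemLp (fun ω => (a 0 ω i j : ℝ)) 2 P := fun i j => by
    refine MemLp.of_bound (hmij i j).aestronglyMeasurable amax ?_
    filter_upwards [h.arrival_le 0 i j] with ω hω
    rwa [Real.norm_of_nonneg (by positivity)]
  refine ⟨Measure.isProbabilityMeasure_map hm.aemeasurable, hamax, ?_, ?_, fun i j => ?_,
    fun F c => ?_⟩
  · rw [ae_map_iff hm.aemeasurable MeasurableSet.of_discrete]
    exact ae_all_iff.2 fun i => ae_all_iff.2 fun j => h.arrival_le 0 i j
  · rw [map_measureReal_apply hm (measurableSet_singleton _)]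
    obtain ⟨e, he, hz⟩ := h.arrival_zero
    -- By independence the probability of no arrival at all is a product of positive factors.
    have h1 := h.measure_arrival_eq 0 0
    change 0 < (P {ω | a 0 ω = 0}).toReal
    rw [h1, ENNReal.toReal_prod]
    exact Finset.prod_pos fun p _ => he.trans (hz 0 p.1 p.2)
  · rw [integral_map hm.aemeasurable Measurable.of_discrete.aestronglyMeasurable, hmean]
  · rw [integral_map hm.aemeasurable Measurable.of_discrete.aestronglyMeasurable]
    set Y : Fin n × Fin n → Ω → ℝ := fun p ω => (a 0 ω p.1 p.2 : ℝ) with hY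
    have hYL : ∀ p ∈ F, MemLp (Y p) 2 P := fun p _ => hL p.1 p.2
    have hind : Set.Pairwise (F : Set (Fin n × Fin n)) fun p p' => IndepFun (Y p) (Y p') P :=
      fun p _ p' _ hpp' => ((h.iIndepFun_slot 0).indepFun hpp').comp
        (φ := fun k : ℕ => (k : ℝ)) (ψ := fun k : ℕ => (k : ℝ)) Measurable.of_discrete
        Measurable.of_discrete
    have hv := IndepFun.variance_sum hYL hind
    have hsumL : MemLp (∑ p ∈ F, Y p) 2 P := memLp_finsetSum' F hYL
    have hE : ∫ ω, (∑ p ∈ F, Y p) ω ∂P = ∑ p ∈ F, lam p.1 p.2 := by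
      simp only [Finset.sum_apply]
      rw [integral_finsetSum F fun p hp => (hYL p hp).integrable (by norm_num)]
      exact Finset.sum_congr rfl fun p _ => hmean p.1 p.2
    have hv2 := variance_eq_sub hsumL
    rw [hv, hE] at hv2
    have hsq : Integrable (fun ω => (∑ p ∈ F, Y p) ω ^ 2) P := hsumL.integrable_sq
    have hi : Integrable (∑ p ∈ F, Y p) P := hsumL.integrable (by norm_num)
    have e : ∀ ω, (∑ p ∈ F, (a 0 ω p.1 p.2 : ℝ) - c) ^ 2 =
        (∑ p ∈ F, Y p) ω ^ 2 - 2 * c * (∑ p ∈ F, Y p) ω + c ^ 2 := fun ω => by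
      simp only [Finset.sum_apply, hY]; ring
    simp only [e]
    have hi2 : Integrable (fun ω => (∑ p ∈ F, Y p) ω ^ 2 - 2 * c * (∑ p ∈ F, Y p) ω) P :=
      hsq.sub (hi.const_mul _)
    rw [integral_add hi2 (integrable_const _), integral_sub hsq (hi.const_mul _), integral_const_mul, hE]
    simp only [integral_const, probReal_univ, one_smul]
    have hv3 : ∑ p ∈ F, σ p.1 p.2 ^ 2 =
        ∫ ω, (∑ p ∈ F, Y p) ω ^ 2 ∂P - (∑ p ∈ F, lam p.1 p.2) ^ 2 := by
      rw [← Finset.sum_congr rfl fun p _ => hvar p.1 p.2, hv2]; rfl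
    linarith

/-- The joint law of queue lengths, schedule and arrivals of a time slot. -/
lemma measure_slot (h : IsMaxWeightSwitch P amax a s q) (t : ℕ) (x σ b : NatArray n) :
    P {ω | q t ω = x ∧ s t ω = σ ∧ a t ω = b} =
      P {ω | q t ω = x} * (uniformOn (maxWeightSchedules x) {σ} * P.map (a 0) {b}) := by
  have hqm : MeasurableSet[past a s q t] {ω | q t ω = x} := by
    refine le_sup_left (a := ⨆ k ∈ Set.Iic t, MeasurableSpace.comap (q k) inferInstance)
      (b := ⨆ k ∈ Set.Iio t, (MeasurableSpace.comap (a k) inferInstance ⊔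
        MeasurableSpace.comap (s k) inferInstance)) _ ?_
    refine le_iSup₂ (f := fun k (_ : k ∈ Set.Iic t) =>
      MeasurableSpace.comap (q k) inferInstance) t (Set.mem_Iic.2 le_rfl) _ ?_
    exact ⟨{x}, measurableSet_singleton x, rfl⟩
  have hsm : MeasurableSet[MeasurableSpace.comap (s t) inferInstance] (s t ⁻¹' {σ}) :=
    ⟨{σ}, measurableSet_singleton σ, rfl⟩
  have ham : MeasurableSet[MeasurableSpace.comap (a t) inferInstance] (a t ⁻¹' {b}) :=
    ⟨{b}, measurableSet_singleton b, rfl⟩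
  have hboth : MeasurableSet[past a s q t ⊔ MeasurableSpace.comap (s t) inferInstance]
      ({ω | q t ω = x} ∩ s t ⁻¹' {σ}) :=
    MeasurableSet.inter (le_sup_left (a := past a s q t) _ hqm)
      (le_sup_right (b := MeasurableSpace.comap (s t) inferInstance) _ hsm)
  have h1 := (Indep_iff _ _ _).1 (h.indep_arrival t) _ _ ham hboth
  have h2 := h.schedule_law t _ {σ} hqm
  have hqm' : MeasurableSet {ω | q t ω = x} := h.measurable_queue t (measurableSet_singleton x)
  have h3 : ∫⁻ ω in {ω | q t ω = x}, uniformOn (maxWeightSchedules (q t ω)) {σ} ∂P =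
      ∫⁻ ω in {ω | q t ω = x}, uniformOn (maxWeightSchedules x) {σ} ∂P :=
    setLIntegral_congr_fun hqm' fun ω hω => by
      have : q t ω = x := hω
      simp only [this]
  rw [h3, setLIntegral_const] at h2
  have e : {ω | q t ω = x ∧ s t ω = σ ∧ a t ω = b} =
      a t ⁻¹' {b} ∩ ({ω | q t ω = x} ∩ s t ⁻¹' {σ}) := by
    ext ω; simp; tauto
  rw [e, h1, h2, ← h.map_arrival_eq t,
    Measure.map_apply (h.measurable_arrival t) (measurableSet_singleton b)]
  ring

variable [IsProbabilityMeasure P]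

/-- The Markov property: the joint law of state, schedule and arrivals is a kernel product, which on
a countable space may be checked on singletons. -/
lemma integral_queue_succ (h : IsMaxWeightSwitch P amax a s q)
    {lam σ : Matrix (Fin n) (Fin n) ℝ} (hα : IsArrivalLaw (P.map (a 0)) amax lam σ)
    {f : NatArray n → ℝ} {C : ℝ} (hC : ∀ x, |f x| ≤ C) (t : ℕ) :
    ∫ ω, f (q (t + 1) ω) ∂P = ∫ ω, hα.avg f (q t ω) ∂P := by
  have := hα.isProbabilityMeasure
  have hqm := h.measurable_queue t
  have : IsProbabilityMeasure (P.map (q t)) := Measure.isProbabilityMeasure_map hqm.aemeasurable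
  set K : Kernel (NatArray n) (NatArray n × NatArray n) :=
    ⟨fun x => (uniformOn (maxWeightSchedules x)).prod (P.map (a 0)), Measurable.of_discrete⟩
    with hK
  have : IsMarkovKernel K := ⟨fun x => by
    change IsProbabilityMeasure ((uniformOn (maxWeightSchedules x)).prod (P.map (a 0)))
    infer_instance⟩
  have hXm : Measurable fun ω => (q t ω, (s t ω, a t ω)) :=
    hqm.prodMk ((h.measurable_schedule t).prodMk (h.measurable_arrival t))
  have hjoint : P.map (fun ω => (q t ω, (s t ω, a t ω))) = (P.map (q t)) ⊗ₘ K := by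
    refine Measure.ext_of_singleton fun ⟨x, σ', b⟩ => ?_
    rw [Measure.map_apply hXm (measurableSet_singleton _)]
    have e : (fun ω => (q t ω, (s t ω, a t ω))) ⁻¹' {(x, σ', b)} =
        {ω | q t ω = x ∧ s t ω = σ' ∧ a t ω = b} := by ext ω; simp
    have e2 : ({(x, σ', b)} : Set (NatArray n × NatArray n × NatArray n)) =
        {x} ×ˢ ({σ'} ×ˢ {b}) := by simp
    rw [e, h.measure_slot, e2, Measure.compProd_apply_prod (measurableSet_singleton _)
      MeasurableSet.of_discrete, lintegral_singleton,
      Measure.map_apply hqm (measurableSet_singleton _)]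
    change _ = ((uniformOn (maxWeightSchedules x)).prod (P.map (a 0))) ({σ'} ×ˢ {b}) * _
    rw [Measure.prod_prod, mul_comm]
    rfl
  set g : NatArray n × NatArray n × NatArray n → ℝ := fun p => f (next p.1 p.2.1 p.2.2) with hg
  have hgi : Integrable g ((P.map (q t)) ⊗ₘ K) :=
    Integrable.of_bound Measurable.of_discrete.aestronglyMeasurable C
      (ae_of_all _ fun p => hC _)
  calc ∫ ω, f (q (t + 1) ω) ∂P = ∫ ω, g (q t ω, (s t ω, a t ω)) ∂P := by
        simp only [h.queue_succ_eq, hg]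
    _ = ∫ p, g p ∂((P.map (q t)) ⊗ₘ K) := by
        rw [← hjoint, integral_map hXm.aemeasurable Measurable.of_discrete.aestronglyMeasurable]
    _ = ∫ x, hα.avg f x ∂(P.map (q t)) := by
        rw [Measure.integral_compProd hgi]
        refine integral_congr_ae (ae_of_all _ fun x => ?_)
        simp only
        rw [IsArrivalLaw.avg_apply, stepLaw, integral_map Measurable.of_discrete.aemeasurable
          Measurable.of_discrete.aestronglyMeasurable]
        rfl
    _ = _ := integral_map hqm.aemeasurable Measurable.of_discrete.aestronglyMeasurable

lemma integral_queue (h : IsMaxWeightSwitch P amax a s q)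
    {lam σ : Matrix (Fin n) (Fin n) ℝ} (hα : IsArrivalLaw (P.map (a 0)) amax lam σ)
    (t : ℕ) {f : NatArray n → ℝ} {C : ℝ} (hC : ∀ x, |f x| ≤ C) :
    ∫ ω, f (q t ω) ∂P = ∫ ω, (hα.avg ^ t) f (q 0 ω) ∂P := by
  induction t generalizing f with
  | zero => simp
  | succ t ih =>
    rw [h.integral_queue_succ hα hC, ih fun x => by simpa using hα.abs_pow_avg_le hC 1 x,
      pow_succ, Module.End.mul_apply]

lemma tendstoInDistribution (h : IsMaxWeightSwitch P amax a s q)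
    {lam σ : Matrix (Fin n) (Fin n) ℝ} (hα : IsArrivalLaw (P.map (a 0)) amax lam σ)
    {π : ProbabilityMeasure (NatArray n)}
    (hlim : ∀ f : NatArray n → ℝ, (∃ C, ∀ x, |f x| ≤ C) → ∀ x,
      Tendsto (fun k => (hα.avg ^ k) f x) atTop (𝓝 (∫ y, f y ∂(π : Measure (NatArray n))))) :
    TendstoInDistribution q atTop (fun x : NatArray n => x) (fun _ => P)
      (π : Measure (NatArray n)) := by
  refine ⟨fun t => (h.measurable_queue t).aemeasurable, aemeasurable_id, ?_⟩
  refine ProbabilityMeasure.tendsto_iff_forall_integral_tendsto.2 fun f => ?_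
  have hC : ∀ x, |f x| ≤ ‖f‖ := fun x => f.norm_coe_le_norm x
  have h1 := hα.tendsto_integral_pow_avg (P := P) (h.measurable_queue 0) hC (hlim f ⟨_, hC⟩)
  simp only [ProbabilityMeasure.coe_mk]
  have e : ∫ x, f x ∂((π : Measure (NatArray n)).map fun x => x) =
      ∫ x, f x ∂(π : Measure (NatArray n)) := by
    rw [Measure.map_id']
  rw [e]
  refine h1.congr fun t => ?_
  rw [integral_map (h.measurable_queue t).aemeasurable
    Measurable.of_discrete.aestronglyMeasurable, h.integral_queue hα t hC]

end IsMaxWeightSwitch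

/-! ### Heavy traffic -/

/-- The power is ε^(1-1/r) with positive exponent, and M stays bounded. -/
lemma tendsto_mul_rpow_neg {r : ℕ} (hr : 2 ≤ r) {M : ℝ → ℝ} {B : ℝ}
    (hM : ∀ᶠ ε in 𝓝[>] (0 : ℝ), |M ε| ≤ B) :
    Tendsto (fun ε : ℝ => ε * ε ^ (-(1 / (r : ℝ))) * M ε) (𝓝[>] 0) (𝓝 0) := by
  have hr2 : (2 : ℝ) ≤ r := by exact_mod_cast hr
  have hinv : 0 < 1 - 1 / (r : ℝ) := by
    have : 1 / (r : ℝ) ≤ 1 / 2 := by gcongr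
    linarith
  have h1 : Tendsto (fun ε : ℝ => ε ^ (1 - 1 / (r : ℝ))) (𝓝[>] 0) (𝓝 0) := by
    have := (Real.continuousAt_rpow_const 0 (1 - 1 / (r : ℝ)) (Or.inr hinv.le)).tendsto
    rw [Real.zero_rpow hinv.ne'] at this
    exact this.mono_left nhdsWithin_le_nhds
  have h2 := h1.zero_mul_isBoundedUnder_le (g := M)
    (isBoundedUnder_of_eventually_le (a := B) hM)
  refine h2.congr' ?_
  filter_upwards [self_mem_nhdsWithin] with ε hε
  rw [show (1 - 1 / (r : ℝ)) = 1 + -(1 / (r : ℝ)) by ring, Real.rpow_add hε, Real.rpow_one]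

lemma tendsto_mul_lowerError {r : ℕ} (hr : 2 ≤ r) {M : ℝ → ℝ} {B : ℝ}
    (hM : ∀ᶠ ε in 𝓝[>] (0 : ℝ), |M ε| ≤ B) :
    Tendsto (fun ε : ℝ => ε * lowerError n r ε (M ε)) (𝓝[>] 0) (𝓝 0) := by
  have h0 : Tendsto (fun ε : ℝ => ε) (𝓝[>] 0) (𝓝 0) := nhdsWithin_le_nhds
  have h1 := (tendsto_mul_rpow_neg hr hM).const_mul (3 * (n : ℝ) ^ (2 - 1 / (r : ℝ)))
  have h2 := ((h0.mul h0).const_mul (-((n : ℝ) / 2))).add (h0.mul_const (n : ℝ))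
  have h3 := h2.add h1
  simp only [mul_zero, zero_mul, add_zero] at h3
  refine h3.congr fun ε => ?_
  rw [lowerError]; ring

lemma tendsto_mul_upperError {r : ℕ} (hr : 2 ≤ r) {M : ℝ → ℝ} {B : ℝ}
    (hM : ∀ᶠ ε in 𝓝[>] (0 : ℝ), |M ε| ≤ B) :
    Tendsto (fun ε : ℝ => ε * upperError n r ε (M ε)) (𝓝[>] 0) (𝓝 0) := by
  have h0 : Tendsto (fun ε : ℝ => ε) (𝓝[>] 0) (𝓝 0) := nhdsWithin_le_nhds
  have h1 := (tendsto_mul_rpow_neg hr hM).const_mul (2 * (n : ℝ) ^ (2 - 1 / (r : ℝ)))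
  have h2 := ((h0.mul h0).const_mul ((n : ℝ) / 2)).add (h0.mul_const ((n : ℝ) / 2))
  have h3 := h2.add h1
  simp only [mul_zero, zero_mul, add_zero] at h3
  refine h3.congr fun ε => ?_
  rw [upperError]; ring

lemma exists_collapseConst_le (n r : ℕ) {νmin : ℝ} (hν : 0 < νmin) (amax A : ℝ) :
    ∃ B, ∀ lam σ : Matrix (Fin n) (Fin n) ℝ, vnorm lam ^ 2 + vnorm σ ^ 2 ≤ A →
      collapseConst lam σ νmin amax r ≤ B := by
  refine ⟨2 ^ (1 / (r : ℝ)) * max (8 * (A + n) / νmin)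
    ((√(r : ℝ) * Real.exp 1) ^ (1 / (r : ℝ)) * 16 * (r / Real.exp 1) * (n * amax / νmin)
      * (n * amax + 1)), fun lam σ hA => ?_⟩
  unfold collapseConst
  gcongr

end MaxWeightSwitch

/-! ### The main theorem -/

theorem theorem1 {n : ℕ} (hn : 0 < n) (ν : Matrix (Fin n) (Fin n) ℝ)
    (hν : ν ∈ doublyStochastic ℝ (Fin n)) (hνmin : 0 < minEntry ν)
    (amax : ℝ) (hamax : 1 ≤ amax) (σ : ℝ → Matrix (Fin n) (Fin n) ℝ)
    {Ω : ℝ → Type*} [∀ ε, MeasurableSpace (Ω ε)]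
    (P : ∀ ε, Measure (Ω ε)) [∀ ε, IsProbabilityMeasure (P ε)]
    (a s q : ∀ ε, ℕ → Ω ε → NatArray n)
    (hswitch : ∀ ε ∈ Set.Ioo (0 : ℝ) 1, IsMaxWeightSwitch (P ε) amax (a ε) (s ε) (q ε))
    (hmean : ∀ ε ∈ Set.Ioo (0 : ℝ) 1, ∀ t i j,
      ∫ ω, (a ε t ω i j : ℝ) ∂(P ε) = (1 - ε) * ν i j)
    (hvar : ∀ ε ∈ Set.Ioo (0 : ℝ) 1, ∀ t i j,
      variance (fun ω => (a ε t ω i j : ℝ)) (P ε) = σ ε i j ^ 2) :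
    ∃ π : ℝ → ProbabilityMeasure (NatArray n),
      -- `π ε` is the steady-state law, and the queue lengths converge to it in distribution
      (∀ ε ∈ Set.Ioo (0 : ℝ) 1,
        IsStationaryLaw ((P ε).map (a ε 0)) (π ε : Measure (NatArray n)) ∧
        (∀ π' : ProbabilityMeasure (NatArray n),
          IsStationaryLaw ((P ε).map (a ε 0)) (π' : Measure (NatArray n)) → π' = π ε) ∧
        TendstoInDistribution (q ε) atTop (fun x : NatArray n => x) (fun _ => P ε)
          (π ε : Measure (NatArray n))) ∧
      -- the bounds for each system
      (∀ ε : ℝ, 0 < ε → ε ≤ minEntry ν / (2 * vnorm ν) →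
        Integrable totalQueue (π ε : Measure (NatArray n)) ∧
        ∀ r : ℕ, 2 ≤ r →
          (1 - 1 / (2 * (n : ℝ))) * (vnorm (σ ε) ^ 2 / ε)
              - lowerError n r ε (collapseConst ((1 - ε) • ν) (σ ε) (minEntry ν) amax r)
            ≤ ∫ x, totalQueue x ∂(π ε : Measure (NatArray n)) ∧
          ∫ x, totalQueue x ∂(π ε : Measure (NatArray n))
            ≤ (1 - 1 / (2 * (n : ℝ))) * (vnorm (σ ε) ^ 2 / ε)
              + upperError n r ε (collapseConst ((1 - ε) • ν) (σ ε) (minEntry ν) amax r)) ∧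
      -- the error terms are `o(1/ε)`
      (∀ r : ℕ, 2 ≤ r →
        Tendsto (fun ε : ℝ =>
          ε * lowerError n r ε (collapseConst ((1 - ε) • ν) (σ ε) (minEntry ν) amax r))
          (𝓝[>] 0) (𝓝 0) ∧
        Tendsto (fun ε : ℝ =>
          ε * upperError n r ε (collapseConst ((1 - ε) • ν) (σ ε) (minEntry ν) amax r))
          (𝓝[>] 0) (𝓝 0)) ∧
      -- the heavy traffic limit
      (∀ σ₀ : Matrix (Fin n) (Fin n) ℝ,
        (∀ i j, Tendsto (fun ε => σ ε i j ^ 2) (𝓝[>] 0) (𝓝 (σ₀ i j ^ 2))) →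
        Tendsto (fun ε : ℝ => ε * ∫ x, totalQueue x ∂(π ε : Measure (NatArray n)))
          (𝓝[>] 0) (𝓝 ((1 - 1 / (2 * (n : ℝ))) * vnorm σ₀ ^ 2))) := by
  have hα : ∀ ε ∈ Set.Ioo (0 : ℝ) 1,
      IsArrivalLaw ((P ε).map (a ε 0)) amax ((1 - ε) • ν) (σ ε) := fun ε hε =>
    (hswitch ε hε).isArrivalLaw hamax (fun i j => by simpa using hmean ε hε 0 i j)
      fun i j => hvar ε hε 0 i j
  have hex : ∀ ε : ℝ, ∃ π : ProbabilityMeasure (NatArray n), ε ∈ Set.Ioo (0 : ℝ) 1 →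
      (IsStationaryLaw ((P ε).map (a ε 0)) (π : Measure (NatArray n)) ∧
        (∀ π' : ProbabilityMeasure (NatArray n),
          IsStationaryLaw ((P ε).map (a ε 0)) (π' : Measure (NatArray n)) → π' = π) ∧
        TendstoInDistribution (q ε) atTop (fun x : NatArray n => x) (fun _ => P ε)
          (π : Measure (NatArray n))) ∧
      ∀ k : ℕ, Integrable (fun x => ‖vec x‖ ^ k) (π : Measure (NatArray n)) := by
    intro ε
    by_cases hε : ε ∈ Set.Ioo (0 : ℝ) 1
    · obtain ⟨π, h1, h2, h3⟩ := (hα ε hε).exists_stationary hn hν hνmin hε.1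
      exact ⟨π, fun _ => ⟨⟨h1, fun π' hπ' => (hα ε hε).eq_of_isStationaryLaw h2 hπ',
        (hswitch ε hε).tendstoInDistribution (hα ε hε) h2⟩, h3⟩⟩
    -- A default law: nothing is claimed outside (0, 1).
    · exact ⟨⟨Measure.dirac 0, inferInstance⟩, fun h => absurd h hε⟩
  choose π hπ using hex
  have hνv : minEntry ν ≤ vnorm ν := by
    rw [← norm_matVec]
    exact (minEntry_le ν ⟨0, hn⟩ ⟨0, hn⟩).trans
      ((le_abs_self _).trans (abs_apply_le_norm (matVec ν) (⟨0, hn⟩, ⟨0, hn⟩)))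
  have hv0 : 0 < vnorm ν := hνmin.trans_le hνv
  -- No entry of ν exceeds its norm, so the threshold is at most 1/2.
  have hmem : ∀ ε : ℝ, 0 < ε → ε ≤ minEntry ν / (2 * vnorm ν) → ε ∈ Set.Ioo (0 : ℝ) 1 :=
    fun ε h0 h1 => ⟨h0, h1.trans_lt (by rw [div_lt_one (by positivity)]; linarith)⟩
  have hbounds : ∀ ε : ℝ, 0 < ε → ε ≤ minEntry ν / (2 * vnorm ν) →
      Integrable totalQueue (π ε : Measure (NatArray n)) ∧
      ∀ r : ℕ, 2 ≤ r →
        (1 - 1 / (2 * (n : ℝ))) * (vnorm (σ ε) ^ 2 / ε)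
            - lowerError n r ε (collapseConst ((1 - ε) • ν) (σ ε) (minEntry ν) amax r)
          ≤ ∫ x, totalQueue x ∂(π ε : Measure (NatArray n)) ∧
        ∫ x, totalQueue x ∂(π ε : Measure (NatArray n))
          ≤ (1 - 1 / (2 * (n : ℝ))) * (vnorm (σ ε) ^ 2 / ε)
            + upperError n r ε (collapseConst ((1 - ε) • ν) (σ ε) (minEntry ν) amax r) := by
    intro ε h0 h1
    have hε := hmem ε h0 h1
    obtain ⟨⟨hst, -, -⟩, hint⟩ := hπ ε hε
    have hi1 : Integrable (fun x => ‖vec x‖) (π ε : Measure (NatArray n)) := by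
      simpa using hint 1
    refine ⟨(hi1.const_mul ((n : ℝ) ^ 2)).mono' Measurable.of_discrete.aestronglyMeasurable
      (ae_of_all _ fun x => ?_), fun r hr => ?_⟩
    · rw [Real.norm_of_nonneg (totalQueue_nonneg x)]; exact totalQueue_le x
    · refine (hα ε hε).integral_totalQueue_bounds hn hν hνmin h0 ?_ hst hi1 (hint 2) hr
      rw [le_div_iff₀ (by positivity)] at h1
      linarith
  have herr : ∀ r : ℕ, ∃ B : ℝ, ∀ᶠ ε in 𝓝[>] (0 : ℝ),
      |collapseConst ((1 - ε) • ν) (σ ε) (minEntry ν) amax r| ≤ B := fun r => by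
    obtain ⟨B, hB⟩ := exists_collapseConst_le n r hνmin amax (n ^ 2 * amax ^ 2)
    refine ⟨B, ?_⟩
    filter_upwards [Ioo_mem_nhdsGT (zero_lt_one (α := ℝ))] with ε hε
    rw [abs_of_nonneg (mul_nonneg (by positivity) (le_max_of_le_left (by positivity)))]
    exact hB _ _ (hα ε hε).vnorm_sq_add_vnorm_sq_le
  have hlow : ∀ r : ℕ, 2 ≤ r → Tendsto (fun ε : ℝ =>
      ε * lowerError n r ε (collapseConst ((1 - ε) • ν) (σ ε) (minEntry ν) amax r))
      (𝓝[>] 0) (𝓝 0) := fun r hr => tendsto_mul_lowerError hr (herr r).choose_spec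
  have hupp : ∀ r : ℕ, 2 ≤ r → Tendsto (fun ε : ℝ =>
      ε * upperError n r ε (collapseConst ((1 - ε) • ν) (σ ε) (minEntry ν) amax r))
      (𝓝[>] 0) (𝓝 0) := fun r hr => tendsto_mul_upperError hr (herr r).choose_spec
  refine ⟨π, fun ε hε => (hπ ε hε).1, hbounds, fun r hr => ⟨hlow r hr, hupp r hr⟩,
    fun σ₀ hσ₀ => ?_⟩
  have hv : Tendsto (fun ε => (1 - 1 / (2 * (n : ℝ))) * vnorm (σ ε) ^ 2) (𝓝[>] 0)
      (𝓝 ((1 - 1 / (2 * (n : ℝ))) * vnorm σ₀ ^ 2)) := by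
    simp only [vnorm_sq]
    exact (tendsto_finsetSum _ fun i _ => tendsto_finsetSum _ fun j _ => hσ₀ i j).const_mul _
  have hev : ∀ᶠ ε in 𝓝[>] (0 : ℝ), 0 < ε ∧ ε ≤ minEntry ν / (2 * vnorm ν) := by
    filter_upwards [Ioo_mem_nhdsGT (show 0 < minEntry ν / (2 * vnorm ν) by positivity)]
      with ε hε using ⟨hε.1, hε.2.le⟩
  -- Any r would do for the squeeze; r = 2 is taken.
  refine tendsto_of_tendsto_of_tendsto_of_le_of_le' (by simpa using hv.sub (hlow 2 le_rfl))
    (by simpa using hv.add (hupp 2 le_rfl)) ?_ ?_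
  · filter_upwards [hev] with ε hε
    have h1 := mul_le_mul_of_nonneg_left ((hbounds ε hε.1 hε.2).2 2 le_rfl).1 hε.1.le
    refine le_trans (le_of_eq ?_) h1
    have := hε.1
    field_simp
  · filter_upwards [hev] with ε hε
    have h1 := mul_le_mul_of_nonneg_left ((hbounds ε hε.1 hε.2).2 2 le_rfl).2 hε.1.le
    refine h1.trans (le_of_eq ?_)
    have := hε.1
    field_simp
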